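/- Let $\mathbf G=\{G_i: i\ge 1\}$ be a sequence of i.i.d. standard Gaussian random variables, let $\mathfrak H$ be a real separable Hilbert space with orthonormal basis $\{e_i: i\ge1\}$, and let $\mathfrak H^{\otimes m}$ (resp. $\mathfrak H^{\odot m}$) be its $m$-th Hilbert tensor power (resp. symmetric tensor power). Let $H_k$ be the Hermite polynomials ($H_0=1$, $H_{k+1}(x)=xH_k(x)-H_k'(x)$). For a multi-index $q=(q_i)_{i\ge1}$ of nonnegative integers with $|q|=\sum_i q_i=d$, let $\tilde e(q)\in\mathfrak H^{\odot d}$ be the symmetrization of the tensor product in which each $e_i$ occurs $q_i$ times, and let $\Phi(q)=\prod_i H_{q_i}(G_i)$. For $h=\sum_{|q|=d}c_q\tilde e(q)\in\mathfrak H^{\odot d}$ set $I_d(h)=\sum_{|q|=d}c_q\Phi(q)$ (convergence in $L^2$). For $h=\sum_{j_1,\dots,j_d} a(j_1,\dots,j_d)\,e_{j_1}\otimes\cdots\otimes e_{j_d}$ and $1\le r\le d-1$, let $h\,\tilde\otimes_r\,h$ be the symmetrization of the contraction $h\otimes_r h\in\mathfrak H^{\otimes(2d-2r)}$, whose coefficient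 at $(j_1,\dots,j_{2d-2r})$ is $$\sum_{i_1,\dots,i_r\ge1} a(i_1,\dots,i_r,j_1,\dots,j_{d-r})\,a(i_1,\dots,i_r,j_{d-r+1},\dots,j_{2d-2r}).$$ For random variables $F,Z$ put $d_{\mathrm{BW}}(F,Z)=\sup|E[g(F)]-E[g(Z)]|$, the supremum being over all $g:\mathbb R\to\mathbb R$ bounded by $1$ in absolute value and Lipschitz with constant at most $1$. Fix an even integer $d\ge2$ and an integer $\nu\ge1$. Let $F=I_d(h)$, $h\in\mathfrak H^{\odot d}$, be such that $E(F^2)=2\nu$, let $Z_\nu$ have the centered chi-square law with $\nu$ degrees of freedom, i.e. the law of $\sum_{i=1}^{\nu}(G_i^2-1)$, and write $$T_3(F)=\Big[4\,d!\,\Big\|h-\tfrac{d!^2}{4\,(d/2)!^3}\,h\,\tilde\otimes_{d/2}\,h\Big\|^2_{\mathfrak H^{\otimes d}}+d^2\sum_{\substack{1\le r\le d-1\\ r\ne d/2}}(r-1)!^2\binom{d-1}{r-1}^4(2d-2r)!\,\|h\,\tilde\otimes_r\,h\|^2_{\mathfrak H^{\otimes(2d-2r)}}\Big]^{1/2},$$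 $$T_4(F)=\sqrt{\tfrac{d-1}{3d}\,\big|E(F^4)-12E(F^3)-12\nu^2+48\nu\big|}.$$ Then $F$ has a finite fourth moment, $$T_3(F)\le T_4(F)\qquad\text{and}\qquad d_{\mathrm{BW}}(F,Z_\nu)\le\max\Big\{\sqrt{\tfrac{2\pi}{\nu}},\ \tfrac1\nu+\tfrac2{\nu^2}\Big\}\,T_3(F).$$ -/

import Mathlib

open MeasureTheory ProbabilityTheory Filter Topology
open scoped Nat ENNReal NNReal

namespace WienerChaos

noncomputable section

/-! ## Tensor powers of a real separable Hilbert space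

Let `H` be a real Hilbert space with orthonormal basis `e : HilbertBasis ℕ ℝ H`. The Hilbert tensor
power of order `m` is the Hilbert space with orthonormal basis `e_{j 0} ⊗ ⋯ ⊗ e_{j (m-1)}`, where
`j` runs over `Fin m → ℕ`; its elements are written through their square summable coordinates. -/

/-- The Hilbert tensor power of order `m`, in the coordinates given by an orthonormal basis. -/
abbrev TensorPower (m : ℕ) : Type := lp (fun _ : Fin m → ℕ => ℝ) 2

lemma memℓp_two_iff {ι : Type*} {f : ι → ℝ} :
    Memℓp f 2 ↔ Summable fun i => f i ^ 2 := by
  rw [memℓp_gen_iff (by norm_num)]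
  simp

lemma TensorPower.summable_sq {m : ℕ} (f : TensorPower m) : Summable fun j => f j ^ 2 :=
  memℓp_two_iff.1 (lp.memℓp f)

section Tensor

variable {H : Type*} [NormedAddCommGroup H] [InnerProductSpace ℝ H]

lemma hasSum_prod_pi : ∀ (m : ℕ) (g : Fin m → ℕ → ℝ) (s : Fin m → ℝ),
    (∀ i, Summable fun k => |g i k|) → (∀ i, HasSum (g i) (s i)) →
      (Summable fun j : Fin m → ℕ => |∏ i, g i (j i)|) ∧
        HasSum (fun j : Fin m → ℕ => ∏ i, g i (j i)) (∏ i, s i) := by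
  intro m
  induction m with
  | zero =>
    intro g s _ _
    refine ⟨(hasSum_fintype _).summable, ?_⟩
    simp
  | succ m ih =>
    intro g s ha hs
    obtain ⟨h1, h2⟩ := ih (fun i => g i.succ) (fun i => s i.succ) (fun i => ha _) (fun i => hs _)
    have hsum := (ha 0).mul_of_nonneg h1 (fun _ => abs_nonneg _) (fun _ => abs_nonneg _)
    have hs' : Summable fun x : ℕ × (Fin m → ℕ) => g 0 x.1 * ∏ i, g i.succ (x.2 i) :=
      Summable.of_abs (by simpa only [abs_mul] using hsum)
    constructor
    · rw [← (Fin.consEquiv (fun _ : Fin (m + 1) => ℕ)).summable_iff]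
      convert hsum using 2 with x
      simp [Fin.prod_univ_succ, Fin.consEquiv, abs_mul]
    · rw [← (Fin.consEquiv (fun _ : Fin (m + 1) => ℕ)).hasSum_iff]
      rw [Fin.prod_univ_succ]
      simpa [Function.comp_def, Fin.consEquiv, Fin.prod_univ_succ] using (hs 0).mul h2 hs'

/-- The elementary tensor `v 0 ⊗ ⋯ ⊗ v (m-1)`; its coordinate at `e_{j 0} ⊗ ⋯ ⊗ e_{j (m-1)}` is
`∏ ⟪e_{j i}, v i⟫`. -/
def tprod (e : HilbertBasis ℕ ℝ H) {m : ℕ} (v : Fin m → H) : TensorPower m :=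
  ⟨fun j => ∏ i, inner ℝ (e (j i)) (v i), memℓp_two_iff.2 <| by
    simp_rw [← Finset.prod_pow]
    have hs : ∀ i, Summable fun k => inner ℝ (e k) (v i) ^ 2 := fun i => by
      simpa [pow_two, real_inner_comm] using e.summable_inner_mul_inner (v i) (v i)
    exact (hasSum_prod_pi m (fun i k => inner ℝ (e k) (v i) ^ 2) _
      (fun i => by simpa using hs i) (fun i => (hs i).hasSum)).2.summable⟩

/-- The elementary tensors have the inner products that characterise the Hilbert tensor power. -/
theorem inner_tprod (e : HilbertBasis ℕ ℝ H) {m : ℕ} (v w : Fin m → H) :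
    inner ℝ (tprod e v) (tprod e w) = ∏ i, inner ℝ (v i) (w i) := by
  have h := (hasSum_prod_pi m (fun i k => inner ℝ (v i) (e k) * inner ℝ (e k) (w i)) _
    (fun i => (e.summable_inner_mul_inner (v i) (w i)).abs)
    (fun i => e.hasSum_inner_mul_inner (v i) (w i))).2
  rw [lp.inner_eq_tsum, ← h.tsum_eq]
  refine tsum_congr fun j => ?_
  simp [tprod, Finset.prod_mul_distrib, real_inner_comm, mul_comm]

theorem tprod_basis (e : HilbertBasis ℕ ℝ H) {m : ℕ} (j : Fin m → ℕ) :
    tprod e (fun i => e (j i)) = lp.single 2 j (1 : ℝ) := by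
  ext k
  have h := (orthonormal_iff_ite.1 e.orthonormal)
  simp only [tprod, h, lp.single_apply, Pi.single_apply, Finset.prod_ite_zero, funext_iff]
  simp

end Tensor

/-- Symmetric tensors, that is, the elements of the symmetric tensor power. -/
def IsSymmetric {m : ℕ} (f : TensorPower m) : Prop :=
  ∀ (σ : Equiv.Perm (Fin m)) (j : Fin m → ℕ), f (j ∘ σ) = f j

/-- Canonical symmetrization `(1 / m!) ∑_σ f (j ∘ σ)`. -/
def symmetrize {m : ℕ} (f : TensorPower m) : TensorPower m :=
  ⟨fun j => (m ! : ℝ)⁻¹ * ∑ σ : Equiv.Perm (Fin m), f (j ∘ σ), by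
    have h : ∀ σ : Equiv.Perm (Fin m), Memℓp (fun j : Fin m → ℕ => (f (j ∘ σ) : ℝ)) 2 := fun σ =>
      memℓp_two_iff.2 (f.summable_sq.comp_injective σ.surjective.injective_comp_right)
    have h2 : Memℓp (fun j : Fin m → ℕ => ∑ σ : Equiv.Perm (Fin m), (f (j ∘ σ) : ℝ)) 2 :=
      Memℓp.finsetSum Finset.univ (fun σ _ => h σ)
    exact h2.const_mul _⟩

/-- The `r`-th contraction of `f ∈ H^{⊗ p}` and `g ∈ H^{⊗ q}`, where `p = r + s` and `q = r + t`: the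
element of `H^{⊗ (s + t)}` with coordinates
`∑_{i ∈ ℕ^r} f (i, j₁, …, j_s) * g (i, j_{s+1}, …, j_{s+t})`. -/
def contraction {r s t p q n : ℕ} (hp : p = r + s) (hq : q = r + t) (hn : n = s + t)
    (f : TensorPower p) (g : TensorPower q) : TensorPower n :=
  ⟨fun j => ∑' i : Fin r → ℕ,
      f (Fin.append i (fun a : Fin s => j (Fin.cast hn.symm (Fin.castAdd t a))) ∘ Fin.cast hp) *
      g (Fin.append i (fun b : Fin t => j (Fin.cast hn.symm (Fin.natAdd s b))) ∘ Fin.cast hq), by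
    subst hp hq hn
    refine memℓp_two_iff.2 ?_
    have key : ∀ {s : ℕ} (f : TensorPower (r + s)),
        Summable fun x : (Fin s → ℕ) × (Fin r → ℕ) => (f (Fin.append x.2 x.1) : ℝ) ^ 2 := by
      intro s f
      refine f.summable_sq.comp_injective (i := fun x : (Fin s → ℕ) × (Fin r → ℕ) =>
        Fin.append x.2 x.1) ?_
      intro x y hxy
      have := (Fin.appendEquiv r s).injective (a₁ := (x.2, x.1)) (a₂ := (y.2, y.1)) hxy
      simp only [Prod.mk.injEq] at this
      exact Prod.ext this.2 this.1
    have hprod := (key f).prod.mul_of_nonneg (key g).prod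
      (fun _ => tsum_nonneg fun _ => sq_nonneg _) (fun _ => tsum_nonneg fun _ => sq_nonneg _)
    have hcomp := hprod.comp_injective (i := fun j : Fin (s + t) → ℕ =>
        ((fun a : Fin s => j (Fin.castAdd t a)), (fun b : Fin t => j (Fin.natAdd s b))))
      (Fin.appendEquiv s t).symm.injective
    refine hcomp.of_nonneg_of_le (fun _ => sq_nonneg _) (fun j => ?_)
    have hF := (key f).prod_factor (fun a : Fin s => j (Fin.castAdd t a))
    have hG := (key g).prod_factor (fun b : Fin t => j (Fin.natAdd s b))
    have hFm := memℓp_two_iff.2 hF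
    have hGm := memℓp_two_iff.2 hG
    have hcs := real_inner_mul_inner_self_le
      (⟨_, hFm⟩ : lp (fun _ : Fin r → ℕ => ℝ) 2) (⟨_, hGm⟩ : lp (fun _ : Fin r → ℕ => ℝ) 2)
    simp only [lp.inner_eq_tsum] at hcs
    simpa [pow_two, mul_comm] using hcs⟩

/-! ## Wiener chaos -/

/-- Multi-indices `q` with `|q| = d`. -/
abbrev MultiIndex (d : ℕ) : Type := {q : ℕ →₀ ℕ // q.degree = d}

/-- The nondecreasing `d`-tuple in which every index `i` occurs `q i` times. -/
def MultiIndex.tuple {d : ℕ} (q : MultiIndex d) : Fin d → ℕ := fun i =>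
  ((Finsupp.toMultiset q.1).sort).get (Fin.cast (by
    rw [Multiset.length_sort, Finsupp.card_toMultiset]; exact q.2.symm) i)

/-- The symmetrization of `e(q) = e_{i₁}^{⊗ q_{i₁}} ⊗ ⋯ ⊗ e_{i_k}^{⊗ q_{i_k}}`. -/
def symmBasis {H : Type*} [NormedAddCommGroup H] [InnerProductSpace ℝ H]
    (e : HilbertBasis ℕ ℝ H) {d : ℕ} (q : MultiIndex d) : TensorPower d :=
  symmetrize (tprod e fun i => e (q.tuple i))

/-- `Φ(q) = ∏_i H_{q_i}(G_i)`, with the probabilists' Hermite polynomials. -/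
def hermiteProd {Ω : Type*} (G : ℕ → Ω → ℝ) {d : ℕ} (q : MultiIndex d) (ω : Ω) : ℝ :=
  ∏ i ∈ q.1.support, Polynomial.aeval (G i ω) (Polynomial.hermite (q.1 i))

/-- `G` is a sequence of independent standard Gaussian random variables. -/
structure IsStdGaussianSeq {Ω : Type*} [MeasurableSpace Ω] (G : ℕ → Ω → ℝ) (P : Measure Ω) :
    Prop where
  hasLaw : ∀ i, HasLaw (G i) (gaussianReal 0 1) P
  indep : iIndepFun G P

/-- `F = I_d(h)` almost surely: `h = ∑_{|q| = d} c_q ẽ(q)` in the tensor power of order `d`, and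
`F = ∑_{|q| = d} c_q Φ(q)` in `L²(P)`. -/
def IsChaosIntegral {H : Type*} [NormedAddCommGroup H] [InnerProductSpace ℝ H]
    (e : HilbertBasis ℕ ℝ H) {Ω : Type*} [MeasurableSpace Ω] (G : ℕ → Ω → ℝ) (P : Measure Ω)
    {d : ℕ} (h : TensorPower d) (F : Ω → ℝ) : Prop :=
  MemLp F 2 P ∧ ∃ c : MultiIndex d → ℝ,
    HasSum (fun q => c q • symmBasis e q) h ∧
    Tendsto (fun S : Finset (MultiIndex d) =>
      eLpNorm (fun ω => F ω - ∑ q ∈ S, c q * hermiteProd G q ω) 2 P) atTop (𝓝 0)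

/-! ## Chi-square law, bounded Wasserstein distance, and the two quantities of the bounds -/

/-- The centered chi-square law with `ν` degrees of freedom: the law of `∑_{i ≤ ν} (G_i² - 1)`. -/
def centeredChiSq (ν : ℕ) : Measure ℝ :=
  (Measure.pi fun _ : Fin ν => gaussianReal 0 1).map fun x => ∑ i, (x i ^ 2 - 1)

/-- The bounded Wasserstein (Fortet–Mourier) distance between the laws of two random variables. For
probability measures the supremum is over a nonempty set of reals bounded by `2`. -/
def dBW {Ω Ω' : Type*} [MeasurableSpace Ω] [MeasurableSpace Ω'] (P : Measure Ω) (F : Ω → ℝ)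
    (P' : Measure Ω') (Z : Ω' → ℝ) : ℝ :=
  sSup {x | ∃ g : ℝ → ℝ, LipschitzWith 1 g ∧ (∀ y, |g y| ≤ 1) ∧
    x = |∫ ω, g (F ω) ∂P - ∫ ω, g (Z ω) ∂P'|}

lemma eq_half_add_half {d : ℕ} (hd : Even d) : d = d / 2 + d / 2 := by
  have := hd.two_dvd
  omega

/-- The contraction quantity `T₃`, as a function of the kernel `h`. -/
def T3 {d : ℕ} (hd : Even d) (h : TensorPower d) : ℝ :=
  Real.sqrt (
    4 * (d ! : ℝ) * ‖h - ((d ! : ℝ) ^ 2 / (4 * ((d / 2)! : ℝ) ^ 3)) •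
      symmetrize (contraction (eq_half_add_half hd) (eq_half_add_half hd) (eq_half_add_half hd)
        h h)‖ ^ 2 +
    (d : ℝ) ^ 2 * ∑ r ∈ (Finset.univ : Finset (Fin d)).filter fun r : Fin d => 1 ≤ (r : ℕ) ∧ (r : ℕ) ≠ d / 2,
      ((r - 1 : ℕ)! : ℝ) ^ 2 * ((d - 1).choose (r - 1) : ℝ) ^ 4 * ((2 * d - 2 * r)! : ℝ) *
        ‖symmetrize (contraction (r := r) (s := d - r) (t := d - r) (n := 2 * d - 2 * r)
          (by omega) (by omega) (by omega) h h)‖ ^ 2)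

/-- The moment quantity `T₄`. -/
def T4 {Ω : Type*} [MeasurableSpace Ω] (P : Measure Ω) (d ν : ℕ) (F : Ω → ℝ) : ℝ :=
  Real.sqrt (((d : ℝ) - 1) / (3 * d) *
    |(∫ ω, F ω ^ 4 ∂P) - 12 * (∫ ω, F ω ^ 3 ∂P) - 12 * (ν : ℝ) ^ 2 + 48 * ν|)

end

end WienerChaos

namespace WienerChaos

/-! ## Wick polynomials -/

section Wick

open MvPolynomial

/-! The argument is Malliavin–Stein in polynomial form. A kernel supported on finitely many basis
vectors is a homogeneous polynomial `p` of degree `d`, and its integral is `F = wick p`, where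
`wick` replaces monomials by Hermite products. Two facts about `wick` suffice: it turns
multiplication by a variable into `X k - ∂ₖ` (`wick_X_mul`) and it commutes with derivatives
(`pderiv_wick`). They give the product formula, with the contractions `∑ ∂^r f ∂^r g`, and, since `X
i - ∂ᵢ` is the Gaussian adjoint of `∂ᵢ`, the orthogonality of chaoses and `E[F f(F)] = E[f'(F)
|∇F|²] / d`.

Expanding `|∇F|² / d` in chaoses yields `E[(2F + 2ν - |∇F|²/d)²] = (2ν - E F²)² + T₃²`. The same
expansion of `E F³` and `E F⁴` writes the moment combination as a sum of the squares in `T₃²` with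
larger weights (`steinDiscrepancy_le`); this is `T₃ ≤ T₄`.

For the distance, Stein's equation `2 (x + ν) ψ' - x ψ = g - E g(Z)` has a solution with `|ψ'| ≤
√(2π/ν)`, so `|E g(F) - E g(Z)| = |E[ψ'(F) (2F + 2ν - |∇F|²/d)]|` is at most `√(2π/ν) T₃` by
Cauchy–Schwarz when `E F² = 2ν`. The bound on `ψ'` is the analytic core. With `y = x + ν`, `b = ν/2`
and `w(y) = y^b e^{-y/2}`, monotonicity first gives `|ψ| ≤ 1` for `y > 0`; then `U = y w ψ'`
satisfies `|U'| ≤ w` and vanishes at `0` and `∞`, so `|U|` is at most either tail mass of `w`. These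
masses are compared with `y w(y)` through their first moments. For `y ≤ 0` an explicit integral
gives `1/ν`, which is smaller.

General kernels follow by approximation: `T₃` is continuous because contractions are bounded, and on
a fixed chaos the `L⁴` norm is controlled by the norm of the kernel, so that all the moments
converge. -/

lemma pderiv_aeval_X {ι : Type*} [DecidableEq ι] (k i : ι) (p : Polynomial ℤ) :
    pderiv k (Polynomial.aeval (X i : MvPolynomial ι ℝ) p) =
      if i = k then Polynomial.aeval (X i : MvPolynomial ι ℝ) (Polynomial.derivative p) else 0 := by
  induction p using Polynomial.induction_on' with
  | add p q hp hq =>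
    rw [map_add, map_add, hp, hq]
    split_ifs <;> simp
  | monomial n a =>
    rw [Polynomial.aeval_monomial, Derivation.leibniz, Derivation.leibniz_pow, pderiv_X,
      Polynomial.derivative_monomial, Polynomial.aeval_monomial]
    rcases eq_or_ne i k with rfl | h
    · simp
      ring
    · simp [h]

lemma pderiv_pderiv_comm {ι : Type*} (i k : ι) (f : MvPolynomial ι ℝ) :
    pderiv i (pderiv k f) = pderiv k (pderiv i f) := by
  classical
  induction f using MvPolynomial.induction_on with
  | C a => simp
  | add p q hp hq => simp [hp, hq]
  | mul_X p j hp =>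
    simp only [Derivation.leibniz, map_add, smul_eq_mul, hp, pderiv_X, Pi.single_apply]
    split_ifs <;> simp <;> ring

variable {ι : Type*} [Fintype ι]

/-- The linear map sending the monomial `x^q` to the Hermite polynomial `∏ i, H_{q i}(x i)`. -/
noncomputable def wick : MvPolynomial ι ℝ →ₗ[ℝ] MvPolynomial ι ℝ :=
  (basisMonomials ι ℝ).constr ℝ fun q =>
    ∏ i, Polynomial.aeval (X i : MvPolynomial ι ℝ) (Polynomial.hermite (q i))

lemma wick_monomial (q : ι →₀ ℕ) :
    wick (monomial q (1 : ℝ)) =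
      ∏ i, Polynomial.aeval (X i : MvPolynomial ι ℝ) (Polynomial.hermite (q i)) := by
  have := (basisMonomials ι ℝ).constr_basis ℝ (fun q : ι →₀ ℕ =>
    ∏ i, Polynomial.aeval (X i : MvPolynomial ι ℝ) (Polynomial.hermite (q i))) q
  rwa [coe_basisMonomials] at this

lemma wick_one : wick (1 : MvPolynomial ι ℝ) = 1 := by
  have h := wick_monomial (ι := ι) 0
  simpa using h

lemma wick_C (a : ℝ) : wick (C a : MvPolynomial ι ℝ) = C a := by
  rw [← mul_one (C a), ← smul_eq_C_mul, map_smul, wick_one]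

/-- The recursion `H_{n+1} = x H_n - H_n'` in the variable `k`; the Hermite factors in the other
variables are constants for `∂ₖ`. -/
lemma wick_X_mul (k : ι) (f : MvPolynomial ι ℝ) :
    wick (X k * f) = X k * wick f - pderiv k (wick f) := by
  classical
  induction f using MvPolynomial.induction_on' with
  | add p q hp hq =>
    rw [mul_add, map_add, hp, hq, map_add, map_add]
    ring
  | monomial q a =>
    have hq : (monomial q a : MvPolynomial ι ℝ) = a • monomial q 1 := by
      rw [smul_monomial, smul_eq_mul, mul_one]
    have hX : (X k : MvPolynomial ι ℝ) * monomial q 1 =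
        monomial (Finsupp.single k 1 + q) 1 := by
      rw [X, monomial_mul, mul_one]
    rw [hq, mul_smul_comm, map_smul, hX, map_smul, Derivation.map_smul, wick_monomial,
      wick_monomial, mul_smul_comm, ← smul_sub]
    congr 1
    rw [← Finset.mul_prod_erase _ _ (Finset.mem_univ k),
      ← Finset.mul_prod_erase Finset.univ _ (Finset.mem_univ k), Derivation.leibniz]
    have h0 : pderiv k (∏ i ∈ Finset.univ.erase k,
        Polynomial.aeval (X i : MvPolynomial ι ℝ) (Polynomial.hermite (q i))) = 0 := by
      refine Finset.prod_induction _ (fun p => pderiv k p = 0) (fun p q hp hq => ?_) (by simp)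
        fun i hi => ?_
      · rw [Derivation.leibniz, hp, hq, smul_zero, smul_zero, add_zero]
      · rw [pderiv_aeval_X, if_neg (Finset.ne_of_mem_erase hi)]
    have h1 : ∏ i ∈ Finset.univ.erase k, Polynomial.aeval (X i : MvPolynomial ι ℝ)
        (Polynomial.hermite ((Finsupp.single k 1 + q : ι →₀ ℕ) i)) =
        ∏ i ∈ Finset.univ.erase k, Polynomial.aeval (X i : MvPolynomial ι ℝ)
        (Polynomial.hermite (q i)) := by
      refine Finset.prod_congr rfl fun i hi => ?_
      rw [Finsupp.add_apply, Finsupp.single_eq_of_ne (Finset.ne_of_mem_erase hi), zero_add]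
    rw [h0, h1, pderiv_aeval_X, if_pos rfl, Finsupp.add_apply, Finsupp.single_eq_same, add_comm 1,
      Polynomial.hermite_succ, map_sub, map_mul, Polynomial.aeval_X, smul_eq_mul, smul_eq_mul]
    ring

/-- The Appell property `H_n' = n H_{n-1}` in several variables. It follows by induction from
`wick_X_mul` alone, because `∂ₖ` commutes with `∂ⱼ` and has commutator `δ_{jk}` with `X j`. -/
lemma pderiv_wick (k : ι) (f : MvPolynomial ι ℝ) : pderiv k (wick f) = wick (pderiv k f) := by
  classical
  induction f using MvPolynomial.induction_on with
  | C a => rw [wick_C, pderiv_C, map_zero]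
  | add p q hp hq => simp [hp, hq]
  | mul_X p j hp =>
    rw [mul_comm, wick_X_mul, map_sub, Derivation.leibniz, Derivation.leibniz, hp,
      pderiv_pderiv_comm, hp, pderiv_X]
    simp only [smul_eq_mul, map_add, wick_X_mul, Pi.single_apply]
    split_ifs <;> simp <;> ring

/-- The symmetrized contraction of order `r` of two polynomials, up to normalization:
`∑ i₁ … i_r, ∂_{i₁} ⋯ ∂_{i_r} f * ∂_{i₁} ⋯ ∂_{i_r} g`. -/
noncomputable def contr : ℕ → MvPolynomial ι ℝ → MvPolynomial ι ℝ → MvPolynomial ι ℝ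
  | 0, f, g => f * g
  | r + 1, f, g => ∑ i, contr r (pderiv i f) (pderiv i g)

lemma contr_add_left (r : ℕ) (f f' g : MvPolynomial ι ℝ) :
    contr r (f + f') g = contr r f g + contr r f' g := by
  induction r generalizing f f' g with
  | zero => exact add_mul _ _ _
  | succ r ih => simp [contr, ih, Finset.sum_add_distrib]

lemma contr_zero_left (r : ℕ) (g : MvPolynomial ι ℝ) : contr r 0 g = 0 := by
  induction r generalizing g with
  | zero => exact zero_mul _
  | succ r ih => simp [contr, ih]

lemma contr_C_left (r : ℕ) (hr : 0 < r) (a : ℝ) (g : MvPolynomial ι ℝ) :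
    contr r (C a) g = 0 := by
  obtain ⟨r, rfl⟩ := Nat.exists_eq_succ_of_ne_zero hr.ne'
  simp [contr, contr_zero_left]

/-- Leibniz: at most one of the `r + 1` derivatives can fall on `X k`; there are `r + 1` choices for
it, and its partner then acts on `g` as `∂ₖ`. -/
lemma contr_X_mul_left (r : ℕ) (k : ι) (f g : MvPolynomial ι ℝ) :
    contr (r + 1) (X k * f) g = X k * contr (r + 1) f g + ((r : ℝ) + 1) • contr r f (pderiv k g) := by
  classical
  -- At `r = 0` the truncated index `r - 1` is harmless, since its coefficient vanishes.
  have key : ∀ r, (∀ f g, contr r (X k * f) g =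
      X k * contr r f g + (r : ℝ) • contr (r - 1) f (pderiv k g)) := by
    intro r
    induction r with
    | zero => intro f g; simp [contr, mul_assoc]
    | succ r ih =>
      intro f g
      have h1 : ∀ i, contr r (pderiv i (X k * f)) (pderiv i g) =
          X k * contr r (pderiv i f) (pderiv i g) +
          (r : ℝ) • contr (r - 1) (pderiv i f) (pderiv k (pderiv i g)) +
          if i = k then contr r f (pderiv k g) else 0 := by
        intro i
        rw [Derivation.leibniz, pderiv_X, contr_add_left, smul_eq_mul, ih, Pi.single_apply]
        rcases eq_or_ne i k with rfl | h
        · simp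
        · simp [h, h.symm, contr_zero_left]
      simp only [contr, h1, Finset.sum_add_distrib, ← Finset.mul_sum, ← Finset.smul_sum,
        Finset.sum_ite_eq', Finset.mem_univ, if_true]
      rw [add_assoc]
      congr 1
      rcases r with _ | r
      · simp [contr]
      · simp only [Nat.add_sub_cancel, contr]
        simp_rw [pderiv_pderiv_comm k]
        push_cast
        module
  simpa using key (r + 1) f g

/-- The product formula for Wick polynomials. -/
lemma exists_wick_mul_wick (f : MvPolynomial ι ℝ) : ∃ R₀, ∀ R ≥ R₀, ∀ g : MvPolynomial ι ℝ,
    wick f * wick g = ∑ r ∈ Finset.range R, ((r ! : ℝ)⁻¹) • wick (contr r f g) := by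
  induction f using MvPolynomial.induction_on with
  | C a =>
    refine ⟨1, fun R hR g => ?_⟩
    rw [Finset.sum_eq_single_of_mem 0 (Finset.mem_range.2 hR)]
    · simp [contr, wick_C, ← smul_eq_C_mul]
    · intro r _ hr
      rw [contr_C_left r (Nat.pos_of_ne_zero hr), map_zero, smul_zero]
  | add p q hp hq =>
    obtain ⟨R₁, h₁⟩ := hp
    obtain ⟨R₂, h₂⟩ := hq
    refine ⟨max R₁ R₂, fun R hR g => ?_⟩
    simp only [map_add, add_mul, contr_add_left, smul_add, Finset.sum_add_distrib]
    rw [h₁ R (le_trans (le_max_left _ _) hR), h₂ R (le_trans (le_max_right _ _) hR)]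
  | mul_X p k hp =>
    obtain ⟨R₀, h₀⟩ := hp
    refine ⟨R₀ + 1, fun R hR g => ?_⟩
    obtain ⟨R, rfl⟩ : ∃ R', R = R' + 1 := ⟨R - 1, by omega⟩
    -- The operator `X k - ∂ₖ` is moved outside the product, where it acts on each Wick summand as
    -- multiplication by `X k`. The correction `wick p * wick (∂ₖ g)` supplies the extra contraction
    -- and is matched with the terms of order one higher.
    have h1 : wick (p * X k) * wick g =
        (X k * (wick p * wick g) - pderiv k (wick p * wick g)) + wick p * wick (pderiv k g) := by
      rw [mul_comm p, wick_X_mul, Derivation.leibniz, pderiv_wick, pderiv_wick, smul_eq_mul,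
        smul_eq_mul]
      ring
    rw [h1, h₀ (R + 1) (by omega) g, h₀ R (by omega) (pderiv k g), Finset.mul_sum, map_sum,
      ← Finset.sum_sub_distrib]
    have h2 : ∀ r, (X k * ((r ! : ℝ)⁻¹ • wick (contr r p g)) -
        pderiv k ((r ! : ℝ)⁻¹ • wick (contr r p g))) =
        (r ! : ℝ)⁻¹ • wick (X k * contr r p g) := by
      intro r
      rw [wick_X_mul, mul_smul_comm, Derivation.map_smul, smul_sub]
    simp_rw [h2]
    rw [Finset.sum_range_succ',
      Finset.sum_range_succ' (fun r => (r ! : ℝ)⁻¹ • wick (contr r (p * X k) g)), add_right_comm,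
      ← Finset.sum_add_distrib]
    congr 1
    · refine Finset.sum_congr rfl fun r _ => ?_
      rw [mul_comm p, contr_X_mul_left, map_add, map_smul, smul_add, smul_smul, Nat.factorial_succ]
      congr 2
      have : (r ! : ℝ) ≠ 0 := by positivity
      push_cast
      field_simp
    · simp [contr, mul_comm p, mul_assoc]

lemma isHomogeneous_contr (r : ℕ) {m n : ℕ} {f g : MvPolynomial ι ℝ} (hf : f.IsHomogeneous m)
    (hg : g.IsHomogeneous n) : (contr r f g).IsHomogeneous ((m - r) + (n - r)) := by
  induction r generalizing f g m n with
  | zero => exact hf.mul hg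
  | succ r ih =>
    refine IsHomogeneous.sum _ _ _ fun i _ => ?_
    have := ih (hf.pderiv (i := i)) (hg.pderiv (i := i))
    rwa [Nat.sub_sub, Nat.sub_sub, add_comm 1 r] at this

lemma contr_eq_zero_of_lt {r m : ℕ} (hr : m < r) {f : MvPolynomial ι ℝ}
    (hf : f.IsHomogeneous m) (g : MvPolynomial ι ℝ) : contr r f g = 0 := by
  induction r generalizing f g m with
  | zero => omega
  | succ r ih =>
    rcases m with _ | m
    · rw [← totalDegree_zero_iff_isHomogeneous, totalDegree_eq_zero_iff_eq_C] at hf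
      rw [hf, contr_C_left _ (Nat.succ_pos r)]
    · exact Finset.sum_eq_zero fun i _ => ih (by omega) (hf.pderiv (i := i)) _

lemma wick_mul_wick {m : ℕ} {f : MvPolynomial ι ℝ} (hf : f.IsHomogeneous m)
    (g : MvPolynomial ι ℝ) :
    wick f * wick g = ∑ r ∈ Finset.range (m + 1), ((r ! : ℝ)⁻¹) • wick (contr r f g) := by
  obtain ⟨R₀, h⟩ := exists_wick_mul_wick f
  rw [h (max R₀ (m + 1)) (le_max_left _ _) g]
  refine (Finset.sum_subset (Finset.range_mono (le_max_right _ _)) fun r _ hr => ?_).symm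
  rw [contr_eq_zero_of_lt (by simpa using hr) hf, map_zero, smul_zero]

/-- The squared norm of the gradient of a Wick polynomial. -/
lemma sum_pderiv_wick_sq {m : ℕ} {f : MvPolynomial ι ℝ} (hf : f.IsHomogeneous (m + 1)) :
    ∑ i, pderiv i (wick f) ^ 2 =
      ∑ r ∈ Finset.range (m + 1), ((r ! : ℝ)⁻¹) • wick (contr (r + 1) f f) := by
  simp_rw [pderiv_wick, sq, wick_mul_wick (hf.pderiv), Nat.add_sub_cancel]
  rw [Finset.sum_comm]
  refine Finset.sum_congr rfl fun r _ => ?_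
  rw [contr, map_sum, Finset.smul_sum]

/-- A homogeneous Wick polynomial as a divergence. -/
lemma nsmul_wick_eq_sum {m : ℕ} {f : MvPolynomial ι ℝ} (hf : f.IsHomogeneous m) :
    m • wick f = ∑ i, (X i * pderiv i (wick f) - pderiv i (pderiv i (wick f))) := by
  rw [← map_nsmul, ← hf.sum_X_mul_pderiv, map_sum]
  simp_rw [wick_X_mul, pderiv_wick]

end Wick

end WienerChaos

namespace WienerChaos

/-! ## Gaussian integration by parts -/

section Gaussian

lemma hasDerivAt_gaussianPDFReal (t : ℝ) :
    HasDerivAt (gaussianPDFReal 0 1) (-(t * gaussianPDFReal 0 1 t)) t := by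
  rw [gaussianPDFReal_def]
  have h1 : HasDerivAt (fun x : ℝ => -(x - 0) ^ 2 / (2 * ((1 : ℝ≥0) : ℝ))) (-t) t := by
    have := ((((hasDerivAt_id t).sub_const 0).pow 2).neg).div_const (2 * ((1 : ℝ≥0) : ℝ))
    convert! this using 1
    simp
    ring
  convert! h1.exp.const_mul (√(2 * Real.pi * ((1 : ℝ≥0) : ℝ)))⁻¹ using 1
  ring

lemma integrable_gaussianReal_iff {u : ℝ → ℝ} :
    Integrable u (gaussianReal 0 1) ↔ Integrable fun t => u t * gaussianPDFReal 0 1 t := by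
  rw [gaussianReal_of_var_ne_zero _ one_ne_zero,
    integrable_withDensity_iff (measurable_gaussianPDF 0 1) (ae_of_all _ fun _ => gaussianPDF_lt_top)]
  simp

/-- Stein's lemma for the standard Gaussian law on the line. -/
lemma integral_id_mul_gaussianReal {u u' : ℝ → ℝ} (hu : ∀ t, HasDerivAt u (u' t) t)
    (h0 : Integrable u (gaussianReal 0 1)) (h1 : Integrable u' (gaussianReal 0 1))
    (h2 : Integrable (fun t => t * u t) (gaussianReal 0 1)) :
    ∫ t, t * u t ∂gaussianReal 0 1 = ∫ t, u' t ∂gaussianReal 0 1 := by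
  rw [integrable_gaussianReal_iff] at h0 h1 h2
  rw [integral_gaussianReal_eq_integral_smul one_ne_zero,
    integral_gaussianReal_eq_integral_smul one_ne_zero]
  have := integral_mul_deriv_eq_deriv_mul_of_integrable (u := u) (u' := u')
    (v := gaussianPDFReal 0 1) (v' := fun t => -(t * gaussianPDFReal 0 1 t))
    (fun t _ => hu t) (fun t _ => hasDerivAt_gaussianPDFReal t)
    (h2.neg.congr (ae_of_all _ fun t => by simp; ring)) h1 h0
  rw [← neg_inj, ← integral_neg]
  calc _ = ∫ t, u t * -(t * gaussianPDFReal 0 1 t) := by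
        refine integral_congr_ae (ae_of_all _ fun t => ?_); simp; ring
    _ = _ := by
        rw [this]; congr 1
        refine integral_congr_ae (ae_of_all _ fun t => ?_); simp; ring

/-- The standard Gaussian law on `ℝ^N`. -/
noncomputable abbrev gaussianPi (N : ℕ) : Measure (Fin N → ℝ) :=
  Measure.pi fun _ => gaussianReal 0 1

/-- Gaussian integration by parts in one coordinate. -/
lemma integral_coord_mul {N : ℕ} (i : Fin N) {u u' : (Fin N → ℝ) → ℝ}
    (hu : ∀ x, HasDerivAt (fun t => u (Function.update x i t)) (u' x) (x i))
    (h0 : Integrable u (gaussianPi N)) (h1 : Integrable u' (gaussianPi N))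
    (h2 : Integrable (fun x => x i * u x) (gaussianPi N)) :
    ∫ x, x i * u x ∂gaussianPi N = ∫ x, u' x ∂gaussianPi N := by
  obtain _ | N := N
  · exact i.elim0
  -- Coordinate `i` is split off and integrated first; for almost every value of the others the
  -- one-dimensional lemma applies.
  have hm := (measurePreserving_piFinSuccAbove (fun _ : Fin (N + 1) => gaussianReal 0 1) i).symm
  have hint : ∀ v : (Fin (N + 1) → ℝ) → ℝ, Integrable v (gaussianPi (N + 1)) →
      Integrable (fun z : ℝ × (Fin N → ℝ) => v (i.insertNth z.1 z.2))
        ((gaussianReal 0 1).prod (gaussianPi N)) := fun v hv =>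
    (hm.integrable_comp_emb (MeasurableEquiv.measurableEmbedding _)).2 hv
  have heq : ∀ v : (Fin (N + 1) → ℝ) → ℝ, Integrable v (gaussianPi (N + 1)) →
      ∫ x, v x ∂gaussianPi (N + 1) =
        ∫ y, ∫ t, v (i.insertNth t y) ∂gaussianReal 0 1 ∂gaussianPi N := fun v hv => by
    rw [← hm.integral_comp' v]
    exact integral_prod_symm _ (hint v hv)
  rw [heq _ h2, heq _ h1]
  refine integral_congr_ae ?_
  filter_upwards [(hint _ h0).prod_left_ae, (hint _ h1).prod_left_ae, (hint _ h2).prod_left_ae]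
    with y g0 g1 g2
  simp only [Fin.insertNth_apply_same] at g2 ⊢
  refine integral_id_mul_gaussianReal (fun t => ?_) g0 g1 g2
  simpa using hu (i.insertNth t y)

end Gaussian

/-! ### Expectations of polynomials in Gaussian variables and orthogonality of Wick powers -/

section GaussianPolynomial

open MvPolynomial

variable {N : ℕ}

lemma hasDerivAt_eval_update (p : MvPolynomial (Fin N) ℝ) (i : Fin N) (x : Fin N → ℝ) :
    HasDerivAt (fun t => eval (Function.update x i t) p) (eval x (pderiv i p)) (x i) := by
  induction p using MvPolynomial.induction_on with
  | C a => simpa using hasDerivAt_const (x i) a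
  | add p q hp hq => simpa using! hp.add hq
  | mul_X p j hp =>
    have hX : HasDerivAt (fun t => Function.update x i t j) (if j = i then 1 else 0) (x i) := by
      rcases eq_or_ne j i with rfl | h
      · simpa using! hasDerivAt_id (x j)
      · simpa [h] using hasDerivAt_const (x i) (x j)
    simp only [map_mul, eval_X]
    convert! hp.mul hX using 1
    rw [Derivation.leibniz, pderiv_X, Pi.single_apply]
    split_ifs <;> simp [mul_comm, add_comm]

/-- Each multiplication by a variable costs a doubling of the exponent by Hölder, so the induction
runs over all finite exponents at once. -/
lemma memLp_eval (p : MvPolynomial (Fin N) ℝ) {q : ℝ≥0∞} (hq : q ≠ ∞) :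
    MemLp (fun x => eval x p) q (gaussianPi N) := by
  induction p using MvPolynomial.induction_on generalizing q with
  | C a => simpa using memLp_const a
  | add p p' hp hp' => simpa using! (hp hq).add (hp' hq)
  | mul_X p i hp =>
    have h2 : 2 * q ≠ ∞ := ENNReal.mul_ne_top (by simp) hq
    have hX : MemLp (fun x : Fin N → ℝ => x i) (2 * q) (gaussianPi N) :=
      (memLp_id_gaussianReal' _ h2).comp_measurePreserving
        (measurePreserving_eval (fun _ : Fin N => gaussianReal 0 1) i)
    have : ENNReal.HolderTriple (2 * q) (2 * q) q := ⟨by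
      rw [ENNReal.mul_inv (by simp) (by simp), ← add_mul, ENNReal.inv_two_add_inv_two, one_mul]⟩
    simpa using! hX.mul' (hp h2)

lemma integrable_eval (p : MvPolynomial (Fin N) ℝ) :
    Integrable (fun x => eval x p) (gaussianPi N) :=
  memLp_one_iff_integrable.1 (memLp_eval p ENNReal.one_ne_top)

/-- The expectation of a polynomial in independent standard Gaussian variables. -/
noncomputable def expect : MvPolynomial (Fin N) ℝ →ₗ[ℝ] ℝ where
  toFun p := ∫ x, eval x p ∂gaussianPi N
  map_add' p q := by
    simp only [map_add]
    exact integral_add (integrable_eval p) (integrable_eval q)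
  map_smul' a p := by simp [smul_eval, integral_const_mul]

lemma expect_apply (p : MvPolynomial (Fin N) ℝ) : expect p = ∫ x, eval x p ∂gaussianPi N := rfl

lemma expect_C (a : ℝ) : expect (C a : MvPolynomial (Fin N) ℝ) = a := by simp [expect_apply]

lemma expect_sq_nonneg (p : MvPolynomial (Fin N) ℝ) : 0 ≤ expect (p ^ 2) := by
  rw [expect_apply]
  exact integral_nonneg fun x => by simpa using sq_nonneg (eval x p)

lemma expect_X_mul (i : Fin N) (p : MvPolynomial (Fin N) ℝ) :
    expect (X i * p) = expect (pderiv i p) := by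
  have := integral_coord_mul i (hasDerivAt_eval_update p i) (integrable_eval p) (integrable_eval _)
    ((integrable_eval (X i * p)).congr (ae_of_all _ fun x => by simp))
  simpa [expect_apply] using this

/-- `X i - ∂ᵢ` is the adjoint of `∂ᵢ` for the Gaussian law. -/
lemma expect_divergence_mul (i : Fin N) (p q : MvPolynomial (Fin N) ℝ) :
    expect ((X i * p - pderiv i p) * q) = expect (p * pderiv i q) := by
  rw [sub_mul, map_sub, mul_assoc, expect_X_mul, Derivation.leibniz, map_add, smul_eq_mul,
    smul_eq_mul, mul_comm q, add_sub_cancel_right]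

/-- A multiple of `X i` becomes a divergence under `wick`, which has mean zero; only the constant
term survives. -/
lemma expect_wick (p : MvPolynomial (Fin N) ℝ) : expect (wick p) = coeff 0 p := by
  induction p using MvPolynomial.induction_on with
  | C a => simp [wick_C, expect_C]
  | add p q hp hq => simp [hp, hq]
  | mul_X p i _ =>
    rw [mul_comm, wick_X_mul, map_sub, expect_X_mul, sub_self]
    rw [coeff_X_mul', if_neg (by simp)]

lemma expect_wick_X_mul (i : Fin N) (p q : MvPolynomial (Fin N) ℝ) :
    expect (wick (X i * p) * wick q) = expect (wick p * wick (pderiv i q)) := by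
  rw [wick_X_mul, expect_divergence_mul, pderiv_wick]

/-- In the product formula the term of order `r ≤ m < n` has positive degree `(m - r) + (n - r)`,
hence no constant coefficient. -/
lemma expect_wick_mul_wick_of_lt {m n : ℕ} {p q : MvPolynomial (Fin N) ℝ}
    (hp : p.IsHomogeneous m) (hq : q.IsHomogeneous n) (hmn : m < n) :
    expect (wick p * wick q) = 0 := by
  rw [wick_mul_wick hp, map_sum]
  refine Finset.sum_eq_zero fun r hr => ?_
  rw [Finset.mem_range] at hr
  rw [map_smul, expect_wick, (isHomogeneous_contr r hp hq).coeff_eq_zero, smul_zero]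
  rw [map_zero]
  omega

lemma expect_wick_mul_wick_of_ne {m n : ℕ} {p q : MvPolynomial (Fin N) ℝ}
    (hp : p.IsHomogeneous m) (hq : q.IsHomogeneous n) (hmn : m ≠ n) :
    expect (wick p * wick q) = 0 := by
  rcases hmn.lt_or_gt with h | h
  · exact expect_wick_mul_wick_of_lt hp hq h
  · rw [mul_comm]
    exact expect_wick_mul_wick_of_lt hq hp h

lemma expect_sum_wick_mul_sum {κ : Type*} (s : Finset κ) (deg : κ → ℕ)
    (hdeg : Set.InjOn deg s) (u v : κ → MvPolynomial (Fin N) ℝ)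
    (hu : ∀ r ∈ s, (u r).IsHomogeneous (deg r)) (hv : ∀ r ∈ s, (v r).IsHomogeneous (deg r)) :
    expect ((∑ r ∈ s, wick (u r)) * ∑ r ∈ s, wick (v r)) =
      ∑ r ∈ s, expect (wick (u r) * wick (v r)) := by
  rw [Finset.sum_mul_sum, map_sum]
  refine Finset.sum_congr rfl fun r hr => ?_
  rw [map_sum]
  refine Finset.sum_eq_single_of_mem r hr fun r' hr' hne => ?_
  exact expect_wick_mul_wick_of_ne (hu r hr) (hv r' hr') fun h => hne (hdeg hr' hr h.symm)

/-- Gaussian integration by parts for a homogeneous Wick polynomial and a test function. -/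
lemma integral_wick_mul_comp {d : ℕ} (hd : d ≠ 0) {p : MvPolynomial (Fin N) ℝ}
    (hp : p.IsHomogeneous d) {f f' : ℝ → ℝ} (hf : ∀ y, HasDerivAt f (f' y) y) {K : ℝ}
    (hK : ∀ y, |f' y| ≤ K) :
    ∫ x, eval x (wick p) * f (eval x (wick p)) ∂gaussianPi N =
      (d : ℝ)⁻¹ * ∫ x, f' (eval x (wick p)) * eval x (∑ i, pderiv i (wick p) ^ 2) ∂gaussianPi N := by
  set F := wick p with hF
  have hfc : Continuous f := continuous_iff_continuousAt.2 fun y => (hf y).continuousAt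
  have hf'm : Measurable f' := by
    have : f' = deriv f := funext fun y => (hf y).deriv.symm
    rw [this]; exact measurable_deriv f
  have hm : ∀ q : MvPolynomial (Fin N) ℝ, Continuous fun x => eval x q := fun q => continuous_eval q
  -- A bounded derivative gives linear growth of `f`, which is what makes every integrand below
  -- integrable.
  have hgrow : ∀ y, |f y| ≤ |f 0| + K * |y| := fun y => by
    have := Convex.norm_image_sub_le_of_norm_hasDerivWithin_le (f := f) (f' := f') (C := K)
      (s := Set.univ) (x := 0) (y := y) (fun z _ => (hf z).hasDerivWithinAt) (fun z _ => hK z)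
      convex_univ trivial trivial
    simp only [Real.norm_eq_abs, sub_zero] at this
    linarith [abs_sub_abs_le_abs_sub (f y) (f 0)]
  have hi1 : ∀ q : MvPolynomial (Fin N) ℝ,
      Integrable (fun x => eval x q * f (eval x F)) (gaussianPi N) := fun q => by
    have hb : Integrable (fun x => |f 0| * |eval x q| + K * |eval x (q * F)|) (gaussianPi N) :=
      ((integrable_eval q).abs.const_mul _).add ((integrable_eval (q * F)).abs.const_mul _)
    refine hb.mono' ((hm q).mul (hfc.comp (hm F))).aestronglyMeasurable (ae_of_all _ fun x => ?_)
    rw [Real.norm_eq_abs, abs_mul, map_mul, abs_mul]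
    nlinarith [hgrow (eval x F), abs_nonneg (eval x q)]
  have hi2 : ∀ q : MvPolynomial (Fin N) ℝ,
      Integrable (fun x => f' (eval x F) * eval x q) (gaussianPi N) := fun q =>
    (integrable_eval q).bdd_mul (hf'm.comp (hm F).measurable).aestronglyMeasurable
      (ae_of_all _ fun x => hK _)
  have key : ∀ i, ∫ x, eval x (X i * pderiv i F - pderiv i (pderiv i F)) * f (eval x F) ∂gaussianPi N
      = ∫ x, f' (eval x F) * eval x (pderiv i F ^ 2) ∂gaussianPi N := fun i => by
    have hd : ∀ x : Fin N → ℝ, HasDerivAt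
        (fun t => eval (Function.update x i t) (pderiv i F) * f (eval (Function.update x i t) F))
        (eval x (pderiv i (pderiv i F)) * f (eval x F) +
          f' (eval x F) * eval x (pderiv i F ^ 2)) (x i) := fun x => by
      have h1 := hasDerivAt_eval_update (pderiv i F) i x
      have h2 := hasDerivAt_eval_update F i x
      have h3 : HasDerivAt f (f' (eval x F)) (eval (Function.update x i (x i)) F) := by
        simpa using hf (eval x F)
      convert! h1.mul (h3.comp (x i) h2) using 1
      simp
      ring
    have h := integral_coord_mul i (u := fun x => eval x (pderiv i F) * f (eval x F)) hd (hi1 _)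
      ((hi1 _).add (hi2 _)) ((hi1 (X i * pderiv i F)).congr (ae_of_all _ fun x => by simp [mul_assoc]))
    rw [integral_add (hi1 _) (hi2 _)] at h
    have h' : ∫ x, eval x (X i * pderiv i F) * f (eval x F) ∂gaussianPi N =
        ∫ x, x i * (eval x (pderiv i F) * f (eval x F)) ∂gaussianPi N := by simp [mul_assoc]
    simp only [map_sub, sub_mul]
    rw [integral_sub (hi1 _) (hi1 _), h', h]
    ring
  -- `F` is an eigenvector of the Ornstein–Uhlenbeck operator with eigenvalue `d`, hence `1/d` times
  -- a divergence.
  have hdF : ∀ x, eval x F = (d : ℝ)⁻¹ * ∑ i, eval x (X i * pderiv i F - pderiv i (pderiv i F)) := by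
    intro x
    rw [← map_sum, hF, ← nsmul_wick_eq_sum hp, map_nsmul, nsmul_eq_mul, inv_mul_cancel_left₀]
    exact_mod_cast hd
  calc _ = (d : ℝ)⁻¹ * ∑ i, ∫ x, eval x (X i * pderiv i F - pderiv i (pderiv i F)) *
        f (eval x F) ∂gaussianPi N := by
        rw [← integral_finsetSum _ fun i _ => hi1 _, ← integral_const_mul]
        refine integral_congr_ae (ae_of_all _ fun x => ?_)
        simp only
        rw [← Finset.sum_mul, ← mul_assoc, ← hdF]
    _ = _ := by
        simp_rw [key]
        rw [← integral_finsetSum _ fun i _ => hi2 _]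
        congr 2 with x
        rw [map_sum, Finset.mul_sum]

/-- Gaussian integration by parts for a homogeneous Wick polynomial and its powers. -/
lemma expect_wick_pow_succ {d : ℕ} {p : MvPolynomial (Fin N) ℝ} (hp : p.IsHomogeneous d) (n : ℕ) :
    (d : ℝ) * expect (wick p ^ (n + 1)) =
      n * expect (wick p ^ (n - 1) * ∑ i, pderiv i (wick p) ^ 2) := by
  have h : (d : ℝ) • wick p ^ (n + 1) =
      ∑ i, (X i * pderiv i (wick p) - pderiv i (pderiv i (wick p))) * wick p ^ n := by
    rw [pow_succ', ← smul_mul_assoc, ← Finset.sum_mul, ← nsmul_wick_eq_sum hp, Nat.cast_smul_eq_nsmul]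
  rw [← smul_eq_mul, ← map_smul, h, map_sum, Finset.mul_sum, map_sum, Finset.mul_sum]
  refine Finset.sum_congr rfl fun i _ => ?_
  rw [expect_divergence_mul, Derivation.leibniz_pow, ← smul_eq_mul (a := (n : ℝ)),
    ← (expect (N := N)).map_smul]
  congr 1
  rw [Nat.cast_smul_eq_nsmul, nsmul_eq_mul, nsmul_eq_mul, smul_eq_mul]
  ring

end GaussianPolynomial

end WienerChaos

namespace WienerChaos

/-! ## Moments of homogeneous Wick polynomials -/

section Moments

open MvPolynomial

variable {N : ℕ}

/-- The weight of the contraction of order `r` in the squared gradient of a Wick polynomial of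
degree `d`. -/
noncomputable def gradWeight (d r : ℕ) : ℝ := r / (d * r !)

/-- The second moment of `2 F - |∇F|² / d`, up to constants, where `F = wick p`. -/
noncomputable def steinDiscrepancy (d : ℕ) (p : MvPolynomial (Fin N) ℝ) : ℝ :=
  expect (wick ((2 : ℝ) • p - gradWeight d (d / 2) • contr (d / 2) p p) ^ 2) +
    ∑ r ∈ (Finset.range d).filter (fun r => 1 ≤ r ∧ r ≠ d / 2),
      gradWeight d r ^ 2 * expect (wick (contr r p p) ^ 2)

/-- Two orders play a special role: at `r = d/2` the contraction lies in the same chaos as `F`, and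
at `r = d` it is constant. -/
lemma sum_range_succ_eq_of_zero {d : ℕ} (hd2 : 2 ≤ d) {g : ℕ → ℝ} (h0 : g 0 = 0) :
    ∑ r ∈ Finset.range (d + 1), g r =
      g (d / 2) + ∑ r ∈ (Finset.range d).filter (fun r => 1 ≤ r ∧ r ≠ d / 2), g r + g d := by
  rw [Finset.sum_range_succ, ← Finset.add_sum_erase (Finset.range d) g
    (Finset.mem_range.2 (show d / 2 < d by omega))]
  congr 2
  symm
  apply Finset.sum_subset
  · intro r hr
    simp only [Finset.mem_filter, Finset.mem_range, Finset.mem_erase] at hr ⊢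
    omega
  · intro r hr hr'
    simp only [Finset.mem_filter, Finset.mem_range, Finset.mem_erase] at hr hr'
    have : r = 0 := by omega
    rw [this, h0]

variable {d : ℕ} {p : MvPolynomial (Fin N) ℝ}

lemma isHomogeneous_contr_self (hp : p.IsHomogeneous d) (r : ℕ) :
    (contr r p p).IsHomogeneous (2 * (d - r)) := by
  simpa [two_mul] using isHomogeneous_contr r hp hp

lemma injOn_two_mul_sub (d : ℕ) :
    Set.InjOn (fun r => 2 * (d - r)) (Finset.range (d + 1) : Set ℕ) := by
  intro r hr s hs h
  simp only [Finset.coe_range, Set.mem_Iio] at hr hs h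
  omega

lemma sum_pderiv_wick_sq' (hd : d ≠ 0) (hp : p.IsHomogeneous d) :
    ∑ i, pderiv i (wick p) ^ 2 =
      ∑ r ∈ Finset.range (d + 1), wick ((d * gradWeight d r) • contr r p p) := by
  obtain ⟨m, rfl⟩ := Nat.exists_eq_succ_of_ne_zero hd
  rw [sum_pderiv_wick_sq hp]
  symm
  rw [Finset.sum_range_succ']
  simp only [gradWeight, Nat.cast_zero, zero_div, mul_zero, zero_smul, map_zero, add_zero]
  refine Finset.sum_congr rfl fun r _ => ?_
  rw [map_smul]
  congr 1
  rw [Nat.factorial_succ]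
  push_cast
  field_simp

lemma wick_sq (hp : p.IsHomogeneous d) :
    wick p ^ 2 = ∑ r ∈ Finset.range (d + 1), wick (((r ! : ℝ)⁻¹) • contr r p p) := by
  rw [sq, wick_mul_wick hp]
  simp_rw [map_smul]

/-- The full contraction has degree zero; its value is read off from the expectation of the product
formula for `wick p ^ 2`, where it is the only term with a constant part. -/
lemma contr_self_eq_C (hp : p.IsHomogeneous d) :
    contr d p p = C (d ! * expect (wick p ^ 2)) := by
  have h0 := isHomogeneous_contr_self hp d
  rw [Nat.sub_self, mul_zero, ← totalDegree_zero_iff_isHomogeneous,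
    totalDegree_eq_zero_iff_eq_C] at h0
  rw [h0]
  congr 1
  rw [wick_sq hp, map_sum, Finset.sum_eq_single_of_mem d (by simp)]
  · rw [map_smul, map_smul, expect_wick, smul_eq_mul, mul_inv_cancel_left₀ (by positivity)]
  · intro r hr hne
    rw [Finset.mem_range] at hr
    rw [map_smul, map_smul, expect_wick, (isHomogeneous_contr_self hp r).coeff_eq_zero, smul_zero]
    rw [map_zero]
    omega

/-- Squaring the chaos expansion of `F²`. This form serves to bound the fourth moment by the norm of
the kernel. -/
lemma expect_wick_pow_four_eq_sum (hp : p.IsHomogeneous d) :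
    expect (wick p ^ 4) =
      ∑ r ∈ Finset.range (d + 1), ((r ! : ℝ)⁻¹) ^ 2 * expect (wick (contr r p p) ^ 2) := by
  rw [show wick p ^ 4 = wick p ^ 2 * wick p ^ 2 by ring, wick_sq hp,
    expect_sum_wick_mul_sum _ (fun r => 2 * (d - r)) (injOn_two_mul_sub d)]
  · refine Finset.sum_congr rfl fun r _ => ?_
    rw [map_smul, smul_mul_smul_comm, map_smul, sq, sq, smul_eq_mul]
  all_goals
    intro r _
    rw [smul_eq_C_mul]
    exact (isHomogeneous_contr_self hp r).C_mul _

/-- Integration by parts gives `E F⁴ = (3/d) E[F² |∇F|²]`. Pairing the two expansions produces the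
weights `gradWeight d r / r! = (d/r) * gradWeight d r ^ 2`; at `r = 0` both sides vanish, with the
convention `d / 0 = 0`. -/
lemma expect_wick_pow_four (hd : d ≠ 0) (hp : p.IsHomogeneous d) :
    expect (wick p ^ 4) = 3 * ∑ r ∈ Finset.range (d + 1),
      (d / r) * (gradWeight d r ^ 2 * expect (wick (contr r p p) ^ 2)) := by
  have h := expect_wick_pow_succ hp 3
  have hd' : (d : ℝ) ≠ 0 := by exact_mod_cast hd
  rw [show 3 - 1 = 2 from rfl, sum_pderiv_wick_sq' hd hp, wick_sq hp,
    expect_sum_wick_mul_sum _ (fun r => 2 * (d - r)) (injOn_two_mul_sub d)] at h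
  · rw [← mul_right_inj' hd', h, mul_left_comm, Nat.cast_ofNat]
    congr 1
    rw [Finset.mul_sum]
    refine Finset.sum_congr rfl fun r _ => ?_
    rw [map_smul, map_smul, smul_mul_smul_comm, map_smul, smul_eq_mul, ← sq]
    generalize expect (wick (contr r p p) ^ 2) = a
    rcases Nat.eq_zero_or_pos r with rfl | hr
    · simp [gradWeight]
    · have : (r : ℝ) ≠ 0 := by exact_mod_cast hr.ne'
      rw [gradWeight]
      field_simp
  all_goals
    intro r _
    rw [smul_eq_C_mul]
    exact (isHomogeneous_contr_self hp r).C_mul _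

/-- `E F³ = (2/d) E[F |∇F|²]`, and only the contraction of order `d/2` has the degree of `F`. -/
lemma expect_wick_pow_three (hd : Even d) (hd0 : d ≠ 0) (hp : p.IsHomogeneous d) :
    expect (wick p ^ 3) =
      2 * (gradWeight d (d / 2) * expect (wick p * wick (contr (d / 2) p p))) := by
  have h := expect_wick_pow_succ hp 2
  have hd' : (d : ℝ) ≠ 0 := by exact_mod_cast hd0
  rw [show 2 - 1 = 1 from rfl, sum_pderiv_wick_sq' hd0 hp, pow_one, Finset.mul_sum, map_sum,
    Finset.sum_eq_single_of_mem (d / 2) (by simp; omega)] at h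
  · rw [← mul_right_inj' hd', h, map_smul, mul_smul_comm, map_smul, smul_eq_mul]
    push_cast
    ring
  · intro r hr hne
    rw [map_smul, mul_smul_comm, map_smul, expect_wick_mul_wick_of_ne hp
      (isHomogeneous_contr_self hp r), smul_zero]
    have := hd.two_dvd
    rw [Finset.mem_range] at hr
    omega

/-- The second moment of `2 F + 2 c - |∇F|² / d`, where `F = wick p`. -/
lemma expect_two_mul_wick_add_sub_sq (hd : Even d) (hd2 : 2 ≤ d) (hp : p.IsHomogeneous d) (c : ℝ) :
    expect (((2 : ℝ) • wick p + C (2 * c) - (d : ℝ)⁻¹ • ∑ i, pderiv i (wick p) ^ 2) ^ 2) =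
      (2 * c - expect (wick p ^ 2)) ^ 2 + steinDiscrepancy d p := by
  have hd0 : d ≠ 0 := by omega
  have hd' : (d : ℝ) ≠ 0 := by exact_mod_cast hd0
  have h2 := hd.two_dvd
  -- `u r` collects the component in the chaos of degree `2 (d - r)`: `2F` joins order `d/2` and the
  -- constant `2c` joins order `d`.
  set u : ℕ → MvPolynomial (Fin N) ℝ := fun r => (if r = d / 2 then (2 : ℝ) • p else 0) +
    (if r = d then C (2 * c) else 0) - gradWeight d r • contr r p p with hu
  have hu0 : u 0 = 0 := by
    have h1 : (0 : ℕ) ≠ d / 2 := by omega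
    simp [hu, h1, hd0.symm, gradWeight]
  have hud : u d = C (2 * c - expect (wick p ^ 2)) := by
    have h1 : d ≠ d / 2 := by omega
    simp only [hu, if_neg h1, if_true, contr_self_eq_C hp, zero_add]
    rw [smul_eq_C_mul, ← C_mul, ← C_sub, gradWeight]
    congr 2
    field_simp
  have huh : u (d / 2) = (2 : ℝ) • p - gradWeight d (d / 2) • contr (d / 2) p p := by
    have h1 : d / 2 ≠ d := by omega
    simp [hu, h1]
  have hsum : (2 : ℝ) • wick p + C (2 * c) - (d : ℝ)⁻¹ • ∑ i, pderiv i (wick p) ^ 2 =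
      ∑ r ∈ Finset.range (d + 1), wick (u r) := by
    rw [sum_pderiv_wick_sq' hd0 hp]
    simp only [hu, map_sub, map_add, apply_ite wick, map_zero, Finset.sum_sub_distrib,
      Finset.sum_add_distrib, Finset.sum_ite_eq', Finset.smul_sum, map_smul, wick_C, smul_smul]
    rw [if_pos (by simp; omega), if_pos (by simp)]
    congr 1
    refine Finset.sum_congr rfl fun r _ => ?_
    rw [inv_mul_cancel_left₀ hd']
  have hhom : ∀ r ∈ Finset.range (d + 1), (u r).IsHomogeneous (2 * (d - r)) := by
    intro r _
    refine ((IsHomogeneous.add ?_ ?_).sub ?_)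
    · split_ifs with h
      · rw [smul_eq_C_mul, show 2 * (d - r) = d by omega]
        exact hp.C_mul _
      · exact isHomogeneous_zero _ _ _
    · split_ifs with h
      · rw [h, Nat.sub_self]
        exact isHomogeneous_C _ _
      · exact isHomogeneous_zero _ _ _
    · rw [smul_eq_C_mul]
      exact (isHomogeneous_contr_self hp r).C_mul _
  rw [hsum, sq, expect_sum_wick_mul_sum _ (fun r => 2 * (d - r)) (injOn_two_mul_sub d) _ _ hhom hhom,
    sum_range_succ_eq_of_zero hd2 (by simp [hu0]), steinDiscrepancy, huh, hud, wick_C, ← C_mul,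
    expect_C, add_comm, ← sq, ← sq]
  congr 2
  refine Finset.sum_congr rfl fun r hr => ?_
  simp only [Finset.mem_filter, Finset.mem_range] at hr
  have : u r = -(gradWeight d r • contr r p p) := by
    simp [hu, hr.2.2, hr.1.ne]
  rw [this, map_neg, map_smul, neg_mul_neg, smul_mul_smul_comm, map_smul, smul_eq_mul, sq, sq]

lemma steinDiscrepancy_nonneg (d : ℕ) (p : MvPolynomial (Fin N) ℝ) : 0 ≤ steinDiscrepancy d p :=
  add_nonneg (expect_sq_nonneg _)
    (Finset.sum_nonneg fun _ _ => mul_nonneg (sq_nonneg _) (expect_sq_nonneg _))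

/-- The Stein discrepancy is controlled by the moments of orders two, three and four. -/
lemma steinDiscrepancy_le (hd : Even d) (hd2 : 2 ≤ d) (hp : p.IsHomogeneous d) :
    steinDiscrepancy d p ≤ ((d : ℝ) - 1) / (3 * d) *
      (expect (wick p ^ 4) - 12 * expect (wick p ^ 3) - 3 * expect (wick p ^ 2) ^ 2 +
        24 * expect (wick p ^ 2)) := by
  have hd0 : d ≠ 0 := by omega
  have hd' : (2 : ℝ) ≤ d := by exact_mod_cast hd2
  set m := expect (wick p ^ 2)
  set A : ℕ → ℝ := fun r => gradWeight d r ^ 2 * expect (wick (contr r p p) ^ 2) with hA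
  set B := expect (wick ((2 : ℝ) • p - gradWeight d (d / 2) • contr (d / 2) p p) ^ 2) with hB
  set S := (Finset.range d).filter (fun r => 1 ≤ r ∧ r ≠ d / 2)
  have hA0 : ∀ r, 0 ≤ A r := fun r => mul_nonneg (sq_nonneg _) (expect_sq_nonneg _)
  have hB0 : 0 ≤ B := expect_sq_nonneg _
  have h4 : expect (wick p ^ 4) = 3 * (2 * A (d / 2) + ∑ r ∈ S, (d / r) * A r + m ^ 2) := by
    rw [expect_wick_pow_four hd0 hp, sum_range_succ_eq_of_zero hd2 (by simp)]
    congr 2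
    · congr 1
      rw [Nat.cast_div hd.two_dvd (by norm_num)]
      simp only [hA, Nat.cast_ofNat]
      field_simp
    · rw [contr_self_eq_C hp, wick_C, ← C_pow, expect_C, gradWeight]
      field_simp
      rfl
  have h3 := expect_wick_pow_three hd hd0 hp
  have hBe : B = 4 * m - 2 * expect (wick p ^ 3) + A (d / 2) := by
    rw [h3, hB]
    have : wick ((2 : ℝ) • p - gradWeight d (d / 2) • contr (d / 2) p p) ^ 2 =
        (4 : ℝ) • wick p ^ 2 - (4 * gradWeight d (d / 2)) • (wick p * wick (contr (d / 2) p p)) +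
          (gradWeight d (d / 2) ^ 2) • wick (contr (d / 2) p p) ^ 2 := by
      rw [map_sub, map_smul, map_smul]
      simp only [smul_eq_C_mul, C_mul, C_pow, map_ofNat]
      ring
    rw [this, map_add, map_sub, map_smul, map_smul, map_smul]
    simp only [smul_eq_mul, hA]
    ring
  -- The cross term in `B` is exactly the third moment, and the order-`d` term `3 m²` of the fourth
  -- moment cancels.
  have hX : expect (wick p ^ 4) - 12 * expect (wick p ^ 3) - 3 * m ^ 2 + 24 * m =
      6 * B + 3 * ∑ r ∈ S, (d / r) * A r := by
    rw [h4, hBe]; ring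
  rw [hX, mul_add, steinDiscrepancy]
  refine add_le_add ?_ ?_
  -- The factor is `2 (d - 1) / d`, at least one since `d ≥ 2`.
  · have : (1 : ℝ) ≤ ((d : ℝ) - 1) / (3 * d) * 6 := by
      rw [div_mul_eq_mul_div, le_div_iff₀ (by positivity)]
      linarith
    calc B = 1 * B := (one_mul B).symm
      _ ≤ _ := by rw [← mul_assoc]; exact mul_le_mul_of_nonneg_right this hB0
  · rw [Finset.mul_sum, Finset.mul_sum]
    refine Finset.sum_le_sum fun r hr => ?_
    simp only [Finset.mem_filter, Finset.mem_range] at hr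
    have hr1 : (1 : ℝ) ≤ r := by exact_mod_cast hr.2.1
    have hr2 : (r : ℝ) + 1 ≤ d := by exact_mod_cast hr.1
    -- Here the factor is `(d - 1) / r`, at least one since `r ≤ d - 1`.
    have : (1 : ℝ) ≤ ((d : ℝ) - 1) / (3 * d) * (3 * (d / r)) := by
      have : ((d : ℝ) - 1) / (3 * d) * (3 * (d / r)) = (d - 1) / r := by field_simp
      rw [this, le_div_iff₀ (by positivity)]
      linarith
    calc (A r : ℝ) = 1 * A r := (one_mul _).symm
      _ ≤ _ := by
        rw [← mul_assoc 3, ← mul_assoc (((d : ℝ) - 1) / (3 * d))]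
        exact mul_le_mul_of_nonneg_right this (hA0 r)

end Moments

end WienerChaos

namespace WienerChaos

/-! ## Polynomials attached to finitely supported tensors -/

section TensorPoly

open MvPolynomial

variable {N : ℕ}

/-- The homogeneous polynomial with (not necessarily symmetric) coefficients `a`. -/
noncomputable def tensorPoly {m : ℕ} (a : (Fin m → Fin N) → ℝ) : MvPolynomial (Fin N) ℝ :=
  ∑ j, a j • ∏ i, X (j i)

/-- Coefficient families that are invariant under permutations of the indices. -/
def SymmCoeff {κ : Type*} {m : ℕ} (a : (Fin m → κ) → ℝ) : Prop :=
  ∀ (σ : Equiv.Perm (Fin m)) (j : Fin m → κ), a (j ∘ σ) = a j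

lemma SymmCoeff.cons {κ : Type*} {m : ℕ} {a : (Fin (m + 1) → κ) → ℝ} (ha : SymmCoeff a) (k : κ) :
    SymmCoeff fun j => a (Fin.cons k j) := by
  intro σ j
  change a (Fin.cons k (j ∘ σ)) = a (Fin.cons k j)
  rw [← ha (Equiv.Perm.decomposeFin.symm (0, σ)) (Fin.cons k j)]
  congr 1
  ext i
  refine Fin.cases ?_ (fun i => ?_) i <;> simp

lemma SymmCoeff.swap {κ : Type*} {m : ℕ} {a : (Fin (m + 2) → κ) → ℝ} (ha : SymmCoeff a) (k l : κ)
    (j : Fin m → κ) : a (Fin.cons k (Fin.cons l j : Fin (m + 1) → κ)) =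
      a (Fin.cons l (Fin.cons k j : Fin (m + 1) → κ)) := by
  rw [← ha (Equiv.swap 0 1) (Fin.cons k (Fin.cons l j : Fin (m + 1) → κ))]
  congr 1
  ext i
  refine Fin.cases ?_ (fun i => Fin.cases ?_ (fun i => ?_) i) i
  · rw [Function.comp_apply, Equiv.swap_apply_left]
    rfl
  · rw [Function.comp_apply, show (Fin.succ 0 : Fin (m + 2)) = 1 from rfl, Equiv.swap_apply_right]
    rfl
  · rw [Function.comp_apply, Equiv.swap_apply_of_ne_of_ne (Fin.succ_ne_zero _)]
    · rfl
    · intro h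
      exact Fin.succ_ne_zero i (Fin.succ_injective _ h)

lemma sum_eq_sum_cons {κ M : Type*} [Fintype κ] [AddCommMonoid M] {m : ℕ}
    (g : (Fin (m + 1) → κ) → M) : ∑ j, g j = ∑ k, ∑ j : Fin m → κ, g (Fin.cons k j) := by
  rw [← (Fin.consEquiv (fun _ : Fin (m + 1) => κ)).sum_comp, Fintype.sum_prod_type]
  rfl

lemma tensorPoly_smul {m : ℕ} (c : ℝ) (a : (Fin m → Fin N) → ℝ) :
    tensorPoly (fun j => c * a j) = c • tensorPoly a := by
  simp [tensorPoly, Finset.smul_sum, smul_smul]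

lemma tensorPoly_add {m : ℕ} (a b : (Fin m → Fin N) → ℝ) :
    tensorPoly (fun j => a j + b j) = tensorPoly a + tensorPoly b := by
  simp [tensorPoly, add_smul, Finset.sum_add_distrib]

lemma tensorPoly_sum {m : ℕ} {κ : Type*} (s : Finset κ) (a : κ → (Fin m → Fin N) → ℝ) :
    tensorPoly (fun j => ∑ k ∈ s, a k j) = ∑ k ∈ s, tensorPoly (a k) := by
  simp only [tensorPoly, Finset.sum_smul]
  exact Finset.sum_comm

lemma tensorPoly_zero_order (a : (Fin 0 → Fin N) → ℝ) : tensorPoly a = C (a Fin.elim0) := by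
  rw [tensorPoly, Fintype.sum_unique, smul_eq_C_mul]
  simp
  congr

lemma tensorPoly_succ {m : ℕ} (a : (Fin (m + 1) → Fin N) → ℝ) :
    tensorPoly a = ∑ k, X k * tensorPoly fun j => a (Fin.cons k j) := by
  rw [tensorPoly, sum_eq_sum_cons]
  refine Finset.sum_congr rfl fun k _ => ?_
  rw [tensorPoly, Finset.mul_sum]
  refine Finset.sum_congr rfl fun j _ => ?_
  rw [Fin.prod_univ_succ]
  simp

lemma isHomogeneous_tensorPoly {m : ℕ} (a : (Fin m → Fin N) → ℝ) :
    (tensorPoly a).IsHomogeneous m := by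
  refine IsHomogeneous.sum _ _ _ fun j _ => ?_
  rw [smul_eq_C_mul]
  refine IsHomogeneous.C_mul ?_ _
  have := IsHomogeneous.prod Finset.univ (fun i => (X (j i) : MvPolynomial (Fin N) ℝ))
    (fun _ => 1) fun i _ => isHomogeneous_X _ _
  simpa using this

/-- Any of the `m + 1` slots may be differentiated, and symmetry brings each of them to the front.
-/
lemma pderiv_tensorPoly {m : ℕ} {a : (Fin (m + 1) → Fin N) → ℝ} (ha : SymmCoeff a) (i : Fin N) :
    pderiv i (tensorPoly a) = ((m : ℝ) + 1) • tensorPoly fun j => a (Fin.cons i j) := by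
  induction m with
  | zero =>
    rw [tensorPoly_succ, map_sum, Finset.sum_eq_single i]
    · simp [tensorPoly_zero_order, mul_comm]
    · intro k _ hk
      simp [tensorPoly_zero_order, pderiv_X_of_ne hk]
    · simp
  | succ m ih =>
    rw [tensorPoly_succ, map_sum]
    have h : ∀ k, pderiv i (X k * tensorPoly fun j => a (Fin.cons k j)) =
        ((m : ℝ) + 1) • (X k * tensorPoly fun j => a (Fin.cons i (Fin.cons k j : Fin (m + 1) → Fin N)))
        + if k = i then tensorPoly (fun j => a (Fin.cons i j)) else 0 := by
      intro k
      rw [Derivation.leibniz, ih (ha.cons k), smul_eq_mul, mul_smul_comm]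
      congr 1
      · simp_rw [ha.swap k i]
      · rcases eq_or_ne k i with rfl | hk
        · simp
        · simp [pderiv_X_of_ne hk, hk]
    simp_rw [h]
    rw [Finset.sum_add_distrib, ← Finset.smul_sum,
      ← tensorPoly_succ (fun j => a (Fin.cons i j))]
    simp only [Finset.sum_ite_eq', Finset.mem_univ, if_true]
    push_cast
    module

/-- The isometry property of Wick polynomials. -/
lemma expect_wick_tensorPoly_mul {m : ℕ} (a : (Fin m → Fin N) → ℝ) {b : (Fin m → Fin N) → ℝ}
    (hb : SymmCoeff b) :
    expect (wick (tensorPoly a) * wick (tensorPoly b)) = m ! * ∑ j, a j * b j := by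
  induction m with
  | zero =>
    rw [tensorPoly_zero_order, tensorPoly_zero_order, wick_C, wick_C, ← C_mul, expect_C,
      Fintype.sum_unique, Subsingleton.elim default Fin.elim0]
    simp
  | succ m ih =>
    rw [tensorPoly_succ, map_sum, Finset.sum_mul, map_sum, sum_eq_sum_cons, Finset.mul_sum]
    refine Finset.sum_congr rfl fun k _ => ?_
    rw [expect_wick_X_mul, pderiv_tensorPoly hb, map_smul, mul_smul_comm, map_smul, ih _ (hb.cons k),
      Nat.factorial_succ]
    push_cast
    rw [smul_eq_mul, mul_assoc]

lemma tensorPoly_comp_perm {m : ℕ} (a : (Fin m → Fin N) → ℝ) (σ : Equiv.Perm (Fin m)) :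
    tensorPoly (fun j => a (j ∘ σ)) = tensorPoly a := by
  rw [tensorPoly, tensorPoly, ← (Equiv.arrowCongr σ.symm (Equiv.refl (Fin N))).sum_comp
    (fun j => a j • ∏ i, X (j i))]
  refine Finset.sum_congr rfl fun j _ => ?_
  congr 1
  exact (Equiv.prod_comp σ fun i => (X (j i) : MvPolynomial (Fin N) ℝ)).symm

lemma tensorPoly_mul {s t n : ℕ} (hn : n = s + t) (a : (Fin s → Fin N) → ℝ)
    (b : (Fin t → Fin N) → ℝ) :
    tensorPoly a * tensorPoly b = tensorPoly fun j : Fin n → Fin N =>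
      a (fun x => j (Fin.cast hn.symm (Fin.castAdd t x))) *
        b (fun x => j (Fin.cast hn.symm (Fin.natAdd s x))) := by
  subst hn
  rw [tensorPoly, tensorPoly, tensorPoly, Finset.sum_mul_sum, ← Fintype.sum_prod_type',
    ← (Fin.appendEquiv s t).sum_comp]
  refine Finset.sum_congr rfl fun j _ => ?_
  simp only [Fin.appendEquiv, Fin.prod_univ_add, smul_mul_smul_comm, Equiv.coe_fn_mk,
    Fin.cast_refl, id_eq, Fin.append_left, Fin.append_right]

lemma contr_smul_smul (r : ℕ) (a b : ℝ) (f g : MvPolynomial (Fin N) ℝ) :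
    contr r (a • f) (b • g) = (a * b) • contr r f g := by
  induction r generalizing f g with
  | zero => exact smul_mul_smul_comm _ _ _ _
  | succ r ih => simp only [contr, Derivation.map_smul, ih, Finset.smul_sum]

/-- Contractions of polynomials are given by contractions of their symmetric coefficients. -/
lemma contr_tensorPoly {r s t p q n : ℕ} (hp : p = r + s) (hq : q = r + t) (hn : n = s + t)
    {a : (Fin p → Fin N) → ℝ} {b : (Fin q → Fin N) → ℝ} (ha : SymmCoeff a) (hb : SymmCoeff b) :
    contr r (tensorPoly a) (tensorPoly b) =
      ((p.descFactorial r : ℝ) * q.descFactorial r) • tensorPoly fun j : Fin n → Fin N =>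
        ∑ i : Fin r → Fin N,
          a (Fin.append i (fun x => j (Fin.cast hn.symm (Fin.castAdd t x))) ∘ Fin.cast hp) *
          b (Fin.append i (fun x => j (Fin.cast hn.symm (Fin.natAdd s x))) ∘ Fin.cast hq) := by
  induction r generalizing p q with
  | zero =>
    obtain rfl : p = s := by omega
    obtain rfl : q = t := by omega
    simp only [contr, Nat.descFactorial_zero, Nat.cast_one, mul_one, one_smul, Fintype.sum_unique]
    rw [tensorPoly_mul hn]
    congr 1
    ext j
    have h : ∀ {u : ℕ} (hu : u = 0 + u) (i : Fin 0 → Fin N) (y : Fin u → Fin N),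
        Fin.append i y ∘ Fin.cast hu = y := by
      intro u hu i y
      rw [Fin.append_left_nil _ _ rfl]
      ext x
      simp
    rw [h, h]
  | succ r ih =>
    obtain ⟨p, rfl⟩ : ∃ p', p = p' + 1 := ⟨p - 1, by omega⟩
    obtain ⟨q, rfl⟩ : ∃ q', q = q' + 1 := ⟨q - 1, by omega⟩
    have hp' : p = r + s := by omega
    have hq' : q = r + t := by omega
    have happ : ∀ {u v : ℕ} (h : v + 1 = r + 1 + u) (h' : v = r + u) (k : Fin N) (i : Fin r → Fin N)
        (y : Fin u → Fin N), Fin.append (Fin.cons k i : Fin (r + 1) → Fin N) y ∘ Fin.cast h =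
          (Fin.cons k (Fin.append i y ∘ Fin.cast h') : Fin (v + 1) → Fin N) := by
      intro u v h h' k i y
      subst h'
      rw [Fin.append_cons]
      rfl
    simp only [contr, pderiv_tensorPoly ha, pderiv_tensorPoly hb, contr_smul_smul,
      ih hp' hq' (ha.cons _) (hb.cons _), smul_smul]
    rw [← Finset.smul_sum, ← tensorPoly_sum]
    congr 1
    · rw [Nat.succ_descFactorial_succ, Nat.succ_descFactorial_succ]
      push_cast
      ring
    · congr 1
      ext j
      rw [sum_eq_sum_cons]
      simp_rw [happ hp hp', happ hq hq']

end TensorPoly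

end WienerChaos

namespace WienerChaos

/-! ## Finitely supported tensors -/

section FinitelySupported

open MvPolynomial

variable {N m : ℕ}

/-- The coordinates of `f` vanish outside of `{0, …, N - 1}^m`. -/
def SupportedBelow (N : ℕ) {m : ℕ} (f : TensorPower m) : Prop :=
  ∀ j : Fin m → ℕ, (∃ i, N ≤ j i) → f j = 0

/-- The coordinates of `f` in `{0, …, N - 1}^m`. -/
def restr (N : ℕ) {m : ℕ} (f : TensorPower m) (j : Fin m → Fin N) : ℝ := f fun i => j i

lemma tsum_eq_sum_of_supported {g : (Fin m → ℕ) → ℝ}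
    (hg : ∀ j : Fin m → ℕ, (∃ i, N ≤ j i) → g j = 0) :
    ∑' j, g j = ∑ j : Fin m → Fin N, g fun i => j i := by
  have hinj : Function.Injective fun (j : Fin m → Fin N) (i : Fin m) => (j i : ℕ) := by
    intro j k h
    ext i
    exact congrFun h i
  rw [← hinj.tsum_eq, tsum_fintype]
  intro j hj
  by_contra h
  refine hj (hg j ?_)
  by_contra! h'
  exact h ⟨fun i => ⟨j i, h' i⟩, rfl⟩

lemma TensorPower.norm_sq_eq_tsum (f : TensorPower m) : ‖f‖ ^ 2 = ∑' j, f j ^ 2 := by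
  rw [← real_inner_self_eq_norm_sq, lp.inner_eq_tsum]
  simp [sq]

lemma SupportedBelow.norm_sq {f : TensorPower m} (hf : SupportedBelow N f) :
    ‖f‖ ^ 2 = ∑ j, restr N f j ^ 2 := by
  rw [TensorPower.norm_sq_eq_tsum, tsum_eq_sum_of_supported (N := N)]
  · rfl
  · intro j hj
    rw [hf j hj, sq, zero_mul]

lemma symmetrize_apply (f : TensorPower m) (j : Fin m → ℕ) :
    symmetrize f j = (m ! : ℝ)⁻¹ * ∑ σ : Equiv.Perm (Fin m), f (j ∘ σ) := rfl

lemma isSymmetric_symmetrize (f : TensorPower m) : IsSymmetric (symmetrize f) := by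
  intro σ j
  rw [symmetrize_apply, symmetrize_apply]
  congr 1
  exact Equiv.sum_comp (Equiv.mulLeft σ) fun τ : Equiv.Perm (Fin m) => (f (j ∘ τ) : ℝ)

lemma IsSymmetric.symmetrize_eq {f : TensorPower m} (hf : IsSymmetric f) : symmetrize f = f := by
  ext j
  rw [symmetrize_apply]
  simp_rw [hf _ j]
  rw [Finset.sum_const, Finset.card_univ, Fintype.card_perm, Fintype.card_fin, nsmul_eq_mul,
    inv_mul_cancel_left₀ (by positivity)]

lemma IsSymmetric.symmCoeff_restr {f : TensorPower m} (hf : IsSymmetric f) :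
    SymmCoeff (restr N f) := fun σ j => hf σ fun i => j i

lemma SupportedBelow.symmetrize {f : TensorPower m} (hf : SupportedBelow N f) :
    SupportedBelow N (symmetrize f) := by
  rintro j ⟨i, hi⟩
  rw [symmetrize_apply, Finset.sum_eq_zero, mul_zero]
  intro σ _
  exact hf _ ⟨σ.symm i, by simpa using hi⟩

lemma restr_add (f g : TensorPower m) :
    restr N (f + g) = fun j => restr N f j + restr N g j := rfl

lemma restr_smul (c : ℝ) (f : TensorPower m) : restr N (c • f) = fun j => c * restr N f j := rfl

/-- The polynomial of a tensor, truncated to the first `N` basis vectors. -/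
noncomputable def toPoly (N : ℕ) : TensorPower m →ₗ[ℝ] MvPolynomial (Fin N) ℝ where
  toFun f := tensorPoly (restr N f)
  map_add' f g := by rw [restr_add, tensorPoly_add]
  map_smul' c f := by rw [restr_smul, tensorPoly_smul, RingHom.id_apply]

lemma toPoly_apply (f : TensorPower m) : toPoly N f = tensorPoly (restr N f) := rfl

lemma isHomogeneous_toPoly (f : TensorPower m) : (toPoly N f).IsHomogeneous m :=
  isHomogeneous_tensorPoly _

lemma toPoly_symmetrize (f : TensorPower m) : toPoly N (symmetrize f) = toPoly N f := by
  have h : restr N (symmetrize f) = fun j => (m ! : ℝ)⁻¹ *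
      ∑ σ : Equiv.Perm (Fin m), restr N f (j ∘ σ) := rfl
  rw [toPoly_apply, h, tensorPoly_smul, tensorPoly_sum]
  simp_rw [tensorPoly_comp_perm]
  rw [Finset.sum_const, Finset.card_univ, Fintype.card_perm, Fintype.card_fin,
    ← Nat.cast_smul_eq_nsmul ℝ, inv_smul_smul₀ (by positivity), toPoly_apply]

/-- The polynomial of a tensor sees only its symmetrization, which is why the norms in `T3` are
those of symmetrized contractions. -/
lemma SupportedBelow.expect_wick_sq {f : TensorPower m} (hf : SupportedBelow N f) :
    expect (wick (toPoly N f) ^ 2) = m ! * ‖WienerChaos.symmetrize f‖ ^ 2 := by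
  rw [← toPoly_symmetrize, sq, toPoly_apply,
    expect_wick_tensorPoly_mul _ (isSymmetric_symmetrize f).symmCoeff_restr, hf.symmetrize.norm_sq]
  simp_rw [sq]

variable {r s t p q n : ℕ} (hp : p = r + s) (hq : q = r + t) (hn : n = s + t)

lemma contraction_apply (f : TensorPower p) (g : TensorPower q) (j : Fin n → ℕ) :
    contraction hp hq hn f g j = ∑' i : Fin r → ℕ,
      f (Fin.append i (fun a : Fin s => j (Fin.cast hn.symm (Fin.castAdd t a))) ∘ Fin.cast hp) *
      g (Fin.append i (fun b : Fin t => j (Fin.cast hn.symm (Fin.natAdd s b))) ∘ Fin.cast hq) := rfl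

lemma SupportedBelow.contraction {f : TensorPower p} {g : TensorPower q} (hf : SupportedBelow N f)
    (hg : SupportedBelow N g) : SupportedBelow N (contraction hp hq hn f g) := by
  rintro j ⟨x, hx⟩
  rw [contraction_apply]
  subst hp hq hn
  refine (tsum_congr fun i => ?_).trans tsum_zero
  induction x using Fin.addCases with
  | left x => rw [hf _ ⟨Fin.natAdd r x, by simpa using hx⟩, zero_mul]
  | right x => rw [hg _ ⟨Fin.natAdd r x, by simpa using hx⟩, mul_zero]

lemma SupportedBelow.restr_contraction {f : TensorPower p} {g : TensorPower q}
    (hf : SupportedBelow N f) (j : Fin n → Fin N) :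
    restr N (WienerChaos.contraction hp hq hn f g) j = ∑ i : Fin r → Fin N,
      restr N f (Fin.append i (fun a : Fin s => j (Fin.cast hn.symm (Fin.castAdd t a))) ∘
        Fin.cast hp) *
      restr N g (Fin.append i (fun b : Fin t => j (Fin.cast hn.symm (Fin.natAdd s b))) ∘
        Fin.cast hq) := by
  subst hp hq hn
  rw [restr, contraction_apply, tsum_eq_sum_of_supported (N := N)]
  · refine Finset.sum_congr rfl fun i _ => ?_
    have happ : ∀ {u : ℕ} (y : Fin u → Fin N),
        (Fin.append (fun x => (i x : ℕ)) fun x => (y x : ℕ)) =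
          fun x => ((Fin.append i y x : Fin N) : ℕ) := by
      intro u y
      ext x
      induction x using Fin.addCases <;> simp
    simp only [Fin.cast_refl, Function.comp_id, restr, happ]
  · rintro i ⟨x, hx⟩
    rw [hf _ ⟨Fin.castAdd s x, by simpa using hx⟩, zero_mul]

lemma SupportedBelow.contr_toPoly {f : TensorPower p} {g : TensorPower q}
    (hf : SupportedBelow N f) (hfs : IsSymmetric f) (hgs : IsSymmetric g) :
    contr r (toPoly N f) (toPoly N g) = ((p.descFactorial r : ℝ) * q.descFactorial r) •
      toPoly N (WienerChaos.contraction hp hq hn f g) := by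
  rw [toPoly_apply, toPoly_apply, toPoly_apply, contr_tensorPoly hp hq hn hfs.symmCoeff_restr
    hgs.symmCoeff_restr]
  congr 2
  ext j
  rw [hf.restr_contraction]

lemma SupportedBelow.expect_wick_contr_sq {f : TensorPower p} (hn : n = s + s)
    (hf : SupportedBelow N f) (hfs : IsSymmetric f) :
    expect (wick (contr r (toPoly N f) (toPoly N f)) ^ 2) = (p.descFactorial r : ℝ) ^ 4 * n ! *
      ‖WienerChaos.symmetrize (WienerChaos.contraction hp hp hn f f)‖ ^ 2 := by
  rw [hf.contr_toPoly hp hp hn hfs hfs, map_smul, smul_pow, map_smul,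
    (hf.contraction hp hp hn hf).expect_wick_sq, smul_eq_mul]
  ring

end FinitelySupported

/-! ### Identification of `T3` with the Stein discrepancy for finitely supported kernels -/

section Discrepancy

open MvPolynomial

variable {N d : ℕ}

lemma SupportedBelow.expect_wick_pow_four {h : TensorPower d} (hsup : SupportedBelow N h)
    (hsymm : IsSymmetric h) :
    expect (wick (toPoly N h) ^ 4) = ∑ r : Fin (d + 1),
      ((r : ℕ) ! : ℝ)⁻¹ ^ 2 * ((d.descFactorial r : ℝ) ^ 4 * (2 * d - 2 * r : ℕ)! *
        ‖WienerChaos.symmetrize (WienerChaos.contraction (r := r) (s := d - r) (t := d - r)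
          (n := 2 * d - 2 * r) (by omega) (by omega) (by omega) h h)‖ ^ 2) := by
  rw [expect_wick_pow_four_eq_sum (isHomogeneous_toPoly h), Finset.sum_range]
  refine Finset.sum_congr rfl fun r _ => ?_
  congr 1
  exact hsup.expect_wick_contr_sq _ _ hsymm

lemma gradWeight_sq_mul {r : ℕ} (hr : 1 ≤ r) (hrd : r ≤ d) :
    gradWeight d r ^ 2 * (d.descFactorial r : ℝ) ^ 4 =
      (d : ℝ) ^ 2 * ((r - 1 : ℕ)! : ℝ) ^ 2 * ((d - 1).choose (r - 1) : ℝ) ^ 4 := by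
  obtain ⟨r, rfl⟩ := Nat.exists_eq_succ_of_ne_zero (by omega : r ≠ 0)
  obtain ⟨d, rfl⟩ := Nat.exists_eq_succ_of_ne_zero (by omega : d ≠ 0)
  simp only [Nat.succ_eq_add_one, Nat.add_sub_cancel, Nat.succ_descFactorial_succ, gradWeight,
    Nat.descFactorial_eq_factorial_mul_choose, Nat.factorial_succ]
  push_cast
  field_simp

/-- The factor `2` on the right matches the `2` in `2F`; pulling it out of the square yields the `4`
in `T3`. -/
lemma gradWeight_half_mul (hd : Even d) (hd2 : 2 ≤ d) :
    gradWeight d (d / 2) * ((d.descFactorial (d / 2) : ℝ) * d.descFactorial (d / 2)) =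
      2 * ((d ! : ℝ) ^ 2 / (4 * ((d / 2)! : ℝ) ^ 3)) := by
  obtain ⟨k, rfl⟩ := hd
  have hk : (k + k) / 2 = k := by omega
  have hk0 : (k : ℝ) ≠ 0 := by
    have : k ≠ 0 := by omega
    exact_mod_cast this
  have h := Nat.factorial_mul_descFactorial (Nat.le_add_left k k)
  rw [Nat.add_sub_cancel] at h
  have h' : (k ! : ℝ) * (k + k).descFactorial k = (k + k)! := by exact_mod_cast h
  rw [hk, ← h', gradWeight]
  push_cast
  have : (k ! : ℝ) ≠ 0 := by positivity
  field_simp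
  ring

/-- The quantity `T₃` of a finitely supported kernel is the Stein discrepancy of its integral. -/
lemma SupportedBelow.steinDiscrepancy_toPoly {h : TensorPower d} (hsup : SupportedBelow N h)
    (hsymm : IsSymmetric h) (hd : Even d) (hd2 : 2 ≤ d) :
    T3 hd h = Real.sqrt (steinDiscrepancy d (toPoly N h)) := by
  rw [T3, steinDiscrepancy]
  have hh := eq_half_add_half hd
  congr 2
  · set c : ℝ := (d ! : ℝ) ^ 2 / (4 * ((d / 2)! : ℝ) ^ 3) with hc
    set g := WienerChaos.contraction hh hh hh h h with hg
    have hgs : SupportedBelow N g := hsup.contraction hh hh hh hsup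
    have hsub : SupportedBelow N (h - c • WienerChaos.symmetrize g) := by
      intro j hj
      change h j - c * WienerChaos.symmetrize g j = 0
      rw [hsup j hj, hgs.symmetrize j hj, mul_zero, sub_zero]
    have hss : IsSymmetric (h - c • WienerChaos.symmetrize g) := by
      intro σ j
      change h (j ∘ σ) - c * WienerChaos.symmetrize g (j ∘ σ) = h j - c * WienerChaos.symmetrize g j
      rw [hsymm σ j, isSymmetric_symmetrize g σ j]
    have := hsub.expect_wick_sq
    rw [hss.symmetrize_eq] at this
    -- The argument of `wick` becomes twice the polynomial of the tensor `h - c • symmetrize g`.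
    rw [hsup.contr_toPoly hh hh hh hsymm hsymm, smul_smul, gradWeight_half_mul hd hd2, ← hg, ← hc,
      mul_smul, ← smul_sub, ← toPoly_symmetrize g, ← map_smul (toPoly N), ← map_sub, map_smul,
      smul_pow, map_smul, this, smul_eq_mul]
    ring
  · rw [Finset.sum_filter, Finset.sum_filter, Finset.sum_range, Finset.mul_sum]
    refine Finset.sum_congr rfl fun r _ => ?_
    split_ifs with hr
    · rw [hsup.expect_wick_contr_sq (s := d - r) (n := 2 * d - 2 * r) (by omega) (by omega) hsymm,
        ← mul_assoc (gradWeight d r ^ 2), ← mul_assoc (gradWeight d r ^ 2),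
        gradWeight_sq_mul hr.1 r.2.le]
      ring
    · rw [mul_zero]

end Discrepancy

/-! ### Hermite products as Wick powers of the symmetrized basis -/

section SymmBasis

open MvPolynomial

lemma MultiIndex.prod_tuple {M : Type*} [CommMonoid M] {d : ℕ} (q : MultiIndex d) (g : ℕ → M) :
    ∏ i, g (q.tuple i) = q.1.prod fun k n => g k ^ n := by
  have h : ∀ (l : List ℕ) (n : ℕ) (hn : n = l.length),
      ∏ i : Fin n, g (l.get (Fin.cast hn i)) = (l.map g).prod := by
    rintro l n rfl
    simp [Fin.prod_univ_fun_getElem]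
  rw [show ∏ i, g (q.tuple i) = _ from h _ _ _, ← Multiset.prod_coe, ← Multiset.map_coe,
    Multiset.sort_eq, Finsupp.toMultiset_map, Finsupp.prod_toMultiset,
    Finsupp.prod_mapDomain_index pow_zero pow_add]

lemma MultiIndex.tuple_mem_support {d : ℕ} (q : MultiIndex d) (i : Fin d) :
    q.tuple i ∈ q.1.support := by
  have : q.tuple i ∈ (Finsupp.toMultiset q.1).sort := List.get_mem _ _
  rwa [Multiset.mem_sort, Finsupp.mem_toMultiset] at this

variable {H : Type*} [NormedAddCommGroup H] [InnerProductSpace ℝ H] (e : HilbertBasis ℕ ℝ H)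
  {d N : ℕ}

lemma supportedBelow_single {j : Fin d → ℕ} (hj : ∀ i, j i < N) :
    SupportedBelow N (lp.single 2 j (1 : ℝ) : TensorPower d) := by
  rintro k ⟨i, hi⟩
  have : k ≠ j := by
    rintro rfl
    exact absurd (hj i) (not_lt.2 hi)
  simp [lp.single_apply, this]

lemma supportedBelow_symmBasis {q : MultiIndex d} (hq : ∀ k ∈ q.1.support, k < N) :
    SupportedBelow N (symmBasis e q) := by
  rw [symmBasis, tprod_basis]
  exact (supportedBelow_single fun i => hq _ (q.tuple_mem_support i)).symmetrize

/-- Symmetrization does not change the polynomial, so the nondecreasing tuple alone gives the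
monomial, with coefficient one. -/
lemma toPoly_symmBasis {q : MultiIndex d} (hq : ∀ k ∈ q.1.support, k < N) :
    toPoly N (symmBasis e q) =
      monomial (Finsupp.equivFunOnFinite.symm fun k : Fin N => q.1 k) 1 := by
  rw [symmBasis, tprod_basis, toPoly_symmetrize, toPoly_apply, tensorPoly]
  have hlt : ∀ i, q.tuple i < N := fun i => hq _ (q.tuple_mem_support i)
  rw [Finset.sum_eq_single (fun i => (⟨q.tuple i, hlt i⟩ : Fin N))]
  · have h1 : restr N (lp.single 2 q.tuple (1 : ℝ) : TensorPower d)
        (fun i => (⟨q.tuple i, hlt i⟩ : Fin N)) = 1 := by simp [restr, lp.single_apply]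
    rw [h1, one_smul]
    set g : ℕ → MvPolynomial (Fin N) ℝ := fun k => if hk : k < N then X ⟨k, hk⟩ else 1 with hg
    have h2 : ∀ i, (X (⟨q.tuple i, hlt i⟩ : Fin N) : MvPolynomial (Fin N) ℝ) = g (q.tuple i) := by
      intro i
      rw [hg]
      simp [hlt i]
    simp_rw [h2]
    rw [MultiIndex.prod_tuple q g, monomial_eq, C_1, one_mul,
      Finsupp.prod_of_support_subset q.1 (s := Finset.range N)
        (fun k hk => Finset.mem_range.2 (hq k hk)) _ (fun _ _ => pow_zero _), Finset.prod_range,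
      Finsupp.prod_fintype _ _ (fun _ => pow_zero _)]
    refine Finset.prod_congr rfl fun k _ => ?_
    simp [hg]
  · intro j _ hj
    have : (fun i => (j i : ℕ)) ≠ q.tuple := by
      intro h
      apply hj
      ext i
      exact congrFun h i
    simp [restr, lp.single_apply, this]
  · simp

lemma eval_wick_toPoly_symmBasis {Ω : Type*} (G : ℕ → Ω → ℝ) {q : MultiIndex d}
    (hq : ∀ k ∈ q.1.support, k < N) (ω : Ω) :
    eval (fun i : Fin N => G i ω) (wick (toPoly N (symmBasis e q))) = hermiteProd G q ω := by
  rw [toPoly_symmBasis e hq, wick_monomial, map_prod, hermiteProd,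
    Finset.prod_subset (s₁ := q.1.support) (s₂ := Finset.range N)
      (fun k hk => Finset.mem_range.2 (hq k hk)), Finset.prod_range]
  · refine Finset.prod_congr rfl fun k _ => ?_
    have : ∀ P : Polynomial ℤ, eval (fun i : Fin N => G i ω)
        (Polynomial.aeval (X k : MvPolynomial (Fin N) ℝ) P) = Polynomial.aeval (G k ω) P := by
      intro P
      induction P using Polynomial.induction_on' with
      | add P Q hP hQ => simp [hP, hQ]
      | monomial n a => simp [Polynomial.aeval_monomial]
    rw [this]
    rfl
  · intro k _ hk
    rw [Finsupp.notMem_support_iff.1 hk]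
    simp

end SymmBasis

end WienerChaos

namespace WienerChaos

/-! ## Stein's equation for the centered chi-square law -/

section SteinSolution

open Real intervalIntegral

/-- The solution of Stein's equation `2 y f' - (y - 2 b) f = k`. -/
noncomputable def steinSol (b : ℝ) (k : ℝ → ℝ) (y : ℝ) : ℝ :=
  1 / 2 * ∫ s in (0 : ℝ)..1, s ^ (b - 1) * (k (y * s) * exp (y * (1 - s) / 2))

/-- The derivative of `steinSol b k`, where `k'` is the derivative of `k`. -/
noncomputable def steinSolDeriv (b : ℝ) (k k' : ℝ → ℝ) (y : ℝ) : ℝ :=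
  1 / 2 * ∫ s in (0 : ℝ)..1,
    s ^ (b - 1) * ((k' (y * s) * s + k (y * s) * ((1 - s) / 2)) * exp (y * (1 - s) / 2))

variable {b : ℝ} {k k' : ℝ → ℝ}

/-- For one degree of freedom `b - 1 = -1/2`, so the weight may be singular at `0`, but remains
integrable. -/
lemma intervalIntegrable_rpow_mul (hb : 0 < b) {g : ℝ → ℝ} (hg : Continuous g) :
    IntervalIntegrable (fun s => s ^ (b - 1) * g s) volume 0 1 :=
  (intervalIntegrable_rpow' (by linarith)).mul_continuousOn hg.continuousOn

/-- The two terms are bounded by `s` and `1 - s`. This serves both for differentiation under the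
integral and for the estimate at `y ≤ 0`. -/
lemma abs_steinSolDeriv_integrand_le (hk2 : ∀ y, |k y| ≤ 2) (hk1 : ∀ y, |k' y| ≤ 1) {s : ℝ}
    (hs : s ∈ Set.Ioc (0 : ℝ) 1) (y : ℝ) :
    |k' (y * s) * s + k (y * s) * ((1 - s) / 2)| ≤ 1 := by
  have h1 : |k' (y * s) * s| ≤ 1 * s := by
    rw [abs_mul, abs_of_pos hs.1]
    exact mul_le_mul_of_nonneg_right (hk1 _) hs.1.le
  have h2 : |k (y * s) * ((1 - s) / 2)| ≤ 2 * ((1 - s) / 2) := by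
    have h0 : 0 ≤ (1 - s) / 2 := by linarith [hs.2]
    rw [abs_mul, abs_of_nonneg h0]
    exact mul_le_mul_of_nonneg_right (hk2 _) h0
  linarith [abs_add_le (k' (y * s) * s) (k (y * s) * ((1 - s) / 2))]

lemma hasDerivAt_steinSol (hb : 0 < b) (hk : ∀ y, HasDerivAt k (k' y) y) (hk' : Continuous k')
    (hk2 : ∀ y, |k y| ≤ 2) (hk1 : ∀ y, |k' y| ≤ 1) (y : ℝ) :
    HasDerivAt (steinSol b k) (steinSolDeriv b k k' y) y := by
  have hkc : Continuous k := continuous_iff_continuousAt.2 fun y => (hk y).continuousAt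
  refine HasDerivAt.const_mul (1 / 2) ?_
  refine (intervalIntegral.hasDerivAt_integral_of_dominated_loc_of_deriv_le
    (F := fun z s => s ^ (b - 1) * (k (z * s) * exp (z * (1 - s) / 2)))
    (F' := fun z s => s ^ (b - 1) *
      ((k' (z * s) * s + k (z * s) * ((1 - s) / 2)) * exp (z * (1 - s) / 2)))
    (bound := fun s => s ^ (b - 1) * exp ((|y| + 1) / 2)) (Metric.ball_mem_nhds y one_pos)
    (Eventually.of_forall fun z => ?_) ?_ ?_ ?_ ?_ ?_).2
  · refine (intervalIntegrable_iff.1 (intervalIntegrable_rpow_mul hb ?_)).aestronglyMeasurable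
    fun_prop
  · exact intervalIntegrable_rpow_mul hb (by fun_prop)
  · refine (intervalIntegrable_iff.1 (intervalIntegrable_rpow_mul hb ?_)).aestronglyMeasurable
    fun_prop
  · refine ae_of_all _ fun s hs z hz => ?_
    rw [Set.uIoc_of_le zero_le_one] at hs
    rw [norm_mul, norm_mul, norm_of_nonneg (rpow_nonneg hs.1.le _), Real.norm_eq_abs,
      Real.norm_eq_abs, abs_exp]
    refine mul_le_mul_of_nonneg_left ?_ (rpow_nonneg hs.1.le _)
    have hz' : z ≤ |y| + 1 := by
      rw [Metric.mem_ball, Real.dist_eq] at hz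
      linarith [le_abs_self (z - y), le_abs_self y]
    have h3 : exp (z * (1 - s) / 2) ≤ exp ((|y| + 1) / 2) := by
      refine exp_le_exp.2 ?_
      nlinarith [hs.1, hs.2, abs_nonneg y]
    calc _ ≤ 1 * exp (z * (1 - s) / 2) := mul_le_mul_of_nonneg_right
          (abs_steinSolDeriv_integrand_le hk2 hk1 hs z) (exp_pos _).le
      _ ≤ _ := by rwa [one_mul]
  · exact intervalIntegrable_rpow_mul hb continuous_const
  · refine ae_of_all _ fun s _ z _ => ?_
    refine HasDerivAt.const_mul _ ?_
    have h1 : HasDerivAt (fun z => k (z * s)) (k' (z * s) * s) z := by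
      have := (hk (z * s)).comp z ((hasDerivAt_id z).mul_const s)
      simpa using! this
    have h2 : HasDerivAt (fun z => exp (z * (1 - s) / 2)) (exp (z * (1 - s) / 2) * ((1 - s) / 2)) z := by
      have := (((hasDerivAt_id z).mul_const (1 - s)).div_const 2).exp
      simpa using! this
    convert! h1.mul h2 using 1
    ring

/-- `steinSol` solves Stein's equation. -/
lemma steinSol_eq (hb : 0 < b) (hk : ∀ y, HasDerivAt k (k' y) y) (hk' : Continuous k') (y : ℝ) :
    2 * y * steinSolDeriv b k k' y - (y - 2 * b) * steinSol b k y = k y := by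
  have hkc : Continuous k := continuous_iff_continuousAt.2 fun y => (hk y).continuousAt
  set g : ℝ → ℝ := fun s => s ^ b * (k (y * s) * exp (y * (1 - s) / 2)) with hg
  set i1 : ℝ → ℝ := fun s =>
    s ^ (b - 1) * ((k' (y * s) * s + k (y * s) * ((1 - s) / 2)) * exp (y * (1 - s) / 2)) with hi1
  set i2 : ℝ → ℝ := fun s => s ^ (b - 1) * (k (y * s) * exp (y * (1 - s) / 2)) with hi2
  have hint1 : IntervalIntegrable i1 volume 0 1 := intervalIntegrable_rpow_mul hb (by fun_prop)
  have hint2 : IntervalIntegrable i2 volume 0 1 := intervalIntegrable_rpow_mul hb (by fun_prop)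
  -- The equation is the fundamental theorem of calculus in `s` for `g`, which equals `k y` at `s =
  -- 1` and `0` at `s = 0`. No division by `y` occurs, so every real `y` is covered.
  have hderiv : ∀ s ∈ Set.Ioo (0 : ℝ) 1,
      HasDerivAt g (y * i1 s - (y - 2 * b) / 2 * i2 s) s := by
    intro s hs
    have h0 := hasDerivAt_rpow_const (x := s) (p := b) (Or.inl hs.1.ne')
    have h1 : HasDerivAt (fun s => k (y * s)) (k' (y * s) * y) s := by
      have := (hk (y * s)).comp s ((hasDerivAt_id s).const_mul y)
      simpa using! this
    have h2 : HasDerivAt (fun s => exp (y * (1 - s) / 2)) (exp (y * (1 - s) / 2) * (-y / 2)) s := by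
      have := ((((hasDerivAt_id s).const_sub 1).const_mul y).div_const 2).exp
      simpa using! this
    convert! h0.mul (h1.mul h2) using 1
    have hsb : s ^ b = s ^ (b - 1) * s := by
      rw [← rpow_add_one hs.1.ne', sub_add_cancel]
    simp only [hi1, hi2, hsb, Pi.mul_apply]
    ring
  have hcont : ContinuousOn g (Set.Icc 0 1) := by
    refine Continuous.continuousOn ?_
    exact (continuous_rpow_const hb.le).mul (by fun_prop)
  have hftc := integral_eq_sub_of_hasDerivAt_of_le zero_le_one hcont hderiv
    ((hint1.const_mul _).sub (hint2.const_mul _))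
  rw [intervalIntegral.integral_sub (hint1.const_mul _) (hint2.const_mul _), intervalIntegral.integral_const_mul,
    intervalIntegral.integral_const_mul] at hftc
  have hg1 : g 1 = k y := by simp [hg]
  have hg0 : g 0 = 0 := by simp [hg, hb.ne']
  rw [hg1, hg0, sub_zero] at hftc
  rw [steinSol, steinSolDeriv, ← hftc]
  ring

/-- The bound on the derivative on the negative half-line. -/
lemma abs_steinSolDeriv_le_of_nonpos (hb : 0 < b) (hk2 : ∀ y, |k y| ≤ 2) (hk1 : ∀ y, |k' y| ≤ 1)
    {y : ℝ} (hy : y ≤ 0) : |steinSolDeriv b k k' y| ≤ 1 / (2 * b) := by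
  have h : ‖∫ s in (0 : ℝ)..1, s ^ (b - 1) * ((k' (y * s) * s + k (y * s) * ((1 - s) / 2)) *
      exp (y * (1 - s) / 2))‖ ≤ ∫ s in (0 : ℝ)..1, s ^ (b - 1) := by
    refine norm_integral_le_of_norm_le zero_le_one (ae_of_all _ fun s hs => ?_)
      (intervalIntegrable_rpow' (by linarith))
    rw [norm_mul, norm_of_nonneg (rpow_nonneg hs.1.le _), norm_mul, Real.norm_eq_abs,
      Real.norm_eq_abs, abs_exp]
    have h3 : exp (y * (1 - s) / 2) ≤ 1 := by
      rw [exp_le_one_iff]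
      nlinarith [hs.2]
    have := mul_le_one₀ (abs_steinSolDeriv_integrand_le hk2 hk1 hs y) (exp_pos _).le h3
    exact mul_le_of_le_one_right (rpow_nonneg hs.1.le _) this
  rw [integral_rpow (Or.inl (by linarith)), sub_add_cancel, one_rpow, zero_rpow hb.ne', sub_zero,
    Real.norm_eq_abs] at h
  rw [steinSolDeriv, abs_mul, abs_of_pos (by norm_num : (0 : ℝ) < 1 / 2)]
  calc _ ≤ 1 / 2 * (1 / b) := by linarith
    _ = _ := by field_simp

end SteinSolution

end WienerChaos

namespace WienerChaos

/-! ### Comparison principles from a vanishing limit at one end -/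

section Comparison

/-- This and its counterpart at infinity reduce inequalities between Gamma integrals to pointwise
inequalities between derivatives. -/
lemma nonneg_of_hasDerivAt_nonneg {g g' : ℝ → ℝ} {y : ℝ} (hy : 0 < y)
    (hg : ∀ t, 0 < t → t ≤ y → HasDerivAt g (g' t) t) (hg' : ∀ t, 0 < t → t ≤ y → 0 ≤ g' t)
    (h0 : Tendsto g (𝓝[>] 0) (𝓝 0)) : 0 ≤ g y := by
  have hmono : MonotoneOn g (Set.Ioc 0 y) := by
    refine monotoneOn_of_deriv_nonneg (convex_Ioc 0 y)
      (fun t ht => (hg t ht.1 ht.2).continuousAt.continuousWithinAt) ?_ ?_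
    · intro t ht
      rw [interior_Ioc] at ht
      exact (hg t ht.1 ht.2.le).differentiableAt.differentiableWithinAt
    · intro t ht
      rw [interior_Ioc] at ht
      rw [(hg t ht.1 ht.2.le).deriv]
      exact hg' t ht.1 ht.2.le
  refine le_of_tendsto h0 ?_
  filter_upwards [Ioo_mem_nhdsGT hy] with t ht
  exact hmono ⟨ht.1, ht.2.le⟩ ⟨hy, le_rfl⟩ ht.2.le

lemma nonneg_of_hasDerivAt_nonpos {g g' : ℝ → ℝ} {y : ℝ}
    (hg : ∀ t, y ≤ t → HasDerivAt g (g' t) t) (hg' : ∀ t, y ≤ t → g' t ≤ 0)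
    (h0 : Tendsto g atTop (𝓝 0)) : 0 ≤ g y := by
  have hanti : AntitoneOn g (Set.Ici y) := by
    refine antitoneOn_of_deriv_nonpos (convex_Ici y)
      (fun t ht => (hg t ht).continuousAt.continuousWithinAt) ?_ ?_
    · intro t ht
      rw [interior_Ici] at ht
      exact (hg t (le_of_lt ht)).differentiableAt.differentiableWithinAt
    · intro t ht
      rw [interior_Ici] at ht
      rw [(hg t (le_of_lt ht)).deriv]
      exact hg' t (le_of_lt ht)
  refine le_of_tendsto h0 ?_
  filter_upwards [eventually_ge_atTop y] with t ht
  exact hanti Set.self_mem_Ici ht ht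

end Comparison

/-! ### The Gamma weight, its two tail masses and their first moments -/

section GammaWeight

open Real

/-- The unnormalized Gamma density with shape `b + 1` and rate `1 / 2`. -/
noncomputable def gammaWeight (b y : ℝ) : ℝ := y ^ b * exp (-(1 / 2) * y)

variable {b y : ℝ}

lemma gammaWeight_pos (hy : 0 < y) : 0 < gammaWeight b y :=
  mul_pos (rpow_pos_of_pos hy _) (exp_pos _)

lemma gammaWeight_eq_mul (hy : 0 < y) : gammaWeight b y = y * gammaWeight (b - 1) y := by
  rw [gammaWeight, gammaWeight, ← mul_assoc, mul_comm y, ← rpow_add_one hy.ne', sub_add_cancel]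

lemma continuous_gammaWeight (hb : 0 < b) : Continuous (gammaWeight b) :=
  (continuous_rpow_const hb.le).mul (by fun_prop)

lemma gammaWeight_zero (hb : 0 < b) : gammaWeight b 0 = 0 := by
  simp [gammaWeight, hb.ne']

lemma hasDerivAt_gammaWeight (hy : 0 < y) :
    HasDerivAt (gammaWeight b) (1 / 2 * gammaWeight (b - 1) y * (2 * b - y)) y := by
  have h1 := hasDerivAt_rpow_const (x := y) (p := b) (Or.inl hy.ne')
  have h2 : HasDerivAt (fun y => exp (-(1 / 2) * y)) (exp (-(1 / 2) * y) * (-(1 / 2))) y := by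
    have := ((hasDerivAt_id y).const_mul (-(1 / 2) : ℝ)).exp
    simpa using! this
  convert! h1.mul h2 using 1
  have hyb : y ^ b = y ^ (b - 1) * y := by rw [← rpow_add_one hy.ne', sub_add_cancel]
  rw [gammaWeight, hyb]
  ring

lemma hasDerivAt_mul_gammaWeight (hy : 0 < y) :
    HasDerivAt (fun y => 2 * y * gammaWeight b y) ((2 * b + 2 - y) * gammaWeight b y) y := by
  convert! ((hasDerivAt_id y).const_mul 2).mul (hasDerivAt_gammaWeight (b := b) hy) using 1
  rw [gammaWeight_eq_mul (b := b) hy]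
  simp only [id]
  ring

lemma tendsto_gammaWeight_atTop (b : ℝ) : Tendsto (gammaWeight b) atTop (𝓝 0) :=
  tendsto_rpow_mul_exp_neg_mul_atTop_nhds_zero b (1 / 2) (by norm_num)

lemma tendsto_id_mul_gammaWeight_atTop (b : ℝ) :
    Tendsto (fun y => y * gammaWeight b y) atTop (𝓝 0) := by
  refine (tendsto_gammaWeight_atTop (b + 1)).congr' ?_
  filter_upwards [eventually_gt_atTop 0] with y hy
  rw [gammaWeight_eq_mul hy, add_sub_cancel_right]

lemma integrableOn_gammaWeight (hb : -1 < b) : IntegrableOn (gammaWeight b) (Set.Ioi 0) := by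
  have := integrableOn_rpow_mul_exp_neg_mul_rpow hb one_pos (by norm_num : (0 : ℝ) < 1 / 2)
  refine this.congr_fun (fun t _ => ?_) measurableSet_Ioi
  simp [gammaWeight]

lemma gammaWeight_mono (hb : 0 < b) {t : ℝ} (ht : 0 < t) (hty : t ≤ y) (hy : y ≤ 2 * b) :
    gammaWeight b t ≤ gammaWeight b y := by
  refine monotoneOn_of_deriv_nonneg (convex_Icc t y) (continuous_gammaWeight hb).continuousOn ?_ ?_
    ⟨le_rfl, hty⟩ ⟨hty, le_rfl⟩ hty
  · intro s hs
    rw [interior_Icc] at hs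
    exact (hasDerivAt_gammaWeight (ht.trans hs.1)).differentiableAt.differentiableWithinAt
  · intro s hs
    rw [interior_Icc] at hs
    rw [(hasDerivAt_gammaWeight (ht.trans hs.1)).deriv]
    have := gammaWeight_pos (b := b - 1) (ht.trans hs.1)
    exact mul_nonneg (by positivity) (by linarith [hs.2])

lemma gammaWeight_anti (hb : 0 < b) {t : ℝ} (hy : 2 * b ≤ y) (hyt : y ≤ t) :
    gammaWeight b t ≤ gammaWeight b y := by
  have hy0 : 0 < y := by linarith
  refine antitoneOn_of_deriv_nonpos (convex_Icc y t) (continuous_gammaWeight hb).continuousOn ?_ ?_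
    ⟨le_rfl, hyt⟩ ⟨hyt, le_rfl⟩ hyt
  · intro s hs
    rw [interior_Icc] at hs
    exact (hasDerivAt_gammaWeight (hy0.trans hs.1)).differentiableAt.differentiableWithinAt
  · intro s hs
    rw [interior_Icc] at hs
    rw [(hasDerivAt_gammaWeight (hy0.trans hs.1)).deriv]
    have := gammaWeight_pos (b := b - 1) (hy0.trans hs.1)
    exact mul_nonpos_of_nonneg_of_nonpos (by positivity) (by linarith [hs.1])

lemma gammaWeight_le_max (hb : 0 < b) (hy : 0 < y) : gammaWeight b y ≤ gammaWeight b (2 * b) := by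
  rcases le_total y (2 * b) with h | h
  · exact gammaWeight_mono hb hy h le_rfl
  · exact gammaWeight_anti hb le_rfl h

/-- The mass of the Gamma weight on `[0, y]`. -/
noncomputable def gammaLower (b y : ℝ) : ℝ := ∫ t in (0 : ℝ)..y, gammaWeight b t

/-- The mass of the Gamma weight on `[y, ∞)`. -/
noncomputable def gammaUpper (b y : ℝ) : ℝ := (∫ t in Set.Ioi (0 : ℝ), gammaWeight b t) - gammaLower b y

lemma hasDerivAt_gammaLower (hb : 0 < b) (y : ℝ) :
    HasDerivAt (gammaLower b) (gammaWeight b y) y :=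
  (continuous_gammaWeight hb).integral_hasStrictDerivAt 0 y |>.hasDerivAt

lemma hasDerivAt_gammaUpper (hb : 0 < b) (y : ℝ) :
    HasDerivAt (gammaUpper b) (-gammaWeight b y) y :=
  (hasDerivAt_gammaLower hb y).const_sub _

lemma tendsto_gammaLower_zero (hb : 0 < b) : Tendsto (gammaLower b) (𝓝[>] 0) (𝓝 0) := by
  have := (hasDerivAt_gammaLower hb 0).continuousAt.tendsto
  rw [show gammaLower b 0 = 0 from intervalIntegral.integral_same] at this
  exact this.mono_left nhdsWithin_le_nhds

lemma tendsto_gammaUpper_atTop (hb : 0 < b) : Tendsto (gammaUpper b) atTop (𝓝 0) := by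
  have := intervalIntegral_tendsto_integral_Ioi 0 (integrableOn_gammaWeight (b := b) (by linarith))
    tendsto_id
  have h2 := this.const_sub (∫ t in Set.Ioi (0 : ℝ), gammaWeight b t)
  rw [sub_self] at h2
  exact h2

lemma gammaLower_nonneg (hb : 0 < b) (hy : 0 < y) : 0 ≤ gammaLower b y :=
  nonneg_of_hasDerivAt_nonneg hy (fun t _ _ => hasDerivAt_gammaLower hb t)
    (fun _ ht _ => (gammaWeight_pos ht).le) (tendsto_gammaLower_zero hb)

lemma gammaUpper_nonneg (hb : 0 < b) (hy : 0 < y) : 0 ≤ gammaUpper b y :=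
  nonneg_of_hasDerivAt_nonpos (fun t _ => hasDerivAt_gammaUpper hb t)
    (fun _ ht => neg_nonpos.2 (gammaWeight_pos (hy.trans_le ht)).le) (tendsto_gammaUpper_atTop hb)

/-- The derivative of `4 w - gammaUpper` is `(4b - t)` times `gammaWeight (b - 1) t`. The bound is
only needed to see that `y * gammaUpper b y` tends to zero. -/
lemma gammaUpper_le (hb : 0 < b) (hy : 4 * b ≤ y) : gammaUpper b y ≤ 4 * gammaWeight b y := by
  have h := nonneg_of_hasDerivAt_nonpos (g := fun t => 4 * gammaWeight b t - gammaUpper b t) (y := y)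
    (fun t ht => ((hasDerivAt_gammaWeight (b := b) (y := t) (by linarith)).const_mul 4).sub
      (hasDerivAt_gammaUpper hb t)) (fun t ht => ?_) ?_
  · linarith
  · have ht0 : 0 < t := by linarith
    have h1 := gammaWeight_pos (b := b - 1) ht0
    rw [gammaWeight_eq_mul (b := b) ht0]
    nlinarith
  · simpa using ((tendsto_gammaWeight_atTop b).const_mul 4).sub (tendsto_gammaUpper_atTop hb)

lemma tendsto_id_mul_gammaUpper_atTop (hb : 0 < b) :
    Tendsto (fun y => y * gammaUpper b y) atTop (𝓝 0) := by
  have h := (tendsto_id_mul_gammaWeight_atTop b).const_mul 4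
  rw [mul_zero] at h
  refine tendsto_of_tendsto_of_tendsto_of_le_of_le' tendsto_const_nhds h ?_ ?_
  · filter_upwards [eventually_gt_atTop 0] with y hy
    exact mul_nonneg hy.le (gammaUpper_nonneg hb hy)
  · filter_upwards [eventually_gt_atTop 0, eventually_ge_atTop (4 * b)] with y hy hy'
    nlinarith [gammaUpper_le hb hy']

/-- The expression is a closed form of `∫_0^t (t - s) w(s) ds`, whose derivative is the mass on `[0,
t]`; the next lemma does the same for the upper tail. -/
lemma hasDerivAt_first_moment_lower (hb : 0 < b) {t : ℝ} (ht : 0 < t) :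
    HasDerivAt (fun t => 2 * t * gammaWeight b t - (2 * b + 2 - t) * gammaLower b t)
      (gammaLower b t) t := by
  convert! (hasDerivAt_mul_gammaWeight (b := b) ht).sub
    (((hasDerivAt_id t).const_sub (2 * b + 2)).mul (hasDerivAt_gammaLower hb t)) using 1
  simp only [id]
  ring

lemma hasDerivAt_first_moment_upper (hb : 0 < b) {t : ℝ} (ht : 0 < t) :
    HasDerivAt (fun t => 2 * t * gammaWeight b t + (2 * b + 2 - t) * gammaUpper b t)
      (-gammaUpper b t) t := by
  convert! (hasDerivAt_mul_gammaWeight (b := b) ht).add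
    (((hasDerivAt_id t).const_sub (2 * b + 2)).mul (hasDerivAt_gammaUpper hb t)) using 1
  simp only [id]
  ring

/-- Among densities bounded by `M`, the first moment is minimal for a constant density. -/
lemma gammaLower_sq_le (hb : 0 < b) (hy : 0 < y) {M : ℝ}
    (hM : ∀ t, 0 < t → t ≤ y → gammaWeight b t ≤ M) :
    gammaLower b y ^ 2 ≤ 2 * M * (2 * y * gammaWeight b y - (2 * b + 2 - y) * gammaLower b y) := by
  have h := nonneg_of_hasDerivAt_nonneg (g := fun t => 2 * M * (2 * t * gammaWeight b t -
      (2 * b + 2 - t) * gammaLower b t) - gammaLower b t ^ 2) hy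
    (fun t ht _ => ((hasDerivAt_first_moment_lower hb ht).const_mul (2 * M)).sub
      ((hasDerivAt_gammaLower hb t).pow 2)) (fun t ht hty => ?_) ?_
  · linarith
  · have h1 := gammaLower_nonneg hb ht
    have h2 := hM t ht hty
    simp only [Nat.cast_ofNat, Nat.add_one_sub_one, pow_one]
    nlinarith
  · have hid : Tendsto (fun t : ℝ => t) (𝓝[>] 0) (𝓝 0) := tendsto_id.mono_left nhdsWithin_le_nhds
    have hw : Tendsto (gammaWeight b) (𝓝[>] 0) (𝓝 0) := by
      have := (continuous_gammaWeight hb).tendsto 0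
      rw [gammaWeight_zero hb] at this
      exact this.mono_left nhdsWithin_le_nhds
    have hl := tendsto_gammaLower_zero hb
    have := ((((hid.const_mul 2).mul hw).sub ((hid.const_sub (2 * b + 2)).mul hl)).const_mul
      (2 * M)).sub (hl.pow 2)
    simpa using this

/-- The upper-tail version: beyond the mode `2b` the weight is at most its value at `y`, and a given
mass has least first moment about `y` when it is packed next to `y` at that height. -/
lemma gammaUpper_sq_le (hb : 0 < b) (hy : 2 * b ≤ y) :
    gammaUpper b y ^ 2 ≤
      2 * gammaWeight b y * (2 * y * gammaWeight b y + (2 * b + 2 - y) * gammaUpper b y) := by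
  have hy0 : 0 < y := by linarith
  set M := gammaWeight b y with hM
  have hM0 : 0 < M := gammaWeight_pos hy0
  have h := nonneg_of_hasDerivAt_nonpos (g := fun t => 2 * M * (2 * t * gammaWeight b t +
      (2 * b + 2 - t) * gammaUpper b t) - gammaUpper b t ^ 2) (y := y)
    (fun t ht => ((hasDerivAt_first_moment_upper hb (hy0.trans_le ht)).const_mul (2 * M)).sub
      ((hasDerivAt_gammaUpper hb t).pow 2)) (fun t ht => ?_) ?_
  · linarith
  · have h1 := gammaUpper_nonneg hb (hy0.trans_le ht)
    have h2 := gammaWeight_anti hb hy ht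
    simp only [Nat.cast_ofNat, Nat.add_one_sub_one, pow_one]
    nlinarith
  · have hl := tendsto_gammaUpper_atTop hb
    have h1 := (tendsto_id_mul_gammaWeight_atTop b).const_mul 2
    have h2 := ((hl.const_mul (2 * b + 2)).sub (tendsto_id_mul_gammaUpper_atTop hb))
    have := ((h1.add h2).const_mul (2 * M)).sub (hl.pow 2)
    simp only [mul_zero, add_zero, sub_zero, ne_eq, OfNat.ofNat_ne_zero, not_false_eq_true,
      zero_pow] at this
    refine this.congr fun t => ?_
    ring

/-- With `y = 2b + 2θ`, `0 ≤ θ ≤ 1`, the claim reads `2 e^θ ≤ π (1 + θ/b)^(b+1)`. The chord of `exp`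
on `[0, 1]` bounds the left side and Bernoulli the right side; `2 + 2θ(e - 1) ≤ π (1 + θ)` remains.
-/
lemma gammaWeight_max_le (hb : 0 < b) (hy1 : 2 * b ≤ y) (hy2 : y ≤ 2 * b + 2) :
    4 * gammaWeight b (2 * b) ≤ π * y / b * gammaWeight b y := by
  set θ := (y - 2 * b) / 2 with hθ
  have hθ0 : 0 ≤ θ := by rw [hθ]; linarith
  have hθ1 : θ ≤ 1 := by rw [hθ]; linarith
  have hyθ : y = 2 * b * (1 + θ / b) := by rw [hθ]; field_simp; ring
  have hexp : exp θ ≤ 1 + θ * (exp 1 - 1) := by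
    have := convexOn_exp.2 (Set.mem_univ 0) (Set.mem_univ 1) (sub_nonneg.2 hθ1) hθ0
      (sub_add_cancel 1 θ)
    simp only [smul_eq_mul, mul_zero, mul_one, zero_add, exp_zero] at this
    linarith
  have hpow : 1 + θ ≤ (1 + θ / b) ^ (b + 1) := by
    have h1 : (0 : ℝ) ≤ θ / b := by positivity
    have := one_add_mul_self_le_rpow_one_add (s := θ / b) (by linarith) (p := b + 1) (by linarith)
    have h2 : (b + 1) * (θ / b) = θ + θ / b := by field_simp
    linarith
  have hmain : 2 * exp θ ≤ π * (1 + θ / b) ^ (b + 1) := by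
    have h1 := exp_one_lt_d9
    have h2 := pi_gt_three
    nlinarith
  have h1 : (0 : ℝ) < 1 + θ / b := by positivity
  have hw : gammaWeight b y =
      gammaWeight b (2 * b) * ((1 + θ / b) ^ b * exp (-θ)) := by
    have he : -(1 / 2) * y = -(1 / 2) * (2 * b) + -θ := by rw [hθ]; ring
    rw [gammaWeight, gammaWeight, he, exp_add]
    nth_rw 1 [hyθ]
    rw [mul_rpow (by positivity) h1.le]
    ring
  have hpos := gammaWeight_pos (b := b) (show 0 < 2 * b by linarith)
  have : π * y / b * gammaWeight b y =
      2 * gammaWeight b (2 * b) * (π * (1 + θ / b) ^ (b + 1) * exp (-θ)) := by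
    rw [hw, rpow_add_one h1.ne']
    nth_rw 1 [hyθ]
    field_simp
  rw [this]
  have h3 : 2 ≤ π * (1 + θ / b) ^ (b + 1) * exp (-θ) := by
    have := mul_le_mul_of_nonneg_right hmain (exp_pos (-θ)).le
    rwa [mul_assoc, ← exp_add, add_neg_cancel, exp_zero, mul_one] at this
  nlinarith

end GammaWeight

/-! ### Bounds on the Stein solution and its derivative on the positive half-line -/

section SteinBound

open Real

variable {b : ℝ} {f f' k k' : ℝ → ℝ}

/-- The function `W = w (1 + f)` vanishes at both ends and `W'` has the sign of `k t - t + 2b`,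
which is nonincreasing. So `W` first increases and then decreases, and stays nonnegative. -/
lemma neg_one_le_of_stein_eq (hb : 0 < b) (hf : ∀ y, 0 < y → HasDerivAt f (f' y) y)
    (heq : ∀ y, 0 < y → 2 * y * f' y - (y - 2 * b) * f y = k y)
    (hk : Antitone fun y => k y - y)
    (h0 : Tendsto (fun y => gammaWeight b y * f y) (𝓝[>] 0) (𝓝 0))
    (h1 : Tendsto (fun y => gammaWeight b y * f y) atTop (𝓝 0)) {y : ℝ} (hy : 0 < y) :
    -1 ≤ f y := by
  have hW : ∀ t, 0 < t → HasDerivAt (fun t => gammaWeight b t + gammaWeight b t * f t)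
      (1 / 2 * gammaWeight (b - 1) t * (k t - t + 2 * b)) t := by
    intro t ht
    convert! (hasDerivAt_gammaWeight (b := b) ht).add
      ((hasDerivAt_gammaWeight (b := b) ht).mul (hf t ht)) using 1
    rw [gammaWeight_eq_mul (b := b) ht, ← heq t ht]
    ring
  have hg0 : Tendsto (gammaWeight b) (𝓝[>] 0) (𝓝 0) := by
    have := (continuous_gammaWeight hb).tendsto 0
    rw [gammaWeight_zero hb] at this
    exact this.mono_left nhdsWithin_le_nhds
  have key : 0 ≤ gammaWeight b y + gammaWeight b y * f y := by
    -- The sign of `W'` at `y` decides whether `y` is reached from `0` or from infinity.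
    rcases le_total 0 (k y - y + 2 * b) with h | h
    · refine nonneg_of_hasDerivAt_nonneg (g := fun t => gammaWeight b t + gammaWeight b t * f t)
        hy (fun t ht _ => hW t ht) (fun t ht hty => ?_)
        (by simpa using hg0.add h0)
      have h2 := gammaWeight_pos (b := b - 1) ht
      have h3 : k y - y ≤ k t - t := hk hty
      exact mul_nonneg (by positivity) (by linarith)
    · refine nonneg_of_hasDerivAt_nonpos (g := fun t => gammaWeight b t + gammaWeight b t * f t)
        (y := y) (fun t ht => hW t (hy.trans_le ht)) (fun t hty => ?_)
        (by simpa using (tendsto_gammaWeight_atTop b).add h1)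
      have h2 := gammaWeight_pos (b := b - 1) (hy.trans_le hty)
      have h3 : k t - t ≤ k y - y := hk hty
      exact mul_nonpos_of_nonneg_of_nonpos (by positivity) (by linarith)
  have h2 := gammaWeight_pos (b := b) hy
  by_contra! h
  nlinarith

/-- Once `|f| ≤ 1`, the function `U = y w f'` has derivative `w (k' + f) / 2`, at most `w` in
absolute value, and vanishes at both ends; hence `|U|` is at most the smaller tail mass. It remains
to bound that mass by `K y w`, in three ranges of `y`. -/
lemma abs_deriv_le_of_stein_eq (hb : 0 < b) {K : ℝ} (hK0 : 0 < K) (hK : π / b ≤ K ^ 2)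
    (hf : ∀ y, 0 < y → HasDerivAt f (f' y) y)
    (heq : ∀ y, 0 < y → 2 * y * f' y - (y - 2 * b) * f y = k y)
    (hk : ∀ y, HasDerivAt k (k' y) y) (hk2 : ∀ y, |k y| ≤ 2) (hk1 : ∀ y, |k' y| ≤ 1)
    (h0 : Tendsto (fun y => gammaWeight b y * f y) (𝓝[>] 0) (𝓝 0))
    (h1 : Tendsto (fun y => gammaWeight b y * f y) atTop (𝓝 0)) {y : ℝ} (hy : 0 < y) :
    |f' y| ≤ K := by
  have hlow : ∀ t, 0 < t → -1 ≤ f t := fun t ht => by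
    refine neg_one_le_of_stein_eq hb hf heq ?_ h0 h1 ht
    refine antitone_of_hasDerivAt_nonpos (fun t => (hk t).sub (hasDerivAt_id t)) fun t => ?_
    simp only [Pi.zero_apply]
    linarith [(abs_le.1 (hk1 t)).2]
  have hupp : ∀ t, 0 < t → f t ≤ 1 := fun t ht => by
    have := neg_one_le_of_stein_eq (f := fun t => -f t) (f' := fun t => -f' t)
      (k := fun t => -k t) hb (fun t ht => (hf t ht).neg)
      (fun t ht => by rw [← heq t ht]; ring) ?_ (by simpa using h0.neg) (by simpa using h1.neg) ht
    · linarith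
    refine antitone_of_hasDerivAt_nonpos (fun t => (hk t).neg.sub (hasDerivAt_id t)) fun t => ?_
    simp only [Pi.zero_apply]
    linarith [(abs_le.1 (hk1 t)).1]
  have habs : ∀ t, 0 < t → |f t| ≤ 1 := fun t ht => abs_le.2 ⟨hlow t ht, hupp t ht⟩
  -- Written through the equation, `U` can be differentiated without a second derivative of `f`.
  set U : ℝ → ℝ := fun t => 1 / 2 * (gammaWeight b t * (k t + (t - 2 * b) * f t)) with hU
  have hUf : ∀ t, 0 < t → U t = t * gammaWeight b t * f' t := by
    intro t ht
    simp only [hU, ← heq t ht]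
    ring
  -- The terms containing `f'` cancel because `2 t w' = (2b - t) w`.
  have hU' : ∀ t, 0 < t → HasDerivAt U (1 / 2 * gammaWeight b t * (k' t + f t)) t := by
    intro t ht
    have := ((hasDerivAt_gammaWeight (b := b) ht).mul ((hk t).add
      (((hasDerivAt_id t).sub_const (2 * b)).mul (hf t ht)))).const_mul (1 / 2)
    convert! this using 1
    have h3 : k t + (t - 2 * b) * f t = 2 * t * f' t := by linarith [heq t ht]
    simp only [id, Pi.add_apply, Pi.mul_apply]
    rw [h3, gammaWeight_eq_mul (b := b) ht]
    ring
  have hUw : ∀ t, 0 < t → |1 / 2 * gammaWeight b t * (k' t + f t)| ≤ gammaWeight b t := by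
    intro t ht
    have hw := gammaWeight_pos (b := b) ht
    rw [abs_mul, abs_of_pos (by positivity)]
    nlinarith [abs_add_le (k' t) (f t), habs t ht, hk1 t]
  have hg0 : Tendsto (gammaWeight b) (𝓝[>] 0) (𝓝 0) := by
    have := (continuous_gammaWeight hb).tendsto 0
    rw [gammaWeight_zero hb] at this
    exact this.mono_left nhdsWithin_le_nhds
  have hUbd : ∀ t, 0 < t → ‖U t‖ ≤ (1 + b) * gammaWeight b t + 1 / 2 * (t * gammaWeight b t) := by
    intro t ht
    have hw := gammaWeight_pos (b := b) ht
    have h3 : |k t + (t - 2 * b) * f t| ≤ 2 + (t + 2 * b) := by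
      refine (abs_add_le _ _).trans (add_le_add (hk2 t) ?_)
      rw [abs_mul]
      have h4 : |t - 2 * b| ≤ t + 2 * b := abs_le.2 ⟨by linarith, by linarith⟩
      calc _ ≤ |t - 2 * b| * 1 := mul_le_mul_of_nonneg_left (habs t ht) (abs_nonneg _)
        _ ≤ _ := by rwa [mul_one]
    rw [Real.norm_eq_abs, hU, abs_mul, abs_mul, abs_of_pos hw, abs_of_pos (by norm_num : (0 : ℝ) < 1 / 2)]
    nlinarith
  have hU0 : Tendsto U (𝓝[>] 0) (𝓝 0) := by
    have hid : Tendsto (fun t : ℝ => t) (𝓝[>] 0) (𝓝 0) := tendsto_id.mono_left nhdsWithin_le_nhds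
    refine squeeze_zero_norm' ?_ (by
      simpa using (hg0.const_mul (1 + b)).add ((hid.mul hg0).const_mul (1 / 2)))
    filter_upwards [self_mem_nhdsWithin] with t ht
    exact hUbd t ht
  have hU1 : Tendsto U atTop (𝓝 0) := by
    refine squeeze_zero_norm' ?_ (by
      simpa using ((tendsto_gammaWeight_atTop b).const_mul (1 + b)).add
        ((tendsto_id_mul_gammaWeight_atTop b).const_mul (1 / 2)))
    filter_upwards [eventually_gt_atTop 0] with t ht
    exact hUbd t ht
  have hUlow : |U y| ≤ gammaLower b y := by
    have hl := tendsto_gammaLower_zero hb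
    have ha := nonneg_of_hasDerivAt_nonneg (g := fun t => gammaLower b t - U t) hy
      (fun t ht _ => (hasDerivAt_gammaLower hb t).sub (hU' t ht))
      (fun t ht _ => by linarith [(abs_le.1 (hUw t ht)).2]) (by simpa using hl.sub hU0)
    have hb' := nonneg_of_hasDerivAt_nonneg (g := fun t => gammaLower b t + U t) hy
      (fun t ht _ => (hasDerivAt_gammaLower hb t).add (hU' t ht))
      (fun t ht _ => by linarith [(abs_le.1 (hUw t ht)).1]) (by simpa using hl.add hU0)
    exact abs_le.2 ⟨by linarith, by linarith⟩
  have hUupp : |U y| ≤ gammaUpper b y := by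
    have hl := tendsto_gammaUpper_atTop hb
    have ha := nonneg_of_hasDerivAt_nonpos (g := fun t => gammaUpper b t - U t) (y := y)
      (fun t ht => (hasDerivAt_gammaUpper hb t).sub (hU' t (hy.trans_le ht)))
      (fun t ht => by linarith [(abs_le.1 (hUw t (hy.trans_le ht))).1]) (by simpa using hl.sub hU1)
    have hb' := nonneg_of_hasDerivAt_nonpos (g := fun t => gammaUpper b t + U t) (y := y)
      (fun t ht => (hasDerivAt_gammaUpper hb t).add (hU' t (hy.trans_le ht)))
      (fun t ht => by linarith [(abs_le.1 (hUw t (hy.trans_le ht))).2]) (by simpa using hl.add hU1)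
    exact abs_le.2 ⟨by linarith, by linarith⟩
  have hw := gammaWeight_pos (b := b) hy
  have hlo0 := gammaLower_nonneg hb hy
  have hpi := pi_gt_three
  have hKb : π ≤ K ^ 2 * b := (div_le_iff₀ hb).1 hK
  suffices h : |U y| ≤ K * (y * gammaWeight b y) by
    rw [hUf y hy, abs_mul, abs_of_pos (by positivity)] at h
    have h5 : 0 < y * gammaWeight b y := by positivity
    exact le_of_mul_le_mul_left (by linarith) h5
  -- Right of `2b + 2` the coefficient `2b + 2 - y` is nonpositive, so the upper mass squared is at
  -- most `4 y w²`, and `K² y ≥ 2 K² b ≥ 2π` suffices.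
  rcases le_or_gt (2 * b + 2) y with hy2 | hy2
  · refine hUupp.trans (abs_le_of_sq_le_sq ?_ (by positivity) |> fun h => (abs_le.1 h).2)
    have h3 := gammaUpper_sq_le hb (show 2 * b ≤ y by linarith)
    have h4 := gammaUpper_nonneg hb hy
    have h5 : 4 ≤ K ^ 2 * y := by nlinarith [sq_nonneg K]
    have h6 : (2 * b + 2 - y) * gammaUpper b y ≤ 0 :=
      mul_nonpos_of_nonpos_of_nonneg (by linarith) h4
    calc _ ≤ 2 * gammaWeight b y * (2 * y * gammaWeight b y) := by nlinarith
      _ = 4 * (y * gammaWeight b y ^ 2) := by ring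
      _ ≤ K ^ 2 * y * (y * gammaWeight b y ^ 2) := by gcongr
      _ = _ := by ring
  -- Left of the mode the weight is increasing, so the height bound for the lower mass is `w(y)`
  -- itself.
  rcases le_or_gt y (2 * b) with hy1 | hy1
  · refine hUlow.trans ?_
    by_contra! h
    have h3 := gammaLower_sq_le hb hy fun t ht hty => gammaWeight_mono hb ht hty hy1
    set L := gammaLower b y
    set w := gammaWeight b y
    set δ := 2 * b + 2 - y with hδ
    have hδ2 : 2 ≤ δ := by rw [hδ]; linarith
    -- This contradicts `L² + 2 δ w L ≤ 4 y w²` when `L > K y w`. For `K ≥ 1` use `δ ≥ 2`; otherwise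
    -- `2 δ K ≥ K² δ` and `K² (y + δ) = K² (2b + 2) ≥ 2π`.
    have h4 : 4 ≤ K ^ 2 * y + 2 * δ * K := by
      rcases le_or_gt 1 K with hK1 | hK1
      · nlinarith [sq_nonneg K]
      · have hKK : K ^ 2 ≤ K := by nlinarith
        have : K ^ 2 * δ ≤ 2 * δ * K := by nlinarith
        have h6 : K ^ 2 * y + K ^ 2 * δ = K ^ 2 * b * 2 + 2 * K ^ 2 := by rw [hδ]; ring
        nlinarith [sq_nonneg K]
    have h5 : (K * (y * w)) ^ 2 < L ^ 2 := pow_lt_pow_left₀ h (by positivity) two_ne_zero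
    have h6 : 2 * w * δ * (K * (y * w)) ≤ 2 * w * δ * L := by gcongr
    have h7 : 4 * (y * w ^ 2) ≤ (K ^ 2 * y + 2 * δ * K) * (y * w ^ 2) := by gcongr
    nlinarith
  -- Between `2b` and `2b + 2` the height bound is the maximum `w(2b)`, and the term in `2b + 2 - y`
  -- is dropped.
  · refine hUlow.trans (abs_le_of_sq_le_sq ?_ (by positivity) |> fun h => (abs_le.1 h).2)
    have h3 := gammaLower_sq_le hb hy fun t ht _ => gammaWeight_le_max hb ht
    have h4 := gammaWeight_max_le hb hy1.le hy2.le
    have h5 : 0 ≤ (2 * b + 2 - y) * gammaLower b y := mul_nonneg (by linarith) hlo0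
    have h6 := gammaWeight_pos (b := b) (show 0 < 2 * b by linarith)
    calc _ ≤ 2 * gammaWeight b (2 * b) * (2 * y * gammaWeight b y) := by nlinarith
      _ = 4 * gammaWeight b (2 * b) * (y * gammaWeight b y) := by ring
      _ ≤ π * y / b * gammaWeight b y * (y * gammaWeight b y) := by gcongr
      _ = π / b * (y * gammaWeight b y) ^ 2 := by ring
      _ ≤ K ^ 2 * (y * gammaWeight b y) ^ 2 := by gcongr
      _ = _ := by ring

end SteinBound

end WienerChaos

namespace WienerChaos

/-! ### Solvability of Stein's equation and smoothing of test functions -/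

section SteinEquation

open Real

lemma sqrt_two_pi_div_pos {ν : ℕ} (hν : 1 ≤ ν) : 0 < √(2 * π / ν) := by
  have : (0 : ℝ) < ν := by exact_mod_cast hν
  positivity

/-- Stein's equation for the centered chi-square law has a solution with bounded derivative. -/
lemma exists_stein_solution {ν : ℕ} (hν : 1 ≤ ν) {g g' : ℝ → ℝ} (hg : ∀ x, HasDerivAt g (g' x) x)
    (hg' : Continuous g') (hg1 : ∀ x, |g x| ≤ 1) (hg1' : ∀ x, |g' x| ≤ 1) :
    ∃ (c : ℝ) (ψ ψ' : ℝ → ℝ), (∀ x, HasDerivAt ψ (ψ' x) x) ∧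
      (∀ x, 2 * (x + ν) * ψ' x - x * ψ x = g x - c) ∧ ∀ x, |ψ' x| ≤ √(2 * π / ν) := by
  have hgc : Continuous g := continuous_iff_continuousAt.2 fun y => (hg y).continuousAt
  have hν1 : (1 : ℝ) ≤ ν := by exact_mod_cast hν
  set b : ℝ := ν / 2 with hbν
  have hb : 0 < b := by positivity
  have hw := integrableOn_gammaWeight (b := b - 1) (by linarith)
  set I := ∫ y in Set.Ioi (0 : ℝ), gammaWeight (b - 1) y with hI
  have hI0 : 0 < I := by
    rw [hI, setIntegral_pos_iff_support_of_nonneg_ae ?_ hw]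
    · refine lt_of_lt_of_le (b := volume (Set.Ioi (0 : ℝ))) (by simp) (measure_mono fun y hy => ?_)
      exact ⟨(gammaWeight_pos hy).ne', hy⟩
    · filter_upwards [self_mem_ae_restrict measurableSet_Ioi] with y hy
      exact (gammaWeight_pos hy).le
  have hwg : IntegrableOn (fun y => gammaWeight (b - 1) y * g (y - ν)) (Set.Ioi 0) :=
    hw.mul_bdd (c := 1) (by fun_prop) (ae_of_all _ fun y => hg1 _)
  set J := ∫ y in Set.Ioi (0 : ℝ), gammaWeight (b - 1) y * g (y - ν) with hJ
  have hJI : |J| ≤ I := by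
    rw [← Real.norm_eq_abs]
    refine norm_integral_le_of_norm_le hw ?_
    filter_upwards [self_mem_ae_restrict measurableSet_Ioi] with y hy
    rw [norm_mul, norm_of_nonneg (gammaWeight_pos hy).le]
    exact mul_le_of_le_one_right (gammaWeight_pos hy).le (hg1 _)
  -- The mean of the test function under the Gamma law, chosen so that `w f` also vanishes at
  -- infinity.
  set c := J / I with hc
  have hc1 : |c| ≤ 1 := by
    rw [hc, abs_div, abs_of_pos hI0]
    exact div_le_one_of_le₀ hJI hI0.le
  set k : ℝ → ℝ := fun y => g (y - ν) - c with hk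
  set k' : ℝ → ℝ := fun y => g' (y - ν) with hk'
  have hkd : ∀ y, HasDerivAt k (k' y) y := fun y => by
    have := (hg (y - ν)).comp y ((hasDerivAt_id y).sub_const (ν : ℝ))
    rw [mul_one] at this
    exact this.sub_const c
  have hk'c : Continuous k' := by fun_prop
  have hk2 : ∀ y, |k y| ≤ 2 := fun y => by
    rw [hk]
    linarith [abs_sub (g (y - ν)) c, hg1 (y - ν)]
  have hk1 : ∀ y, |k' y| ≤ 1 := fun y => hg1' _
  set f := steinSol b k
  set f' := steinSolDeriv b k k'
  have hf : ∀ y, HasDerivAt f (f' y) y := hasDerivAt_steinSol hb hkd hk'c hk2 hk1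
  have hode : ∀ y, 2 * y * f' y - (y - 2 * b) * f y = k y := steinSol_eq hb hkd hk'c
  have hfc : Continuous f := continuous_iff_continuousAt.2 fun y => (hf y).continuousAt
  have hVc : Continuous fun y => gammaWeight b y * f y := (continuous_gammaWeight hb).mul hfc
  have hV : ∀ y ∈ Set.Ioi (0 : ℝ), HasDerivAt (fun y => gammaWeight b y * f y)
      (1 / 2 * (gammaWeight (b - 1) y * k y)) y := by
    intro y hy
    convert! (hasDerivAt_gammaWeight (b := b) hy).mul (hf y) using 1
    rw [gammaWeight_eq_mul (b := b) hy, ← hode]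
    ring
  have hkeq : ∀ y, gammaWeight (b - 1) y * k y =
      gammaWeight (b - 1) y * g (y - ν) - gammaWeight (b - 1) y * c := fun y => mul_sub _ _ _
  have hVint : IntegrableOn (fun y => 1 / 2 * (gammaWeight (b - 1) y * k y)) (Set.Ioi 0) := by
    simp_rw [hkeq]
    exact (hwg.sub (hw.mul_const c)).const_mul _
  have hlim := tendsto_limUnder_of_hasDerivAt_of_integrableOn_Ioi hV hVint
  -- `(w f)'` is half the centred integrand, so the limit of `w f` at infinity is its total
  -- integral, zero.
  have hV1 : Tendsto (fun y => gammaWeight b y * f y) atTop (𝓝 0) := by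
    have h1 := integral_Ioi_of_hasDerivAt_of_tendsto hVc.continuousWithinAt hV hVint hlim
    have h2 : ∫ y in Set.Ioi (0 : ℝ), 1 / 2 * (gammaWeight (b - 1) y * k y) = 0 := by
      simp_rw [hkeq]
      rw [integral_const_mul, integral_sub hwg (hw.mul_const c), integral_mul_const, ← hJ, ← hI, hc,
        mul_div_cancel₀ _ hI0.ne', sub_self, mul_zero]
    rw [h2, gammaWeight_zero hb, zero_mul, sub_zero] at h1
    rwa [← h1] at hlim
  have hV0 : Tendsto (fun y => gammaWeight b y * f y) (𝓝[>] 0) (𝓝 0) := by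
    have := hVc.tendsto 0
    simp only [gammaWeight_zero hb, zero_mul] at this
    exact this.mono_left nhdsWithin_le_nhds
  have hK : π / b ≤ √(2 * π / ν) ^ 2 := by
    rw [sq_sqrt (by positivity), hbν]
    apply le_of_eq
    field_simp
  refine ⟨c, fun x => f (x + ν), fun x => f' (x + ν), fun x => ?_, fun x => ?_, fun x => ?_⟩
  · have := (hf (x + ν)).comp x ((hasDerivAt_id x).add_const (ν : ℝ))
    simpa using! this
  · have := hode (x + ν)
    simp only [hk, add_sub_cancel_right, hbν] at this
    rw [← this]
    ring
  · rcases le_or_gt (x + ν) 0 with hx | hx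
    -- Here the bound is `1 / (2b) = 1 / ν`, below `√(2π/ν)` because `ν ≥ 1`.
    · refine (abs_steinSolDeriv_le_of_nonpos hb hk2 hk1 hx).trans (le_sqrt_of_sq_le ?_)
      rw [hbν, div_pow, div_le_div_iff₀ (by positivity) (by positivity)]
      nlinarith [pi_gt_three]
    · exact abs_deriv_le_of_stein_eq hb (sqrt_two_pi_div_pos hν) hK (fun y _ => hf y)
        (fun y _ => hode y) hkd hk2 hk1 hV0 hV1 hx

/-- Bounded Lipschitz functions are uniform limits of smooth ones with the same bounds. -/
lemma exists_smooth_approx {g : ℝ → ℝ} (hL : LipschitzWith 1 g) (hg : ∀ y, |g y| ≤ 1) {ε : ℝ}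
    (hε : 0 < ε) : ∃ u u' : ℝ → ℝ, (∀ x, HasDerivAt u (u' x) x) ∧ Continuous u' ∧
      (∀ x, |u x| ≤ 1) ∧ (∀ x, |u' x| ≤ 1) ∧ ∀ x, |u x - g x| ≤ ε := by
  have hgc := hL.continuous
  have hdist : ∀ x y, |g x - g y| ≤ |x - y| := fun x y => by
    simpa [Real.dist_eq] using hL.dist_le_mul x y
  have hu : ∀ x, ε⁻¹ * ((∫ t in (0 : ℝ)..(x + ε), g t) - ∫ t in (0 : ℝ)..x, g t) =
      ε⁻¹ * ∫ t in x..(x + ε), g t := fun x => by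
    rw [intervalIntegral.integral_interval_sub_left (hgc.intervalIntegrable _ _)
      (hgc.intervalIntegrable _ _)]
  -- The approximation is the average of `g` over `[x, x + ε]`, whose derivative is a difference
  -- quotient of `g`.
  refine ⟨fun x => ε⁻¹ * ((∫ t in (0 : ℝ)..(x + ε), g t) - ∫ t in (0 : ℝ)..x, g t),
    fun x => ε⁻¹ * (g (x + ε) - g x), fun x => ?_, by fun_prop, fun x => ?_, fun x => ?_,
    fun x => ?_⟩
  · have h1 := (hgc.integral_hasStrictDerivAt 0 (x + ε)).hasDerivAt.comp x
      ((hasDerivAt_id x).add_const ε)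
    have h2 := (hgc.integral_hasStrictDerivAt 0 x).hasDerivAt
    have := (h1.sub h2).const_mul ε⁻¹
    simpa using! this
  · simp only [hu]
    have := intervalIntegral.norm_integral_le_of_norm_le_const (a := x) (b := x + ε) (f := g)
      (C := 1) fun t _ => hg t
    rw [Real.norm_eq_abs, add_sub_cancel_left, one_mul, abs_of_pos hε] at this
    rw [abs_mul, abs_of_pos (inv_pos.2 hε)]
    exact (inv_mul_le_one₀ hε).2 this
  · have := hdist (x + ε) x
    rw [add_sub_cancel_left, abs_of_pos hε] at this
    rw [abs_mul, abs_of_pos (inv_pos.2 hε)]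
    exact (inv_mul_le_one₀ hε).2 this
  · simp only [hu]
    have h1 : ε⁻¹ * (∫ t in x..(x + ε), g t) - g x = ε⁻¹ * ∫ t in x..(x + ε), (g t - g x) := by
      rw [intervalIntegral.integral_sub (hgc.intervalIntegrable _ _) (by simp),
        intervalIntegral.integral_const, add_sub_cancel_left, smul_eq_mul]
      field_simp
    have h2 := intervalIntegral.norm_integral_le_of_norm_le_const (a := x) (b := x + ε)
      (f := fun t => g t - g x) (C := ε) fun t ht => by
        rw [Set.uIoc_of_le (by linarith)] at ht
        refine (hdist t x).trans ?_
        rw [abs_of_pos (by linarith [ht.1])]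
        linarith [ht.2]
    rw [Real.norm_eq_abs, add_sub_cancel_left, abs_of_pos hε] at h2
    rw [h1, abs_mul, abs_of_pos (inv_pos.2 hε), inv_mul_le_iff₀ hε]
    exact h2

end SteinEquation

/-! ### Stein's bound for Wick polynomials -/

section SteinWick

open MvPolynomial

variable {N d : ℕ} {p : MvPolynomial (Fin N) ℝ}

/-- Cauchy–Schwarz, in the form that the variance of `|q|` is nonnegative. -/
lemma abs_integral_mul_le_sqrt {f : ℝ → ℝ} {K : ℝ} (hK : ∀ y, |f y| ≤ K)
    (F q : MvPolynomial (Fin N) ℝ) :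
    |∫ x, f (eval x F) * eval x q ∂gaussianPi N| ≤ K * √(expect (q ^ 2)) := by
  have hK0 : 0 ≤ K := (abs_nonneg _).trans (hK 0)
  have h1 : |∫ x, f (eval x F) * eval x q ∂gaussianPi N| ≤
      ∫ x, K * |eval x q| ∂gaussianPi N := by
    rw [← Real.norm_eq_abs]
    refine norm_integral_le_of_norm_le ((integrable_eval q).abs.const_mul K) (ae_of_all _ fun x => ?_)
    rw [norm_mul]
    exact mul_le_mul_of_nonneg_right (hK _) (norm_nonneg _)
  rw [integral_const_mul] at h1
  refine h1.trans (mul_le_mul_of_nonneg_left (Real.le_sqrt_of_sq_le ?_) hK0)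
  have h2 := variance_nonneg (fun x => |eval x q|) (gaussianPi N)
  rw [variance_eq_sub (show MemLp (fun x => |eval x q|) 2 (gaussianPi N) from
    (memLp_eval q (by simp)).abs)] at h2
  have h3 : expect (q ^ 2) = (gaussianPi N)[(fun x => |eval x q|) ^ 2] := by
    simp [expect_apply]
  rw [h3]
  linarith

/-- Stein's bound for test functions that solve Stein's equation. -/
lemma abs_integral_comp_wick_sub_le (hd : d ≠ 0) (hp : p.IsHomogeneous d) {g ψ ψ' : ℝ → ℝ}
    {c a K : ℝ} (hψ : ∀ x, HasDerivAt ψ (ψ' x) x)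
    (heq : ∀ x, 2 * (x + a) * ψ' x - x * ψ x = g x - c) (hK : ∀ x, |ψ' x| ≤ K)
    (hg : Integrable (fun x => g (eval x (wick p))) (gaussianPi N)) :
    |∫ x, g (eval x (wick p)) ∂gaussianPi N - c| ≤ K * √(expect
      (((2 : ℝ) • wick p + C (2 * a) - (d : ℝ)⁻¹ • ∑ i, pderiv i (wick p) ^ 2) ^ 2)) := by
  have hm : Measurable ψ' := by
    have : ψ' = deriv ψ := funext fun y => (hψ y).deriv.symm
    rw [this]; exact measurable_deriv ψ
  set F := wick p with hF
  set Γ := ∑ i, pderiv i F ^ 2 with hΓ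
  have hint : ∀ q : MvPolynomial (Fin N) ℝ,
      Integrable (fun x => ψ' (eval x F) * eval x q) (gaussianPi N) := fun q =>
    (integrable_eval q).bdd_mul (hm.comp (continuous_eval F).measurable).aestronglyMeasurable
      (ae_of_all _ fun x => hK _)
  have hibp := integral_wick_mul_comp hd hp hψ hK
  rw [← hF, ← hΓ] at hibp
  have hgc : ∫ x, g (eval x F) ∂gaussianPi N - c = ∫ x, (g (eval x F) - c) ∂gaussianPi N := by
    rw [integral_sub hg (integrable_const c)]
    simp
  -- The equation expresses `F ψ(F)` through `ψ'(F)` times a polynomial and the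
  -- bounded-by-hypothesis integrable `g(F) - c`, so no growth bound on `ψ` is needed.
  have hFint : Integrable (fun x => eval x F * ψ (eval x F)) (gaussianPi N) := by
    refine ((hint ((2 : ℝ) • F + C (2 * a))).sub (hg.sub (integrable_const c))).congr
      (ae_of_all _ fun x => ?_)
    simp only [Pi.sub_apply, ← heq, map_add, smul_eval, eval_C]
    ring
  have hmain : ∫ x, (g (eval x F) - c) ∂gaussianPi N =
      ∫ x, ψ' (eval x F) * eval x ((2 : ℝ) • F + C (2 * a) - (d : ℝ)⁻¹ • Γ) ∂gaussianPi N := by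
    simp only [map_sub, mul_sub]
    rw [integral_sub (hint _) (hint _)]
    have h1 : ∫ x, ψ' (eval x F) * eval x ((d : ℝ)⁻¹ • Γ) ∂gaussianPi N =
        ∫ x, eval x F * ψ (eval x F) ∂gaussianPi N := by
      rw [hibp, ← integral_const_mul]
      refine integral_congr_ae (ae_of_all _ fun x => ?_)
      simp only [smul_eval]
      ring
    rw [h1, ← integral_sub (hint _) hFint]
    refine integral_congr_ae (ae_of_all _ fun x => ?_)
    simp only [← heq, map_add, smul_eval, eval_C]
    ring
  rw [hgc, hmain]
  exact abs_integral_mul_le_sqrt hK _ _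

lemma wick_sum_X_sq (N : ℕ) : wick (∑ i : Fin N, X i * X i) = ∑ i : Fin N, (X i ^ 2 - 1) := by
  rw [map_sum]
  refine Finset.sum_congr rfl fun i _ => ?_
  have h : wick (X i : MvPolynomial (Fin N) ℝ) = X i := by
    have := wick_X_mul i (1 : MvPolynomial (Fin N) ℝ)
    rw [wick_one] at this
    simpa using this
  rw [wick_X_mul, h, pderiv_X_self, sq]

lemma integral_centeredChiSq {ν : ℕ} {g : ℝ → ℝ} (hg : Continuous g) :
    ∫ z, g z ∂centeredChiSq ν =
      ∫ x, g (eval x (wick (∑ i : Fin ν, X i * X i))) ∂gaussianPi ν := by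
  rw [centeredChiSq, integral_map (Measurable.aemeasurable (by fun_prop)) hg.aestronglyMeasurable,
    wick_sum_X_sq]
  simp

/-- The constant in Stein's equation is the mean of the test function under the target law. -/
lemma integral_centeredChiSq_eq {ν : ℕ} {g ψ ψ' : ℝ → ℝ} {c K : ℝ} (hg : Continuous g)
    (hg1 : ∀ x, |g x| ≤ 1) (hψ : ∀ x, HasDerivAt ψ (ψ' x) x)
    (heq : ∀ x, 2 * (x + ν) * ψ' x - x * ψ x = g x - c) (hK : ∀ x, |ψ' x| ≤ K) :
    ∫ z, g z ∂centeredChiSq ν = c := by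
  have hp : (∑ i : Fin ν, X i * X i : MvPolynomial (Fin ν) ℝ).IsHomogeneous 2 :=
    IsHomogeneous.sum _ _ _ fun i _ => (isHomogeneous_X ℝ i).mul (isHomogeneous_X ℝ i)
  have hint : Integrable (fun x => g (eval x (wick (∑ i : Fin ν, X i * X i)))) (gaussianPi ν) :=
    Integrable.of_bound (hg.comp (continuous_eval _)).aestronglyMeasurable 1
      (ae_of_all _ fun x => hg1 _)
  have h := abs_integral_comp_wick_sub_le two_ne_zero hp hψ heq hK hint
  -- The target `Z = ∑ (X i ^ 2 - 1)` lies in the second chaos and satisfies `2Z + 2ν = |∇Z|²/2`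
  -- identically, so Stein's bound for it is zero.
  have hz : (2 : ℝ) • wick (∑ i : Fin ν, X i * X i) + C (2 * (ν : ℝ)) -
      ((2 : ℕ) : ℝ)⁻¹ • ∑ i, pderiv i (wick (∑ i : Fin ν, X i * X i)) ^ 2 = 0 := by
    have hder : ∀ i : Fin ν, pderiv i (∑ j : Fin ν, (X j ^ 2 - 1 : MvPolynomial (Fin ν) ℝ)) =
        2 * X i := by
      intro i
      rw [map_sum, Finset.sum_eq_single i]
      · simp
      · intro j _ hj
        simp [pderiv_X_of_ne hj]
      · simp
    rw [wick_sum_X_sq]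
    simp only [hder, mul_pow, ← Finset.mul_sum]
    rw [Finset.sum_sub_distrib, smul_eq_C_mul, smul_eq_C_mul]
    have h4 : C (((2 : ℕ) : ℝ)⁻¹) * (2 : MvPolynomial (Fin ν) ℝ) ^ 2 = 2 := by
      rw [show (2 : MvPolynomial (Fin ν) ℝ) ^ 2 = C 4 by rw [map_ofNat]; norm_num, ← C_mul,
        show ((2 : ℕ) : ℝ)⁻¹ * 4 = 2 by norm_num, map_ofNat]
    have h2 : (C 2 : MvPolynomial (Fin ν) ℝ) = 2 := map_ofNat C 2
    rw [← mul_assoc, h4, C_mul, h2]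
    simp
    ring
  rw [hz, sq, zero_mul, map_zero, Real.sqrt_zero, mul_zero, ← integral_centeredChiSq hg] at h
  exact sub_eq_zero.1 (abs_nonpos_iff.1 h)

/-- Stein's bound for homogeneous Wick polynomials and bounded Lipschitz test functions. -/
lemma abs_integral_comp_wick_sub_centeredChiSq_le (hd : Even d) (hd2 : 2 ≤ d)
    (hp : p.IsHomogeneous d) {ν : ℕ} (hν : 1 ≤ ν) {g : ℝ → ℝ} (hL : LipschitzWith 1 g)
    (hg : ∀ y, |g y| ≤ 1) :
    |∫ x, g (eval x (wick p)) ∂gaussianPi N - ∫ z, g z ∂centeredChiSq ν| ≤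
      √(2 * Real.pi / ν) *
        √((2 * ν - expect (wick p ^ 2)) ^ 2 + steinDiscrepancy d p) := by
  have hbd : ∀ {M : ℕ} (q : MvPolynomial (Fin M) ℝ) {u : ℝ → ℝ}, Continuous u → (∀ x, |u x| ≤ 1) →
      Integrable (fun x => u (eval x q)) (gaussianPi M) := fun q u hu hu1 =>
    Integrable.of_bound (hu.comp (continuous_eval _)).aestronglyMeasurable 1
      (ae_of_all _ fun x => hu1 _)
  refine le_of_forall_pos_le_add fun ε hε => ?_
  -- Stein's equation is solved for a smooth `u` within `ε/2` of `g`; each of the two expectations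
  -- moves by at most `ε/2`.
  obtain ⟨u, u', hu, hu', hu1, hu1', hug⟩ := exists_smooth_approx hL hg (half_pos hε)
  have huc : Continuous u := continuous_iff_continuousAt.2 fun y => (hu y).continuousAt
  have hclose : ∀ {M : ℕ} (q : MvPolynomial (Fin M) ℝ),
      |∫ x, u (eval x q) ∂gaussianPi M - ∫ x, g (eval x q) ∂gaussianPi M| ≤ ε / 2 := by
    intro M q
    rw [← integral_sub (hbd q huc hu1) (hbd q hL.continuous hg)]
    have := norm_integral_le_of_norm_le_const (μ := gaussianPi M) (C := ε / 2)
      (f := fun x => u (eval x q) - g (eval x q)) (ae_of_all _ fun x => hug _)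
    simpa using this
  obtain ⟨c, ψ, ψ', hψ, heq, hK⟩ := exists_stein_solution hν hu hu' hu1 hu1'
  have hc := integral_centeredChiSq_eq huc hu1 hψ heq hK
  have h1 := abs_integral_comp_wick_sub_le (by omega) hp hψ heq hK (hbd _ huc hu1)
  rw [expect_two_mul_wick_add_sub_sq hd hd2 hp] at h1
  have h2 := hclose (wick p)
  have h3 := hclose (wick (∑ i : Fin ν, X i * X i))
  rw [← integral_centeredChiSq huc, ← integral_centeredChiSq hL.continuous, hc] at h3
  rw [abs_le] at *
  constructor <;> linarith [h1.1, h1.2, h2.1, h2.2, h3.1, h3.2]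

end SteinWick

end WienerChaos

namespace WienerChaos

/-! ## Continuity of symmetrization and contraction -/

section Continuity

variable {m : ℕ}

lemma TensorPower.norm_le_of_sq_le {f : TensorPower m} {a : ℝ} (ha : 0 ≤ a)
    (h : ∑' j, f j ^ 2 ≤ a ^ 2) : ‖f‖ ≤ a := by
  rw [← f.norm_sq_eq_tsum] at h
  exact (sq_le_sq₀ (norm_nonneg _) ha).1 h

/-- The action of permutations on tensors. -/
noncomputable def permute (σ : Equiv.Perm (Fin m)) (f : TensorPower m) : TensorPower m :=
  ⟨fun j => f (j ∘ σ), memℓp_two_iff.2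
    (f.summable_sq.comp_injective σ.surjective.injective_comp_right)⟩

lemma norm_permute (σ : Equiv.Perm (Fin m)) (f : TensorPower m) : ‖permute σ f‖ = ‖f‖ := by
  rw [← sq_eq_sq₀ (norm_nonneg _) (norm_nonneg _), TensorPower.norm_sq_eq_tsum,
    TensorPower.norm_sq_eq_tsum]
  exact (Equiv.arrowCongr σ.symm (Equiv.refl ℕ)).tsum_eq fun j => f j ^ 2

lemma symmetrize_eq_smul_sum (f : TensorPower m) :
    symmetrize f = (m ! : ℝ)⁻¹ • ∑ σ : Equiv.Perm (Fin m), permute σ f := by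
  ext j
  rw [symmetrize_apply, lp.coeFn_smul, Pi.smul_apply, lp.coeFn_sum, Finset.sum_apply, smul_eq_mul]
  rfl

lemma norm_symmetrize_le (f : TensorPower m) : ‖symmetrize f‖ ≤ ‖f‖ := by
  rw [symmetrize_eq_smul_sum, norm_smul, norm_inv, Real.norm_of_nonneg (by positivity),
    inv_mul_le_iff₀ (by positivity)]
  refine (norm_sum_le _ _).trans ?_
  simp_rw [norm_permute]
  rw [Finset.sum_const, Finset.card_univ, Fintype.card_perm, Fintype.card_fin, nsmul_eq_mul]

lemma symmetrize_sub (f g : TensorPower m) : symmetrize (f - g) = symmetrize f - symmetrize g := by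
  ext j
  change (m ! : ℝ)⁻¹ * ∑ σ : Equiv.Perm (Fin m), (f (j ∘ σ) - g (j ∘ σ)) =
    (m ! : ℝ)⁻¹ * ∑ σ : Equiv.Perm (Fin m), f (j ∘ σ) -
      (m ! : ℝ)⁻¹ * ∑ σ : Equiv.Perm (Fin m), g (j ∘ σ)
  rw [Finset.sum_sub_distrib, mul_sub]

lemma continuous_symmetrize : Continuous (symmetrize : TensorPower m → TensorPower m) := by
  refine LipschitzWith.continuous (K := 1) (LipschitzWith.of_dist_le_mul fun f g => ?_)
  rw [dist_eq_norm, dist_eq_norm, ← symmetrize_sub, NNReal.coe_one, one_mul]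
  exact norm_symmetrize_le _

variable {r s t p q n : ℕ} (hp : p = r + s) (hq : q = r + t) (hn : n = s + t)

lemma summable_slice_sq (f : TensorPower p) (x : Fin s → ℕ) :
    Summable fun i : Fin r → ℕ => (f (Fin.append i x ∘ Fin.cast hp) : ℝ) ^ 2 := by
  subst hp
  refine f.summable_sq.comp_injective (i := fun i : Fin r → ℕ => Fin.append i x ∘ Fin.cast rfl) ?_
  intro i i' h
  exact (Prod.mk.inj ((Fin.appendEquiv r s).injective (a₁ := (i, x)) (a₂ := (i', x)) h)).1

lemma summable_slice_mul (f : TensorPower p) (g : TensorPower q) (x : Fin s → ℕ) (y : Fin t → ℕ) :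
    Summable fun i : Fin r → ℕ =>
      f (Fin.append i x ∘ Fin.cast hp) * g (Fin.append i y ∘ Fin.cast hq) := by
  refine Summable.of_norm_bounded ((summable_slice_sq hp f x).add (summable_slice_sq hq g y))
    fun i => ?_
  rw [Real.norm_eq_abs, abs_le]
  generalize (f (Fin.append i x ∘ Fin.cast hp) : ℝ) = a
  generalize (g (Fin.append i y ∘ Fin.cast hq) : ℝ) = b
  constructor <;> nlinarith [sq_nonneg (a + b), sq_nonneg (a - b), sq_nonneg a, sq_nonneg b]

lemma slice_cauchy_schwarz (f : TensorPower p) (g : TensorPower q) (x : Fin s → ℕ)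
    (y : Fin t → ℕ) :
    (∑' i : Fin r → ℕ, f (Fin.append i x ∘ Fin.cast hp) * g (Fin.append i y ∘ Fin.cast hq)) ^ 2 ≤
      (∑' i : Fin r → ℕ, f (Fin.append i x ∘ Fin.cast hp) ^ 2) *
        ∑' i : Fin r → ℕ, g (Fin.append i y ∘ Fin.cast hq) ^ 2 := by
  have hcs := real_inner_mul_inner_self_le
    (⟨_, memℓp_two_iff.2 (summable_slice_sq hp f x)⟩ : lp (fun _ : Fin r → ℕ => ℝ) 2)
    (⟨_, memℓp_two_iff.2 (summable_slice_sq hq g y)⟩ : lp (fun _ : Fin r → ℕ => ℝ) 2)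
  simp only [lp.inner_eq_tsum] at hcs
  simpa [pow_two, mul_comm] using hcs

lemma summable_prod_slice (f : TensorPower p) :
    Summable fun x : (Fin s → ℕ) × (Fin r → ℕ) =>
      (f (Fin.append x.2 x.1 ∘ Fin.cast hp) : ℝ) ^ 2 := by
  subst hp
  exact ((Equiv.prodComm _ _).trans (Fin.appendEquiv r s)).summable_iff.2 f.summable_sq

lemma tsum_tsum_slice_sq (f : TensorPower p) :
    ∑' x : Fin s → ℕ, ∑' i : Fin r → ℕ, f (Fin.append i x ∘ Fin.cast hp) ^ 2 = ‖f‖ ^ 2 := by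
  rw [← (summable_prod_slice hp f).tsum_prod, TensorPower.norm_sq_eq_tsum]
  subst hp
  exact ((Equiv.prodComm _ _).trans (Fin.appendEquiv r s)).tsum_eq fun j => f j ^ 2

/-- Cauchy–Schwarz in the contracted indices; the sum over the free indices then factorizes into the
two squared norms. -/
lemma norm_contraction_le (f : TensorPower p) (g : TensorPower q) :
    ‖contraction hp hq hn f g‖ ≤ ‖f‖ * ‖g‖ := by
  refine TensorPower.norm_le_of_sq_le (by positivity) ?_
  have hA := (summable_prod_slice hp f).prod
  have hB := (summable_prod_slice hq g).prod
  have hAB := hA.mul_of_nonneg hB (fun _ => tsum_nonneg fun _ => sq_nonneg _)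
    (fun _ => tsum_nonneg fun _ => sq_nonneg _)
  have hsum : ∀ (k : TensorPower n), Summable fun j => k j ^ 2 := fun k => k.summable_sq
  rw [mul_pow, ← tsum_tsum_slice_sq hp f, ← tsum_tsum_slice_sq hq g, hA.tsum_mul_tsum hB hAB]
  subst hn
  rw [← (Fin.appendEquiv s t).tsum_eq fun j => contraction hp hq rfl f g j ^ 2]
  refine Summable.tsum_le_tsum (fun x => ?_) ((Fin.appendEquiv s t).summable_iff.2 (hsum _)) hAB
  rw [contraction_apply]
  simpa [Fin.appendEquiv] using slice_cauchy_schwarz hp hq f g x.1 x.2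

lemma contraction_sub_left (f f' : TensorPower p) (g : TensorPower q) :
    contraction hp hq hn (f - f') g = contraction hp hq hn f g - contraction hp hq hn f' g := by
  ext j
  rw [lp.coeFn_sub, Pi.sub_apply, contraction_apply, contraction_apply, contraction_apply,
    ← (summable_slice_mul hp hq f g _ _).tsum_sub (summable_slice_mul hp hq f' g _ _)]
  simp_rw [lp.coeFn_sub, Pi.sub_apply, sub_mul]

lemma contraction_sub_right (f : TensorPower p) (g g' : TensorPower q) :
    contraction hp hq hn f (g - g') = contraction hp hq hn f g - contraction hp hq hn f g' := by
  ext j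
  rw [lp.coeFn_sub, Pi.sub_apply, contraction_apply, contraction_apply, contraction_apply,
    ← (summable_slice_mul hp hq f g _ _).tsum_sub (summable_slice_mul hp hq f g' _ _)]
  simp_rw [lp.coeFn_sub, Pi.sub_apply, mul_sub]

lemma norm_contraction_self_sub_le (hq : p = r + t) (f g : TensorPower p) :
    ‖contraction hp hq hn g g - contraction hp hq hn f f‖ ≤ ‖g - f‖ * ‖g‖ + ‖f‖ * ‖g - f‖ := by
  have h1 := contraction_sub_left hp hq hn g f g
  have h2 := contraction_sub_right hp hq hn f g f
  have b1 := norm_contraction_le hp hq hn (g - f) g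
  have b2 := norm_contraction_le hp hq hn f (g - f)
  rw [h1] at b1
  rw [h2] at b2
  generalize contraction hp hq hn g g = A at *
  generalize contraction hp hq hn f f = B at *
  generalize contraction hp hq hn f g = C at *
  exact (norm_sub_le_norm_sub_add_norm_sub A C B).trans (add_le_add b1 b2)

lemma continuous_contraction_self (hq : p = r + t) :
    Continuous fun f : TensorPower p => contraction hp hq hn f f := by
  refine continuous_iff_continuousAt.2 fun f => tendsto_iff_norm_sub_tendsto_zero.2 ?_
  have hc : Continuous fun g : TensorPower p => ‖g - f‖ * ‖g‖ + ‖f‖ * ‖g - f‖ :=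
    (((continuous_id.sub continuous_const).norm).mul continuous_norm).add
      (continuous_const.mul (continuous_id.sub continuous_const).norm)
  have hz := hc.tendsto f
  rw [sub_self, norm_zero, zero_mul, mul_zero, add_zero] at hz
  exact squeeze_zero (g := fun g => ‖g - f‖ * ‖g‖ + ‖f‖ * ‖g - f‖) (fun _ => norm_nonneg _)
    (fun g => norm_contraction_self_sub_le hp hn hq f g) hz

lemma continuous_symmetrize_contraction_self {d : ℕ} (hp : d = r + s) (hn : n = s + s) :
    Continuous fun f : TensorPower d => symmetrize (contraction hp hp hn f f) :=
  continuous_symmetrize.comp (continuous_contraction_self hp hn hp)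

lemma continuous_T3 {d : ℕ} (hd : Even d) : Continuous (T3 hd) := by
  have h2 : Continuous fun f : TensorPower d => symmetrize (contraction (eq_half_add_half hd)
      (eq_half_add_half hd) (eq_half_add_half hd) f f) :=
    continuous_symmetrize_contraction_self _ _
  have h3 : ∀ r : Fin d, Continuous fun f : TensorPower d =>
      symmetrize (contraction (r := r) (s := d - r) (t := d - r) (n := 2 * d - 2 * r)
          (by omega) (by omega) (by omega) f f) := fun r =>
    continuous_symmetrize_contraction_self _ _
  unfold T3
  refine Real.continuous_sqrt.comp ?_
  refine Continuous.add (continuous_const.mul (Continuous.pow (Continuous.norm ?_) 2))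
    (continuous_const.mul (continuous_finsetSum _ fun r _ =>
      continuous_const.mul ((h3 r).norm.pow 2)))
  exact continuous_id.sub ((continuous_const_smul ((d ! : ℝ) ^ 2 / (4 * ((d / 2)! : ℝ) ^ 3))).comp h2)

/-- The fourth moment of an integral is bounded by the fourth power of the norm of its kernel. -/
lemma exists_expect_wick_pow_four_le (d : ℕ) : ∃ A : ℝ, 0 ≤ A ∧ ∀ (N : ℕ) (h : TensorPower d),
    SupportedBelow N h → IsSymmetric h → expect (wick (toPoly N h) ^ 4) ≤ (A * ‖h‖) ^ 4 := by
  set B : ℝ := ∑ r : Fin (d + 1), ((r : ℕ) ! : ℝ)⁻¹ ^ 2 *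
    ((d.descFactorial r : ℝ) ^ 4 * (2 * d - 2 * r : ℕ)!) with hB
  have hB0 : 0 ≤ B := Finset.sum_nonneg fun r _ => by positivity
  -- `1 + B` is used because its fourth power dominates `B` whatever the size of `B`.
  refine ⟨1 + B, by linarith, fun N h hsup hsymm => ?_⟩
  have h1 : expect (wick (toPoly N h) ^ 4) ≤ B * ‖h‖ ^ 4 := by
    rw [hsup.expect_wick_pow_four hsymm, hB, Finset.sum_mul]
    refine Finset.sum_le_sum fun r _ => ?_
    rw [mul_assoc _ _ (‖h‖ ^ 4)]
    gcongr
    calc _ ≤ (‖h‖ * ‖h‖) ^ 2 := by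
          gcongr
          exact (norm_symmetrize_le _).trans (norm_contraction_le _ _ _ _ _)
      _ = _ := by ring
  refine h1.trans ?_
  rw [mul_pow]
  refine mul_le_mul_of_nonneg_right ?_ (by positivity)
  calc B ≤ 1 + B := by linarith
    _ ≤ (1 + B) ^ 4 := le_self_pow₀ (by linarith) (by norm_num)

end Continuity

end WienerChaos

namespace WienerChaos

/-! ## Convergence in `L^p` -/

section Convergence

variable {Ω ι : Type*} [MeasurableSpace Ω] {P : Measure Ω}

/-- Multiplication is continuous from `L^p × L^q` to `L^r`. -/
lemma tendsto_eLpNorm_mul_sub {l : Filter ι} {p q r : ℝ≥0∞} [p.HolderTriple q r] (hr : 1 ≤ r)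
    {u v : ι → Ω → ℝ} {a b : Ω → ℝ} (hu : ∀ i, MemLp (u i) p P) (hv : ∀ i, MemLp (v i) q P)
    (ha : MemLp a p P) (hb : MemLp b q P)
    (hua : Tendsto (fun i => eLpNorm (u i - a) p P) l (𝓝 0))
    (hvb : Tendsto (fun i => eLpNorm (v i - b) q P) l (𝓝 0)) :
    Tendsto (fun i => eLpNorm (u i * v i - a * b) r P) l (𝓝 0) := by
  have hbd : ∀ i, eLpNorm (u i * v i - a * b) r P ≤
      eLpNorm (u i - a) p P * eLpNorm (v i - b) q P + eLpNorm (u i - a) p P * eLpNorm b q P +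
        eLpNorm a p P * eLpNorm (v i - b) q P := by
    intro i
    have mu := ((hu i).sub ha).1
    have mv := ((hv i).sub hb).1
    have : u i * v i - a * b = (u i - a) • (v i - b) + (u i - a) • b + a • (v i - b) := by
      simp only [smul_eq_mul]
      ring
    rw [this]
    refine (eLpNorm_add_le ((mu.smul mv).add (mu.smul hb.1)) (ha.1.smul mv) hr).trans ?_
    gcongr
    · refine (eLpNorm_add_le (mu.smul mv) (mu.smul hb.1) hr).trans ?_
      gcongr
      · exact eLpNorm_smul_le_mul_eLpNorm mv mu
      · exact eLpNorm_smul_le_mul_eLpNorm hb.1 mu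
    · exact eLpNorm_smul_le_mul_eLpNorm mv ha.1
  have hlim : Tendsto (fun i => eLpNorm (u i - a) p P * eLpNorm (v i - b) q P +
      eLpNorm (u i - a) p P * eLpNorm b q P + eLpNorm a p P * eLpNorm (v i - b) q P) l
      (𝓝 (0 * 0 + 0 * eLpNorm b q P + eLpNorm a p P * 0)) :=
    ((ENNReal.Tendsto.mul hua (.inr ENNReal.zero_ne_top) hvb (.inr ENNReal.zero_ne_top)).add
      (ENNReal.Tendsto.mul_const hua (.inr hb.2.ne))).add
      (ENNReal.Tendsto.const_mul hvb (.inr ha.2.ne))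
  simp only [mul_zero, zero_mul, add_zero] at hlim
  exact tendsto_of_tendsto_of_tendsto_of_le_of_le tendsto_const_nhds hlim (fun _ => zero_le) hbd

lemma tendsto_integral_mul {l : Filter ι} {u v : ι → Ω → ℝ} {a b : Ω → ℝ}
    (hu : ∀ i, MemLp (u i) 2 P) (hv : ∀ i, MemLp (v i) 2 P)
    (ha : MemLp a 2 P) (hb : MemLp b 2 P)
    (hua : Tendsto (fun i => eLpNorm (u i - a) 2 P) l (𝓝 0))
    (hvb : Tendsto (fun i => eLpNorm (v i - b) 2 P) l (𝓝 0)) :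
    Tendsto (fun i => ∫ ω, u i ω * v i ω ∂P) l (𝓝 (∫ ω, a ω * b ω ∂P)) :=
  tendsto_integral_of_L1' (a * b) (ha.1.mul hb.1)
    (Eventually.of_forall fun i => (hu i).integrable_mul (hv i))
    (tendsto_eLpNorm_mul_sub le_rfl hu hv ha hb hua hvb)

/-- Convergence in `L⁴` implies convergence of the second, third and fourth moments. -/
lemma tendsto_moments [IsProbabilityMeasure P] {l : Filter ι} {u : ι → Ω → ℝ} {a : Ω → ℝ}
    (hu : ∀ i, MemLp (u i) 4 P) (ha : MemLp a 4 P)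
    (hua : Tendsto (fun i => eLpNorm (u i - a) 4 P) l (𝓝 0)) :
    Tendsto (fun i => ∫ ω, u i ω ^ 2 ∂P) l (𝓝 (∫ ω, a ω ^ 2 ∂P)) ∧
    Tendsto (fun i => ∫ ω, u i ω ^ 3 ∂P) l (𝓝 (∫ ω, a ω ^ 3 ∂P)) ∧
    Tendsto (fun i => ∫ ω, u i ω ^ 4 ∂P) l (𝓝 (∫ ω, a ω ^ 4 ∂P)) := by
  have : ENNReal.HolderTriple 4 4 2 := ⟨by
    rw [← two_mul, show (4 : ℝ≥0∞) = 2 * 2 by norm_num, ENNReal.mul_inv (by simp) (by simp),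
      ← mul_assoc, ENNReal.mul_inv_cancel (by simp) (by simp), one_mul]⟩
  have h24 : (2 : ℝ≥0∞) ≤ 4 := by norm_num
  have hu2 := fun i => (hu i).mono_exponent h24
  have ha2 := ha.mono_exponent h24
  have hua2 : Tendsto (fun i => eLpNorm (u i - a) 2 P) l (𝓝 0) :=
    tendsto_of_tendsto_of_tendsto_of_le_of_le tendsto_const_nhds hua (fun _ => zero_le)
      fun i => eLpNorm_le_eLpNorm_of_exponent_le h24 ((hu i).sub ha).1
  have hsq := tendsto_eLpNorm_mul_sub one_le_two hu hu ha ha hua hua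
  have hus : ∀ i, MemLp (u i * u i) 2 P := fun i => (hu i).mul (hu i)
  have has : MemLp (a * a) 2 P := ha.mul ha
  refine ⟨?_, ?_, ?_⟩
  · simpa only [sq] using tendsto_integral_mul hu2 hu2 ha2 ha2 hua2 hua2
  · simpa only [Pi.mul_apply, pow_succ, pow_zero, one_mul] using
      tendsto_integral_mul hus hu2 has ha2 hsq hua2
  · simpa only [Pi.mul_apply, pow_succ, pow_zero, one_mul, mul_assoc] using
      tendsto_integral_mul hus hus has has hsq hsq

/-- An `L²`-limit of an `L⁴`-Cauchy net is an `L⁴`-limit. -/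
lemma memLp_four_of_tendsto [IsProbabilityMeasure P] {E : Type*} [SeminormedAddCommGroup E]
    [SemilatticeSup ι] [Nonempty ι] {u : ι → Ω → ℝ} {a : Ω → ℝ} {k : ι → E} {x : E} {A : ℝ}
    (hu : ∀ i, MemLp (u i) 4 P) (ha : MemLp a 2 P)
    (hua : Tendsto (fun i => eLpNorm (u i - a) 2 P) atTop (𝓝 0))
    (hk : Tendsto k atTop (𝓝 x))
    (hbd : ∀ i j, eLpNorm (u i - u j) 4 P ≤ ENNReal.ofReal (A * ‖k i - k j‖)) :
    MemLp a 4 P ∧ Tendsto (fun i => eLpNorm (u i - a) 4 P) atTop (𝓝 0) := by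
  have : Fact ((1 : ℝ≥0∞) ≤ 4) := ⟨by norm_num⟩
  have h24 : (2 : ℝ≥0∞) ≤ 4 := by norm_num
  have hbd' : ∀ i j, eLpNorm (u i - u j) 4 P ≤ ENNReal.ofReal (|A| * ‖k i - k j‖) := fun i j =>
    (hbd i j).trans (ENNReal.ofReal_le_ofReal (by gcongr; exact le_abs_self A))
  have hcauchy : CauchySeq fun i => (hu i).toLp := by
    rw [cauchySeq_iff_tendsto_dist_atTop_0]
    have h0 := (cauchySeq_iff_tendsto_dist_atTop_0.1 hk.cauchySeq).const_mul |A|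
    rw [mul_zero] at h0
    refine squeeze_zero (fun _ => dist_nonneg) (fun n => ?_) h0
    rw [Lp.dist_def, dist_eq_norm]
    refine ENNReal.toReal_le_of_le_ofReal (by positivity) ((le_of_eq ?_).trans (hbd' n.1 n.2))
    exact eLpNorm_congr_ae ((hu n.1).coeFn_toLp.sub (hu n.2).coeFn_toLp)
  obtain ⟨b, hb⟩ := cauchySeq_tendsto_of_complete hcauchy
  rw [Lp.tendsto_Lp_iff_tendsto_eLpNorm'] at hb
  have hb' : Tendsto (fun i => eLpNorm (u i - ⇑b) 4 P) atTop (𝓝 0) :=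
    hb.congr fun i => eLpNorm_congr_ae ((hu i).coeFn_toLp.sub EventuallyEq.rfl)
  have hbm := Lp.memLp b
  have hsum : Tendsto (fun i => eLpNorm (u i - a) 2 P + eLpNorm (u i - ⇑b) 4 P) atTop (𝓝 0) := by
    simpa using hua.add hb'
  -- The `L⁴` limit `b`, given by completeness, is compared with `a` in `L²`, where both are limits
  -- of `u`.
  have hle : eLpNorm (a - ⇑b) 2 P ≤ 0 := by
    refine ge_of_tendsto' hsum fun i => ?_
    have h1 : a - ⇑b = (a - u i) + (u i - ⇑b) := by abel
    have hu2 := (hu i).mono_exponent h24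
    rw [h1, eLpNorm_sub_comm (u i) a]
    refine (eLpNorm_add_le (ha.1.sub hu2.1) (hu2.1.sub hbm.1) one_le_two).trans ?_
    gcongr
    exact eLpNorm_le_eLpNorm_of_exponent_le h24 ((hu i).1.sub hbm.1)
  have hab : a =ᵐ[P] b := by
    have := (eLpNorm_eq_zero_iff (ha.1.sub hbm.1) two_ne_zero).1 (le_antisymm hle (zero_le))
    filter_upwards [this] with ω hω
    exact sub_eq_zero.1 hω
  exact ⟨(memLp_congr_ae hab).2 hbm,
    hb'.congr fun i => eLpNorm_congr_ae (EventuallyEq.rfl.sub hab.symm)⟩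

lemma tendsto_integral_comp [IsProbabilityMeasure P] {l : Filter ι} {u : ι → Ω → ℝ} {a : Ω → ℝ}
    (hu : ∀ i, MemLp (u i) 2 P) (ha : MemLp a 2 P)
    (hua : Tendsto (fun i => eLpNorm (u i - a) 2 P) l (𝓝 0)) {g : ℝ → ℝ}
    (hL : LipschitzWith 1 g) (hg : ∀ y, |g y| ≤ 1) :
    Tendsto (fun i => ∫ ω, g (u i ω) ∂P) l (𝓝 (∫ ω, g (a ω) ∂P)) := by
  have hm : ∀ {v : Ω → ℝ}, MemLp v 2 P → AEStronglyMeasurable (fun ω => g (v ω)) P := fun hv =>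
    hL.continuous.comp_aestronglyMeasurable hv.1
  refine tendsto_integral_of_L1' _ (hm ha)
    (Eventually.of_forall fun i => Integrable.of_bound (hm (hu i)) 1 (ae_of_all _ fun ω => hg _)) ?_
  refine tendsto_of_tendsto_of_tendsto_of_le_of_le tendsto_const_nhds hua (fun _ => zero_le)
    fun i => ?_
  refine (eLpNorm_mono_ae (ae_of_all _ fun ω => ?_)).trans
    (eLpNorm_le_eLpNorm_of_exponent_le one_le_two ((hu i).sub ha).1)
  simpa [Real.dist_eq] using hL.dist_le_mul (u i ω) (a ω)

end Convergence

end WienerChaos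

namespace WienerChaos

open MvPolynomial

/-! ## Finite chaos expansions -/

section FiniteChaos

variable {H : Type*} [NormedAddCommGroup H] [InnerProductSpace ℝ H] (e : HilbertBasis ℕ ℝ H)
  {Ω : Type*} (G : ℕ → Ω → ℝ) {d : ℕ}

/-- The kernel `∑_{q ∈ S} c_q ẽ(q)`. -/
noncomputable def finiteKernel (c : MultiIndex d → ℝ) (S : Finset (MultiIndex d)) : TensorPower d :=
  ∑ q ∈ S, c q • symmBasis e q

/-- The random variable `∑_{q ∈ S} c_q Φ(q)`. -/
noncomputable def finiteChaos (c : MultiIndex d → ℝ) (S : Finset (MultiIndex d)) (ω : Ω) : ℝ :=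
  ∑ q ∈ S, c q * hermiteProd G q ω

variable {e G}

lemma isSymmetric_finiteKernel (c : MultiIndex d → ℝ) (S : Finset (MultiIndex d)) :
    IsSymmetric (finiteKernel e c S) := by
  intro σ j
  simp only [finiteKernel, lp.coeFn_sum, Finset.sum_apply, lp.coeFn_smul, Pi.smul_apply]
  exact Finset.sum_congr rfl fun q _ => by rw [symmBasis, isSymmetric_symmetrize _ σ j]

lemma exists_support_lt (S : Finset (MultiIndex d)) :
    ∃ N, ∀ q ∈ S, ∀ k ∈ q.1.support, k < N := by
  classical
  refine ⟨(S.biUnion fun q => q.1.support).sup id + 1, fun q hq k hk => Nat.lt_succ_of_le ?_⟩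
  exact Finset.le_sup (f := id) (Finset.mem_biUnion.2 ⟨q, hq, hk⟩)

lemma exists_finiteChaos_eq (e : HilbertBasis ℕ ℝ H) (G : ℕ → Ω → ℝ) (c : MultiIndex d → ℝ)
    (S : Finset (MultiIndex d)) :
    ∃ N, SupportedBelow N (finiteKernel e c S) ∧ ∀ ω, finiteChaos G c S ω =
      eval (fun i : Fin N => G i ω) (wick (toPoly N (finiteKernel e c S))) := by
  obtain ⟨N, hN⟩ := exists_support_lt S
  refine ⟨N, fun j hj => ?_, fun ω => ?_⟩
  · simp only [finiteKernel, lp.coeFn_sum, Finset.sum_apply, lp.coeFn_smul, Pi.smul_apply]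
    exact Finset.sum_eq_zero fun q hq => by
      rw [supportedBelow_symmBasis e (hN q hq) j hj, smul_zero]
  · simp only [finiteKernel, finiteChaos, map_sum, map_smul, smul_eval]
    exact Finset.sum_congr rfl fun q hq => by rw [eval_wick_toPoly_symmBasis e G (hN q hq)]

variable [MeasurableSpace Ω] {P : Measure Ω}

lemma IsStdGaussianSeq.hasLaw_gaussianPi (hG : IsStdGaussianSeq G P)
    (N : ℕ) : HasLaw (fun ω (i : Fin N) => G i ω) (gaussianPi N) P where
  aemeasurable := aemeasurable_pi_lambda _ fun i => (hG.hasLaw i).aemeasurable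
  map_eq := by
    have hind : iIndepFun (fun i : Fin N => G i) P := hG.indep.precomp Fin.val_injective
    rw [hind.map_fun_eq_pi_map fun i : Fin N => (hG.hasLaw i).aemeasurable]
    simp_rw [(hG.hasLaw _).map_eq]

/-- A finite chaos expansion has the law of a homogeneous Wick polynomial in finitely many
independent standard Gaussian random variables. -/
lemma IsStdGaussianSeq.exists_hasLaw_finiteChaos (hG : IsStdGaussianSeq G P)
    (e : HilbertBasis ℕ ℝ H) (c : MultiIndex d → ℝ) (S : Finset (MultiIndex d)) :
    ∃ N, SupportedBelow N (finiteKernel e c S) ∧ ∀ (u : ℝ → ℝ), Continuous u →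
      ∫ ω, u (finiteChaos G c S ω) ∂P =
        ∫ x, u (eval x (wick (toPoly N (finiteKernel e c S)))) ∂gaussianPi N := by
  obtain ⟨N, h1, h2⟩ := exists_finiteChaos_eq e G c S
  refine ⟨N, h1, fun u hu => ?_⟩
  simp_rw [h2]
  exact (hG.hasLaw_gaussianPi N).integral_comp (f := fun x => u (eval x _))
    (hu.comp (continuous_eval _)).aestronglyMeasurable

lemma IsStdGaussianSeq.memLp_finiteChaos (hG : IsStdGaussianSeq G P)
    (e : HilbertBasis ℕ ℝ H) (c : MultiIndex d → ℝ) (S : Finset (MultiIndex d)) {p : ℝ≥0∞}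
    (hp : p ≠ ∞) : MemLp (finiteChaos G c S) p P := by
  obtain ⟨N, -, h2⟩ := exists_finiteChaos_eq e G c S
  have hl := hG.hasLaw_gaussianPi N
  have := memLp_eval (wick (toPoly N (finiteKernel e c S))) hp
  rw [← hl.map_eq] at this
  have := this.comp_of_map hl.aemeasurable
  exact (funext h2 : finiteChaos G c S = _) ▸ this

/-- The fourth moment of a finite chaos expansion is controlled by its kernel. -/
lemma IsStdGaussianSeq.exists_eLpNorm_four_le (hG : IsStdGaussianSeq G P)
    (e : HilbertBasis ℕ ℝ H) (d : ℕ) : ∃ A : ℝ, ∀ (c : MultiIndex d → ℝ) (S : Finset (MultiIndex d)),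
      eLpNorm (finiteChaos G c S) 4 P ≤ ENNReal.ofReal (A * ‖finiteKernel e c S‖) := by
  obtain ⟨A, hA0, hA⟩ := exists_expect_wick_pow_four_le d
  refine ⟨A, fun c S => ?_⟩
  obtain ⟨N, h1, h2⟩ := hG.exists_hasLaw_finiteChaos e c S
  have h3 := hA N _ h1 (isSymmetric_finiteKernel c S)
  rw [expect_apply] at h3
  simp_rw [map_pow] at h3
  rw [← h2 (fun y => y ^ 4) (continuous_pow 4)] at h3
  rw [(hG.memLp_finiteChaos e c S (by norm_num)).eLpNorm_eq_integral_rpow_norm (by norm_num)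
    (by norm_num)]
  refine ENNReal.ofReal_le_ofReal ?_
  have h4 : ∫ ω, ‖finiteChaos G c S ω‖ ^ ENNReal.toReal 4 ∂P = ∫ ω, finiteChaos G c S ω ^ 4 ∂P := by
    refine integral_congr_ae (ae_of_all _ fun ω => ?_)
    simp only [ENNReal.toReal_ofNat, Real.rpow_ofNat, Real.norm_eq_abs]
    exact Even.pow_abs (by decide) _
  rw [h4, ENNReal.toReal_ofNat]
  refine (Real.rpow_le_rpow (integral_nonneg fun ω => by positivity) h3 (by norm_num)).trans_eq ?_
  rw [← Real.rpow_natCast, ← Real.rpow_mul (by positivity)]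
  norm_num

/-- The difference of two partial sums is itself a finite sum with modified coefficients, so the
`L⁴` bound yields a Cauchy estimate. -/
lemma sum_sub_sum_eq_sum_union {ι M : Type*} [DecidableEq ι] [AddCommGroup M] [Module ℝ M]
    (c : ι → ℝ) (v : ι → M) (S T : Finset ι) :
    ∑ q ∈ S, c q • v q - ∑ q ∈ T, c q • v q =
      ∑ q ∈ S ∪ T, ((if q ∈ S then c q else 0) - (if q ∈ T then c q else 0)) • v q := by
  simp_rw [sub_smul, Finset.sum_sub_distrib, ite_smul, zero_smul]
  rw [Finset.sum_ite_mem, Finset.sum_ite_mem, Finset.union_inter_cancel_left,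
    Finset.union_inter_cancel_right]

lemma IsStdGaussianSeq.exists_eLpNorm_four_sub_le (hG : IsStdGaussianSeq G P)
    (e : HilbertBasis ℕ ℝ H) (c : MultiIndex d → ℝ) : ∃ A : ℝ, ∀ S T : Finset (MultiIndex d),
      eLpNorm (finiteChaos G c S - finiteChaos G c T) 4 P ≤
        ENNReal.ofReal (A * ‖finiteKernel e c S - finiteKernel e c T‖) := by
  classical
  obtain ⟨A, hA⟩ := hG.exists_eLpNorm_four_le e d
  refine ⟨A, fun S T => ?_⟩
  have h := hA (fun q => (if q ∈ S then c q else 0) - (if q ∈ T then c q else 0)) (S ∪ T)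
  rw [finiteKernel, ← sum_sub_sum_eq_sum_union] at h
  refine (le_of_eq ?_).trans h
  congr 1
  funext ω
  exact sum_sub_sum_eq_sum_union c (fun q => hermiteProd G q ω) S T

lemma IsStdGaussianSeq.T3_finiteKernel_sq_le (hG : IsStdGaussianSeq G P)
    (e : HilbertBasis ℕ ℝ H) (hd : Even d) (hd2 : 2 ≤ d) (c : MultiIndex d → ℝ)
    (S : Finset (MultiIndex d)) :
    T3 hd (finiteKernel e c S) ^ 2 ≤ ((d : ℝ) - 1) / (3 * d) *
      ((∫ ω, finiteChaos G c S ω ^ 4 ∂P) - 12 * (∫ ω, finiteChaos G c S ω ^ 3 ∂P) -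
        3 * (∫ ω, finiteChaos G c S ω ^ 2 ∂P) ^ 2 + 24 * ∫ ω, finiteChaos G c S ω ^ 2 ∂P) := by
  obtain ⟨N, h1, h2⟩ := hG.exists_hasLaw_finiteChaos e c S
  have h := steinDiscrepancy_le hd hd2 (isHomogeneous_toPoly (N := N) (finiteKernel e c S))
  simp_rw [expect_apply, map_pow] at h
  rw [← h2 _ (continuous_pow 4), ← h2 _ (continuous_pow 3), ← h2 _ (continuous_pow 2)] at h
  rwa [h1.steinDiscrepancy_toPoly (isSymmetric_finiteKernel c S) hd hd2,
    Real.sq_sqrt (steinDiscrepancy_nonneg _ _)]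

/-- A partial sum need not have variance `2ν`; the defect is kept as an extra term that vanishes in
the limit. -/
lemma IsStdGaussianSeq.abs_integral_comp_finiteChaos_sub_le (hG : IsStdGaussianSeq G P)
    (e : HilbertBasis ℕ ℝ H) (hd : Even d) (hd2 : 2 ≤ d) {ν : ℕ} (hν : 1 ≤ ν)
    (c : MultiIndex d → ℝ) (S : Finset (MultiIndex d)) {g : ℝ → ℝ} (hL : LipschitzWith 1 g)
    (hg : ∀ y, |g y| ≤ 1) :
    |∫ ω, g (finiteChaos G c S ω) ∂P - ∫ z, g z ∂centeredChiSq ν| ≤ √(2 * Real.pi / ν) *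
      √((2 * ν - ∫ ω, finiteChaos G c S ω ^ 2 ∂P) ^ 2 + T3 hd (finiteKernel e c S) ^ 2) := by
  obtain ⟨N, h1, h2⟩ := hG.exists_hasLaw_finiteChaos e c S
  have h := abs_integral_comp_wick_sub_centeredChiSq_le hd hd2
    (isHomogeneous_toPoly (N := N) (finiteKernel e c S)) hν hL hg
  simp_rw [expect_apply, map_pow] at h
  rw [← h2 _ (continuous_pow 2), ← h2 _ hL.continuous] at h
  rwa [h1.steinDiscrepancy_toPoly (isSymmetric_finiteKernel c S) hd hd2,
    Real.sq_sqrt (steinDiscrepancy_nonneg _ _)]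

/-- A chaos integral is an `L⁴`-limit of finite chaos expansions. -/
lemma IsChaosIntegral.exists_tendsto [IsProbabilityMeasure P] (hG : IsStdGaussianSeq G P) {h : TensorPower d} {F : Ω → ℝ}
    (hF : IsChaosIntegral e G P h F) : MemLp F 4 P ∧ ∃ c : MultiIndex d → ℝ,
      Tendsto (finiteKernel e c) atTop (𝓝 h) ∧
      Tendsto (fun S => eLpNorm (finiteChaos G c S - F) 4 P) atTop (𝓝 0) := by
  classical
  obtain ⟨hF2, c, hc, hlim⟩ := hF
  obtain ⟨A, hA⟩ := hG.exists_eLpNorm_four_sub_le e c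
  have hk : Tendsto (finiteKernel e c) atTop (𝓝 h) := hc
  have hlim' : Tendsto (fun S => eLpNorm (finiteChaos G c S - F) 2 P) atTop (𝓝 0) :=
    hlim.congr fun S => eLpNorm_sub_comm F (finiteChaos G c S) 2 P
  obtain ⟨h1, h2⟩ := memLp_four_of_tendsto
    (fun S => hG.memLp_finiteChaos e c S (by norm_num)) hF2 hlim' hk hA
  exact ⟨h1, c, hk, h2⟩

end FiniteChaos

end WienerChaos

/-! ### Passage to the limit along finite chaos expansions -/

theorem theorem3p6 {H : Type*} [NormedAddCommGroup H] [InnerProductSpace ℝ H] [CompleteSpace H]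
    (e : HilbertBasis ℕ ℝ H)
    {Ω : Type*} [MeasurableSpace Ω] (P : Measure Ω) [IsProbabilityMeasure P]
    (G : ℕ → Ω → ℝ) (hG : WienerChaos.IsStdGaussianSeq G P)
    {d : ℕ} (hd : Even d) (hd2 : 2 ≤ d) {ν : ℕ} (hν : 1 ≤ ν)
    (h : WienerChaos.TensorPower d) (hsymm : WienerChaos.IsSymmetric h)
    (F : Ω → ℝ) (hF : WienerChaos.IsChaosIntegral e G P h F)
    (hvar : ∫ ω, F ω ^ 2 ∂P = 2 * ν)
    {Ω' : Type*} [MeasurableSpace Ω'] (P' : Measure Ω') [IsProbabilityMeasure P']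
    (Z : Ω' → ℝ) (hZ : HasLaw Z (WienerChaos.centeredChiSq ν) P') :
    MemLp F 4 P ∧
    WienerChaos.T3 hd h ≤ WienerChaos.T4 P d ν F ∧
    WienerChaos.dBW P F P' Z ≤
      max (Real.sqrt (2 * Real.pi / ν)) (1 / (ν : ℝ) + 2 / (ν : ℝ) ^ 2) * WienerChaos.T3 hd h := by
  obtain ⟨hF4, c, hk, hlim⟩ := hF.exists_tendsto hG
  have h24 : (2 : ℝ≥0∞) ≤ 4 := by norm_num
  have hmem4 : ∀ S, MemLp (WienerChaos.finiteChaos G c S) 4 P := fun S =>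
    hG.memLp_finiteChaos e c S (by norm_num)
  have hlim2 : Tendsto (fun S => eLpNorm (WienerChaos.finiteChaos G c S - F) 2 P) atTop (𝓝 0) :=
    tendsto_of_tendsto_of_tendsto_of_le_of_le tendsto_const_nhds hlim (fun _ => zero_le)
      fun S => eLpNorm_le_eLpNorm_of_exponent_le h24 ((hmem4 S).sub hF4).1
  obtain ⟨m2, m3, m4⟩ := WienerChaos.tendsto_moments hmem4 hF4 hlim
  rw [hvar] at m2
  have hT := ((WienerChaos.continuous_T3 hd).tendsto h).comp hk
  have hT0 : 0 ≤ WienerChaos.T3 hd h := Real.sqrt_nonneg _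
  refine ⟨hF4, ?_, ?_⟩
  · refine Real.le_sqrt_of_sq_le ?_
    -- Both sides of the finite inequality converge; inserting `E F² = 2ν` turns `-3 m² + 24 m` into
    -- `-12 ν² + 48 ν`.
    have key := le_of_tendsto_of_tendsto' (hT.pow 2)
      (((((m4.sub (m3.const_mul 12)).sub ((m2.pow 2).const_mul 3)).add
        (m2.const_mul 24))).const_mul (((d : ℝ) - 1) / (3 * d)))
      (hG.T3_finiteKernel_sq_le e hd hd2 c)
    refine key.trans (mul_le_mul_of_nonneg_left ((le_of_eq ?_).trans (le_abs_self _)) ?_)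
    · ring
    · have : (2 : ℝ) ≤ d := by exact_mod_cast hd2
      exact div_nonneg (by linarith) (by linarith)
  -- The supremum is over a nonempty set, as the test function `0` shows.
  · refine csSup_le ⟨_, 0, LipschitzWith.const' 0 |>.weaken zero_le, by simp, rfl⟩ ?_
    rintro x ⟨g, hL, hg, rfl⟩
    have hZg : ∫ ω, g (Z ω) ∂P' = ∫ z, g z ∂WienerChaos.centeredChiSq ν :=
      hZ.integral_comp (f := g) hL.continuous.aestronglyMeasurable
    rw [hZg]
    have hgF := WienerChaos.tendsto_integral_comp (fun S => (hmem4 S).mono_exponent h24)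
      (hF4.mono_exponent h24) hlim2 hL hg
    have key := le_of_tendsto_of_tendsto' (hgF.sub_const _).abs
      ((((m2.const_sub (2 * (ν : ℝ))).pow 2).add (hT.pow 2)).sqrt.const_mul (√(2 * Real.pi / ν)))
      (fun S => hG.abs_integral_comp_finiteChaos_sub_le e hd hd2 hν c S hL hg)
    -- The variance defect has disappeared in the limit, and the first entry of the maximum is
    -- already a valid constant.
    rw [sub_self, zero_pow two_ne_zero, zero_add, Real.sqrt_sq hT0] at key
    exact key.trans (mul_le_mul_of_nonneg_right (le_max_left _ _) hT0)
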